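/- Let $N\ge 1$ be an integer, $1<p<2$, $0<s<1$, $0<C_1\le C_2$, and put $p_c=\frac{2N}{N+2s}$ and $\lambda_r=N(p-2)+rps$. Let $\Omega\subset\mathbb R^N$ be open, $T\in(0,\infty]$, and let $K:\mathbb R^N\times\mathbb R^N\times(0,T)\to\mathbb R$ be measurable with, almost everywhere, $K(x,y,\tau)=K(y,x,\tau)$ and $C_1\le K(x,y,\tau)|x-y|^{N+ps}\le C_2$. All suprema below are essential suprema, $\sup_{t_1<\tau<t_2}$ over times included, and inequalities between functions hold almost everywhere. $U\Subset\Omega$ means that $U$ is open with compact closure contained in $\Omega$; $W^{s,p}_0(U)$ is the set of functions in $W^{s,p}(\mathbb R^N)$ that vanish a.e. outside $U$. A measurable $u:\mathbb R^N\times(0,T)\to\mathbb R$ is a *local weak solution* of $u_t+\mathcal L_Ku=0$ in $\Omega\times(0,T)$ if $u\in C((0,T);L^2_{\rm loc}(\Omega))\cap L^p_{\rm loc}(0,T;W^{s,p}_{\rm loc}(\Omega))$ and, for all $0<t_1<t_2<T$, $$\sup_{t_1<\tau<t_2}\int_{\mathbb R^N}\frac{|u(x,\tau)|^{p-1}}{(1+|x|)^{N+ps}}\,dx<\infty,$$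 and for all $U\Subset\Omega$ and all $\varphi\in W^{1,2}_{\rm loc}(0,T;L^2(U))\cap L^p_{\rm loc}(0,T;W^{s,p}_0(U))$ $$0=\int_U u\varphi\,dx\Big|_{t_1}^{t_2}-\int_{t_1}^{t_2}\!\int_U u\varphi_\tau\,dx\,d\tau+\int_{t_1}^{t_2}\!\iint_{\mathbb R^N\times\mathbb R^N}|u(x,\tau)-u(y,\tau)|^{p-2}(u(x,\tau)-u(y,\tau))(\varphi(x,\tau)-\varphi(y,\tau))K(x,y,\tau)\,dx\,dy\,d\tau .$$ It is *locally bounded* if $u\in L^\infty(U\times(t_1,t_2))$ for all $U\Subset\Omega$ and $0<t_1<t_2<T$. The nonlocal tail is $$\mathrm{Tail}(v,x_0,\rho,t_1,t_2)=\sup_{t_1<\tau<t_2}\Big[\rho^{ps}\int_{\mathbb R^N\setminus B_\rho(x_0)}\frac{|v(x,\tau)|^{p-1}}{|x-x_0|^{N+ps}}\,dx\Big]^{\frac1{p-1}}\in[0,\infty].$$ **(i) ($L^r$-$L^\infty$ estimate)** Let $r\ge1$ satisfy $\lambda_r>0$, and suppose $r<2$ in case $p>p_c$. Then there is a constant $\gamma>0$,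 depending only on $N,p,s,C_1,C_2,r$, such that for all $\Omega,T,K$ as above, every locally bounded local weak solution $u$, and all $x_0\in\mathbb R^N$, $\rho>0$, $0<t\le T$, $t<\infty$, with $B_{4\rho}(x_0)\subset\Omega$ and $u\ge0$ in $B_{4\rho}(x_0)\times(0,t)$, $$\sup_{B_{\rho/2}(x_0)\times(t/2,t)}u\le\gamma\Big[\frac1{|B_\rho(x_0)\times(0,t)|}\int_0^t\!\int_{B_\rho(x_0)}u^r\,dx\,d\tau\Big]^{\frac{ps}{\lambda_r}}\Big(\frac t{\rho^{ps}}\Big)^{-\frac N{\lambda_r}}+\gamma\Big(\frac t{\rho^{ps}}\Big)^{\frac1{2-p}}\max\Big\{1,\Big(\frac t{\rho^{ps}}\Big)^{\frac{1-p}{2-p}}\mathrm{Tail}\Big(u_+,x_0,\frac\rho2,0,t\Big)^{p-1}\Big\},$$ where the right-hand side may be $+\infty$. **(ii) (Local boundedness)** If $p>p_c$, then every local weak solution of $u_t+\mathcal L_Ku=0$ in $\Omega\times(0,T)$ is locally bounded. -/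

import Mathlib

open MeasureTheory Set Filter Topology
open scoped ENNReal ContDiff

noncomputable section

namespace FracPLap

/-- Euclidean space `ℝ^N`. -/
abbrev RN (N : ℕ) := EuclideanSpace ℝ (Fin N)

/-- The time interval `(0, T)`, where `T ∈ (0, ∞]` is an extended real. -/
def timeDom (T : EReal) : Set ℝ := {τ | 0 < τ ∧ (τ : EReal) < T}

/-- `U ⋐ Ω`: `U` is open and its closure is a compact subset of `Ω`. -/
def CompactlyIn {N : ℕ} (U Ω : Set (RN N)) : Prop :=
  IsOpen U ∧ IsCompact (closure U) ∧ closure U ⊆ Ω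

/-- The kernels: measurable on `ℝ^N × ℝ^N × (0,T)`, symmetric in `(x,y)`, and
`C₁ ≤ K(x,y,τ) |x-y|^{N+ps} ≤ C₂`, almost everywhere. -/
structure IsKernel (N : ℕ) (p s C₁ C₂ : ℝ) (T : EReal) (K : RN N × RN N × ℝ → ℝ) : Prop where
  aemeasurable : AEMeasurable K (volume.restrict (univ ×ˢ univ ×ˢ timeDom T))
  symm : ∀ᵐ q ∂(volume.restrict (univ ×ˢ univ ×ˢ timeDom T) : Measure (RN N × RN N × ℝ)),
    K (q.1, q.2.1, q.2.2) = K (q.2.1, q.1, q.2.2)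
  bounds : ∀ᵐ q ∂(volume.restrict (univ ×ˢ univ ×ˢ timeDom T) : Measure (RN N × RN N × ℝ)),
    C₁ ≤ K q * ‖q.1 - q.2.1‖ ^ ((N : ℝ) + p * s) ∧
      K q * ‖q.1 - q.2.1‖ ^ ((N : ℝ) + p * s) ≤ C₂

/-- The `p`-th power of the Gagliardo seminorm,
`∬_{U×U} |f(x)-f(y)|^p / |x-y|^{N+ps} dx dy`. -/
def gagliardoPow {N : ℕ} (s p : ℝ) (U : Set (RN N)) (f : RN N → ℝ) : ℝ≥0∞ :=
  ∫⁻ z in U ×ˢ U, ENNReal.ofReal (|f z.1 - f z.2| ^ p / ‖z.1 - z.2‖ ^ ((N : ℝ) + p * s))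

/-- The `p`-th power of the norm of `W^{s,p}(U)`. -/
def sobolevPow {N : ℕ} (s p : ℝ) (U : Set (RN N)) (f : RN N → ℝ) : ℝ≥0∞ :=
  (∫⁻ x in U, ENNReal.ofReal (|f x| ^ p)) + gagliardoPow s p U f

/-- `u ∈ L^p_loc(0,T; W^{s,p}(U))` (for `u` measurable). -/
def LpLocSobolev {N : ℕ} (s p : ℝ) (U : Set (RN N)) (T : EReal) (u : RN N × ℝ → ℝ) : Prop :=
  ∀ t₁ t₂ : ℝ, 0 < t₁ → t₁ < t₂ → (t₂ : EReal) < T →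
    ∫⁻ τ in Ioo t₁ t₂, sobolevPow s p U (fun x => u (x, τ)) < ⊤

/-- `u ∈ C(0,T; L²(U))`: every time slice is in `L²(U)`, and the slices depend continuously in
`L²(U)` on the time in the open interval `(0,T)`. -/
def ContL2 {N : ℕ} (U : Set (RN N)) (T : EReal) (u : RN N × ℝ → ℝ) : Prop :=
  (∀ τ ∈ timeDom T, MemLp (fun x => u (x, τ)) 2 (volume.restrict U)) ∧
  ∀ τ₀ ∈ timeDom T,
    Tendsto (fun τ => eLpNorm (fun x => u (x, τ) - u (x, τ₀)) 2 (volume.restrict U))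
      (𝓝 τ₀) (𝓝 0)

/-- `φ ∈ W^{1,2}_loc(0,T; L²(U)) ∩ L^p_loc(0,T; W^{s,p}_0(U))` with weak time derivative
`φ_τ = ψ`. Here `W^{s,p}_0(U)` is the set of functions in `W^{s,p}(ℝ^N)` that vanish a.e. outside
`U`. As usual `φ` is the representative that is continuous in time with values in `L²(U)`. -/
structure IsTestFunction {N : ℕ} (s p : ℝ) (U : Set (RN N)) (T : EReal)
    (φ ψ : RN N × ℝ → ℝ) : Prop where
  aemeasurable : AEMeasurable φ (volume.restrict (univ ×ˢ timeDom T))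
  vanish : ∀ᵐ z ∂(volume.restrict (Uᶜ ×ˢ timeDom T) : Measure (RN N × ℝ)), φ z = 0
  sobolev : LpLocSobolev s p univ T φ
  cont : ContL2 U T φ
  deriv_aemeasurable : AEMeasurable ψ (volume.restrict (U ×ˢ timeDom T))
  deriv_sq : ∀ t₁ t₂ : ℝ, 0 < t₁ → t₁ < t₂ → (t₂ : EReal) < T →
    ∫⁻ τ in Ioo t₁ t₂, ∫⁻ x in U, ENNReal.ofReal (ψ (x, τ) ^ 2) < ⊤
  weak_deriv : ∀ η : ℝ → ℝ, ContDiff ℝ ∞ η → HasCompactSupport η → tsupport η ⊆ timeDom T →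
    ∀ᵐ x ∂(volume.restrict U),
      ∫ τ in timeDom T, φ (x, τ) * deriv η τ = - ∫ τ in timeDom T, ψ (x, τ) * η τ

/-- `u` is a local weak solution of `u_t + L_K u = 0` in `Ω × (0,T)`. Suprema in time are
essential suprema. -/
structure IsLocalWeakSolution {N : ℕ} (p s : ℝ) (Ω : Set (RN N)) (T : EReal)
    (K : RN N × RN N × ℝ → ℝ) (u : RN N × ℝ → ℝ) : Prop where
  aemeasurable : AEMeasurable u (volume.restrict (univ ×ˢ timeDom T))
  cont : ∀ U : Set (RN N), CompactlyIn U Ω → ContL2 U T u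
  sobolev : ∀ U : Set (RN N), CompactlyIn U Ω → LpLocSobolev s p U T u
  weak : ∀ U : Set (RN N), CompactlyIn U Ω →
    ∀ t₁ t₂ : ℝ, 0 < t₁ → t₁ < t₂ → (t₂ : EReal) < T →
    ∀ φ ψ : RN N × ℝ → ℝ, IsTestFunction s p U T φ ψ →
      0 = ((∫ x in U, u (x, t₂) * φ (x, t₂)) - ∫ x in U, u (x, t₁) * φ (x, t₁))
        - (∫ τ in Ioo t₁ t₂, ∫ x in U, u (x, τ) * ψ (x, τ))
        + ∫ τ in Ioo t₁ t₂, ∫ z : RN N × RN N,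
            |u (z.1, τ) - u (z.2, τ)| ^ (p - 2) * (u (z.1, τ) - u (z.2, τ))
              * (φ (z.1, τ) - φ (z.2, τ)) * K (z.1, z.2, τ)
  tail : ∀ t₁ t₂ : ℝ, 0 < t₁ → t₁ < t₂ → (t₂ : EReal) < T →
    essSup (fun τ => ∫⁻ x : RN N,
        ENNReal.ofReal (|u (x, τ)| ^ (p - 1) / (1 + ‖x‖) ^ ((N : ℝ) + p * s)))
      (volume.restrict (Ioo t₁ t₂)) < ⊤

/-- `u ∈ L^∞_loc(Ω × (0,T))`. -/
def IsLocallyBounded {N : ℕ} (Ω : Set (RN N)) (T : EReal) (u : RN N × ℝ → ℝ) : Prop :=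
  ∀ U : Set (RN N), CompactlyIn U Ω → ∀ t₁ t₂ : ℝ, 0 < t₁ → t₁ < t₂ → (t₂ : EReal) < T →
    ∃ M : ℝ, ∀ᵐ z ∂(volume.restrict (U ×ˢ Ioo t₁ t₂)), |u z| ≤ M

/-- The nonlocal tail, with values in `[0,∞]`:
`sup_{t₁<τ<t₂} [ρ^{ps} ∫_{B_ρ(x₀)^c} |u(x,τ)|^{p-1} / |x-x₀|^{N+ps} dx]^{1/(p-1)}`
(essential supremum in time). -/
def Tail {N : ℕ} (p s : ℝ) (u : RN N × ℝ → ℝ) (x₀ : RN N) (ρ t₁ t₂ : ℝ) : ℝ≥0∞ :=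
  essSup (fun τ =>
      (ENNReal.ofReal (ρ ^ (p * s)) * ∫⁻ x in (Metric.ball x₀ ρ)ᶜ,
        ENNReal.ofReal (|u (x, τ)| ^ (p - 1) / ‖x - x₀‖ ^ ((N : ℝ) + p * s))) ^ (1 / (p - 1)))
    (volume.restrict (Ioo t₁ t₂))

/-- `λ_r = N(p-2) + rps`. -/
def lam (N : ℕ) (p s r : ℝ) : ℝ := (N : ℝ) * (p - 2) + r * p * s

/-- The critical exponent `p_c = 2N/(N+2s)`. -/
def pCrit (N : ℕ) (s : ℝ) : ℝ := 2 * (N : ℝ) / ((N : ℝ) + 2 * s)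

end FracPLap

end

open FracPLap

open MeasureTheory Set Filter Topology
open scoped ENNReal ContDiff
open FracPLap

namespace FracPLap

/-- The odd power function `d ↦ |d|^{p-2} d`. -/
noncomputable def oddPow (p d : ℝ) : ℝ := |d| ^ (p - 2) * d

lemma oddPow_of_nonneg {p d : ℝ} (hp : 1 < p) (hd : 0 ≤ d) : oddPow p d = d ^ (p - 1) := by
  rw [oddPow, abs_of_nonneg hd, ← Real.rpow_add_one' hd (by linarith)]
  ring_nf

lemma oddPow_neg (p d : ℝ) : oddPow p (-d) = -oddPow p d := by
  simp [oddPow]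

lemma abs_oddPow {p : ℝ} (hp : 1 < p) (d : ℝ) : |oddPow p d| = |d| ^ (p - 1) := by
  rw [oddPow, abs_mul, abs_of_nonneg (Real.rpow_nonneg (abs_nonneg d) _),
    ← Real.rpow_add_one' (abs_nonneg d) (by linarith)]
  ring_nf

lemma measurable_oddPow (p : ℝ) : Measurable (oddPow p) := by
  unfold oddPow; fun_prop

lemma rpow_sub_rpow_le {p x y : ℝ} (hp : 1 < p) (hx : 0 ≤ x) (hxy : x ≤ y) :
    y ^ p - x ^ p ≤ p * y ^ (p - 1) * (y - x) := by
  rcases (hx.trans hxy).eq_or_lt with rfl | hy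
  · obtain rfl : x = 0 := le_antisymm hxy hx
    simp
  have h := one_add_mul_self_le_rpow_one_add (s := x / y - 1) (p := p)
    (by have := div_nonneg hx hy.le; linarith) hp.le
  have h1 : (1 + (x / y - 1)) = x / y := by ring
  rw [h1, Real.div_rpow hx hy.le, le_div_iff₀ (Real.rpow_pos_of_pos hy p)] at h
  have h2 : y ^ p = y ^ (p - 1) * y := by
    rw [← Real.rpow_add_one' hy.le (by linarith)]; ring_nf
  have h3 : (1 + p * (x / y - 1)) * y ^ p = y ^ p + p * y ^ (p - 1) * (x - y) := by
    rw [h2]; field_simp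
  linarith

lemma rpow_sub_one_mul_self {p x : ℝ} (hp : 1 < p) (hx : 0 ≤ x) : x ^ (p - 1) * x = x ^ p := by
  rw [← Real.rpow_add_one' hx (by linarith)]; ring_nf

lemma young_absorb {p X Y : ℝ} (hp : 1 < p) (hp2 : p < 2) (hX : 0 ≤ X) (hY : 0 ≤ Y) :
    p * X ^ (p - 1) * Y ≤ 1 / 2 * X ^ p + 8 * Y ^ p := by
  have hXp := rpow_sub_one_mul_self hp hX
  have hYp := rpow_sub_one_mul_self hp hY
  have hX1 : 0 ≤ X ^ (p - 1) := Real.rpow_nonneg hX _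
  have hY1 : 0 ≤ Y ^ (p - 1) := Real.rpow_nonneg hY _
  have hYp0 : 0 ≤ Y ^ p := Real.rpow_nonneg hY _
  have hXp0 : 0 ≤ X ^ p := Real.rpow_nonneg hX _
  by_cases h : 2 * p * Y ≤ X
  · have : X ^ (p - 1) * (2 * p * Y) ≤ X ^ (p - 1) * X := mul_le_mul_of_nonneg_left h hX1
    nlinarith
  · have h4 : X ≤ 4 * Y := by nlinarith
    have h5 : X ^ (p - 1) ≤ (4 * Y) ^ (p - 1) := Real.rpow_le_rpow hX h4 (by linarith)
    rw [Real.mul_rpow (by norm_num) hY] at h5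
    have h6 : (4 : ℝ) ^ (p - 1) ≤ 4 ^ (1 : ℝ) :=
      Real.rpow_le_rpow_of_exponent_le (by norm_num) (by linarith)
    rw [Real.rpow_one] at h6
    have h7 : X ^ (p - 1) ≤ 4 * Y ^ (p - 1) := h5.trans (by gcongr)
    have h8 : X ^ (p - 1) * Y ≤ 4 * Y ^ p := by rw [← hYp]; nlinarith
    nlinarith

lemma add_rpow_le_two_mul {p X Y : ℝ} (hp : 1 < p) (hp2 : p < 2) (hX : 0 ≤ X) (hY : 0 ≤ Y) :
    (X + Y) ^ p ≤ 2 * (X ^ p + Y ^ p) := by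
  lift X to NNReal using hX
  lift Y to NNReal using hY
  have h : ((X : ℝ) + Y) ^ p ≤ 2 ^ (p - 1) * ((X : ℝ) ^ p + (Y : ℝ) ^ p) := by
    exact_mod_cast NNReal.rpow_add_le_mul_rpow_add_rpow X Y hp.le
  refine h.trans ?_
  have : (2 : ℝ) ^ (p - 1) ≤ 2 ^ (1 : ℝ) :=
    Real.rpow_le_rpow_of_exponent_le (by norm_num) (by linarith)
  rw [Real.rpow_one] at this
  gcongr

/-- The algebraic inequality behind the Caccioppoli estimate, when `b ≤ a`. -/
lemma oddPow_mul_ge_of_le {p a b k z₁ z₂ : ℝ} (hp : 1 < p) (hp2 : p < 2) (hba : b ≤ a)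
    (h1 : 0 ≤ z₁) (h2 : 0 ≤ z₂) :
    1 / 4 * |max (a - k) 0 * z₁ - max (b - k) 0 * z₂| ^ p
        - 9 * (max (a - k) 0 * |z₁ - z₂|) ^ p
      ≤ oddPow p (a - b) * (max (a - k) 0 * z₁ ^ p - max (b - k) 0 * z₂ ^ p) := by
  set A := max (a - k) 0 with hA
  set B := max (b - k) 0 with hB
  have hA0 : 0 ≤ A := le_max_right _ _
  have hB0 : 0 ≤ B := le_max_right _ _
  have hAB : B ≤ A := max_le_max (by linarith) le_rfl
  have he : A - B ≤ a - b := by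
    rcases le_total (a - k) 0 with h | h
    · rw [hA, max_eq_right h]; linarith
    · rw [hA, max_eq_left h]
      have : b - k ≤ B := le_max_left _ _
      linarith
  have he0 : 0 ≤ A - B := by linarith
  rw [oddPow_of_nonneg hp (by linarith)]
  set Z := max z₁ z₂ with hZ
  have hZ0 : 0 ≤ Z := h1.trans (le_max_left _ _)
  have key : 1 / 2 * ((A - B) * Z) ^ p - 8 * (A * |z₁ - z₂|) ^ p
      ≤ (A - B) ^ (p - 1) * (A * z₁ ^ p - B * z₂ ^ p) := by
    have hn1 : 0 ≤ (A * |z₁ - z₂|) ^ p := by positivity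
    have hem := rpow_sub_one_mul_self hp he0
    have hz2 : 0 ≤ z₂ ^ p := by positivity
    have hz1 : 0 ≤ z₁ ^ p := by positivity
    have hee : 0 ≤ (A - B) ^ (p - 1) := by positivity
    have hee' : 0 ≤ (A - B) ^ p := by positivity
    rcases le_total z₂ z₁ with h | h
    · rw [hZ, max_eq_left h, Real.mul_rpow he0 h1]
      have : z₂ ^ p ≤ z₁ ^ p := Real.rpow_le_rpow h2 h (by linarith)
      have h3 : (A - B) * z₁ ^ p ≤ A * z₁ ^ p - B * z₂ ^ p := by nlinarith
      have h4 := mul_le_mul_of_nonneg_left h3 hee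
      rw [← mul_assoc, hem] at h4
      nlinarith [mul_nonneg hee' hz1]
    · rw [hZ, max_eq_right h, abs_sub_comm, abs_of_nonneg (by linarith)]
      have h3 := rpow_sub_rpow_le hp h1 h
      have h4 := young_absorb hp hp2 (mul_nonneg he0 h2) (mul_nonneg hA0 (sub_nonneg.2 h))
      have h5 : A * z₁ ^ p - B * z₂ ^ p ≥
          (A - B) * z₂ ^ p - A * (p * z₂ ^ (p - 1) * (z₂ - z₁)) := by
        nlinarith
      have h6 := mul_le_mul_of_nonneg_left h5.le hee
      rw [Real.mul_rpow he0 h2] at h4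
      have h7 : (A - B) ^ (p - 1) * ((A - B) * z₂ ^ p - A * (p * z₂ ^ (p - 1) * (z₂ - z₁)))
          = ((A - B) * z₂) ^ p - p * ((A - B) ^ (p - 1) * z₂ ^ (p - 1)) * (A * (z₂ - z₁)) := by
        rw [Real.mul_rpow he0 h2, ← hem]; ring
      rw [h7] at h6
      linarith
  have h8 : |A * z₁ - B * z₂| ≤ (A - B) * Z + A * |z₁ - z₂| := by
    have hz1 : z₁ ≤ Z := le_max_left _ _
    have hz2 : z₂ ≤ Z := le_max_right _ _
    have e1 := le_abs_self (z₁ - z₂)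
    have e2 := neg_abs_le (z₁ - z₂)
    rw [abs_le]
    constructor <;> nlinarith
  have h9 : |A * z₁ - B * z₂| ^ p ≤ 2 * (((A - B) * Z) ^ p + (A * |z₁ - z₂|) ^ p) :=
    (Real.rpow_le_rpow (abs_nonneg _) h8 (by linarith)).trans
      (add_rpow_le_two_mul hp hp2 (by positivity) (by positivity))
  have h10 : (A - B) ^ (p - 1) * (A * z₁ ^ p - B * z₂ ^ p)
      ≤ (a - b) ^ (p - 1) * (A * z₁ ^ p - B * z₂ ^ p) := by
    rcases le_total 0 (A * z₁ ^ p - B * z₂ ^ p) with h | h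
    · exact mul_le_mul_of_nonneg_right (Real.rpow_le_rpow he0 he (by linarith)) h
    · have hAB' : A - B = a - b ∨ A * z₁ ^ p - B * z₂ ^ p = 0 := by
        by_cases hb : b - k ≤ 0
        · right
          have : B = 0 := max_eq_right hb
          rw [this] at h ⊢
          have : 0 ≤ A * z₁ ^ p := by positivity
          linarith
        · left
          rw [hA, hB, max_eq_left (by linarith), max_eq_left (by linarith)]; ring
      rcases hAB' with h' | h'
      · rw [h']
      · rw [h']; simp
  have h11 : 0 ≤ (A * |z₁ - z₂|) ^ p := by positivity
  linarith

lemma oddPow_mul_ge {p a b k z₁ z₂ : ℝ} (hp : 1 < p) (hp2 : p < 2)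
    (h1 : 0 ≤ z₁) (h2 : 0 ≤ z₂) :
    1 / 4 * |max (a - k) 0 * z₁ - max (b - k) 0 * z₂| ^ p
        - 9 * (max (a - k) 0 ^ p + max (b - k) 0 ^ p) * |z₁ - z₂| ^ p
      ≤ oddPow p (a - b) * (max (a - k) 0 * z₁ ^ p - max (b - k) 0 * z₂ ^ p) := by
  have hA : 0 ≤ max (a - k) 0 := le_max_right _ _
  have hB : 0 ≤ max (b - k) 0 := le_max_right _ _
  have hz : 0 ≤ |z₁ - z₂| ^ p := by positivity
  have hAp : 0 ≤ max (a - k) 0 ^ p := by positivity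
  have hBp : 0 ≤ max (b - k) 0 ^ p := by positivity
  rcases le_total b a with h | h
  · have := oddPow_mul_ge_of_le (k := k) hp hp2 h h1 h2
    rw [Real.mul_rpow hA (abs_nonneg _)] at this
    nlinarith [mul_nonneg hBp hz]
  · have := oddPow_mul_ge_of_le (k := k) hp hp2 h h2 h1
    rw [Real.mul_rpow hB (abs_nonneg _), abs_sub_comm, abs_sub_comm z₂,
      ← neg_sub a b, oddPow_neg] at this
    nlinarith [mul_nonneg hAp hz]

/-- The lower bound when the second point lies outside the support of the cutoff. -/
lemma oddPow_mul_ge_tail {p a b k z : ℝ} (hp : 1 < p) (hk : 0 ≤ k) (hz : 0 ≤ z) :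
    -(max b 0 ^ (p - 1) * (max (a - k) 0 * z)) ≤ oddPow p (a - b) * (max (a - k) 0 * z) := by
  rcases le_total (a - k) 0 with h | h
  · simp [max_eq_right h]
  have hw : 0 ≤ max (a - k) 0 * z := by positivity
  rw [← neg_mul]
  refine mul_le_mul_of_nonneg_right ?_ hw
  have hm : 0 ≤ max b 0 ^ (p - 1) := Real.rpow_nonneg (le_max_right _ _) _
  rcases le_total b a with hab | hab
  · rw [oddPow_of_nonneg hp (by linarith)]
    have : 0 ≤ (a - b) ^ (p - 1) := Real.rpow_nonneg (by linarith) _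
    linarith
  · rw [← neg_sub b a, oddPow_neg, oddPow_of_nonneg hp (by linarith), neg_le_neg_iff]
    exact Real.rpow_le_rpow (by linarith) (by linarith [le_max_left b 0]) (by linarith)

/-- `∫ min(1,|y|)^p |y|^{-N-ps} dy`. -/
noncomputable def cutoffMass (N : ℕ) (p s : ℝ) : ℝ :=
  ∫ y : RN N, min 1 ‖y‖ ^ p / ‖y‖ ^ ((N : ℝ) + p * s)

lemma finrank_RN (N : ℕ) : Module.finrank ℝ (RN N) = N := by simp

lemma integrable_cutoffKernel {N : ℕ} (hN : 1 ≤ N) {p s : ℝ} (hp : 1 < p) (hs₀ : 0 < s)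
    (hs₁ : s < 1) :
    Integrable (fun y : RN N => min 1 ‖y‖ ^ p / ‖y‖ ^ ((N : ℝ) + p * s)) := by
  have : Nontrivial (RN N) := by
    have : Nonempty (Fin N) := ⟨⟨0, hN⟩⟩
    infer_instance
  have hps : 0 < p * s := by positivity
  rw [integrable_fun_norm_addHaar (μ := (volume : Measure (RN N)))
    (f := fun r => min 1 r ^ p / r ^ ((N : ℝ) + p * s)), finrank_RN,
    ← Ioc_union_Ioi_eq_Ioi zero_le_one]
  have hpow : ∀ y : ℝ, 0 < y → y ^ (N - 1) = y ^ ((N : ℝ) - 1) := by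
    intro y hy
    rw [← Real.rpow_natCast, Nat.cast_sub hN, Nat.cast_one]
  refine IntegrableOn.union ?_ ?_
  · have h1 : IntegrableOn (fun y : ℝ => y ^ (p - 1 - p * s)) (Ioc 0 1) := by
      rw [← intervalIntegrable_iff_integrableOn_Ioc_of_le zero_le_one]
      exact intervalIntegral.intervalIntegrable_rpow' (by nlinarith)
    refine h1.congr_fun (fun y hy => ?_) measurableSet_Ioc
    simp only [smul_eq_mul]
    rw [hpow y hy.1, min_eq_right hy.2, div_eq_mul_inv, ← Real.rpow_neg hy.1.le,
      ← Real.rpow_add hy.1, ← Real.rpow_add hy.1]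
    ring_nf
  · have h1 : IntegrableOn (fun y : ℝ => y ^ (- 1 - p * s)) (Ioi 1) :=
      integrableOn_Ioi_rpow_of_lt (by linarith) one_pos
    refine h1.congr_fun (fun y hy => ?_) measurableSet_Ioi
    have hy : 1 < y := hy
    have hy0 : 0 < y := by linarith
    simp only [smul_eq_mul]
    rw [hpow y hy0, min_eq_left hy.le, Real.one_rpow, one_div, ← Real.rpow_neg hy0.le,
      ← Real.rpow_add hy0]
    ring_nf

lemma cutoffMass_nonneg (N : ℕ) (p s : ℝ) : 0 ≤ cutoffMass N p s :=
  integral_nonneg fun _ => by positivity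

lemma lintegral_cutoffKernel {N : ℕ} (hN : 1 ≤ N) {p s L : ℝ} (hp : 1 < p) (hs₀ : 0 < s)
    (hs₁ : s < 1) (hL : 0 < L) (x : RN N) :
    ∫⁻ y : RN N, ENNReal.ofReal (min 1 (L * ‖x - y‖) ^ p / ‖x - y‖ ^ ((N : ℝ) + p * s))
      = ENNReal.ofReal (L ^ (p * s) * cutoffMass N p s) := by
  have hI := integrable_cutoffKernel hN hp hs₀ hs₁
  rw [lintegral_sub_left_eq_self (fun y : RN N =>
    ENNReal.ofReal (min 1 (L * ‖y‖) ^ p / ‖y‖ ^ ((N : ℝ) + p * s)))]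
  have hF : (fun y : RN N => min 1 (L * ‖y‖) ^ p / ‖y‖ ^ ((N : ℝ) + p * s))
      = fun y => L ^ ((N : ℝ) + p * s) *
        (fun y : RN N => min 1 ‖y‖ ^ p / ‖y‖ ^ ((N : ℝ) + p * s)) (L • y) := by
    funext y
    simp only [norm_smul, Real.norm_eq_abs, abs_of_pos hL]
    rw [Real.mul_rpow hL.le (norm_nonneg _)]
    have : L ^ ((N : ℝ) + p * s) ≠ 0 := (Real.rpow_pos_of_pos hL _).ne'
    rcases eq_or_ne (‖y‖ ^ ((N : ℝ) + p * s)) 0 with h | h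
    · simp [h]
    · field_simp
  rw [← ofReal_integral_eq_lintegral_ofReal]
  · congr 1
    rw [hF, integral_const_mul, Measure.integral_comp_smul volume
        (fun y : RN N => min 1 ‖y‖ ^ p / ‖y‖ ^ ((N : ℝ) + p * s)), finrank_RN,
      abs_of_pos (by positivity), smul_eq_mul, ← mul_assoc,
      ← Real.rpow_natCast, ← Real.rpow_neg hL.le, ← Real.rpow_add hL]
    simp [cutoffMass]
  · rw [hF]
    exact (hI.comp_smul hL.ne').const_mul _
  · exact Eventually.of_forall fun y => by positivity

lemma volume_ball_RN {N : ℕ} (x : RN N) {R : ℝ} (hR : 0 < R) :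
    volume (Metric.ball x R)
      = ENNReal.ofReal (R ^ N * (volume (Metric.ball (0 : RN N) 1)).toReal) := by
  rw [Measure.addHaar_ball_of_pos _ _ hR, finrank_RN, ENNReal.ofReal_mul (by positivity),
    ENNReal.ofReal_toReal measure_ball_lt_top.ne]

lemma volume_unitBall_pos (N : ℕ) : 0 < (volume (Metric.ball (0 : RN N) 1)).toReal :=
  ENNReal.toReal_pos (Metric.measure_ball_pos _ _ one_pos).ne' measure_ball_lt_top.ne

lemma lintegral_gagliardo_ge {N : ℕ} (hN : 1 ≤ N) {p s : ℝ} (hp : 1 < p) (hs₀ : 0 < s)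
    {f : RN N → ℝ} (hf : Measurable f) {S : ℝ} (hS : 0 < S)
    (hfS : ∫⁻ y, ENNReal.ofReal (f y ^ 2) = ENNReal.ofReal S) (x : RN N) :
    ENNReal.ofReal (|f x| ^ (p + 2 * (p * s / N))) ≤
      ENNReal.ofReal (2 ^ (p + 1) / (volume (Metric.ball (0 : RN N) 1)).toReal
        * (8 / (volume (Metric.ball (0 : RN N) 1)).toReal) ^ (p * s / N) * S ^ (p * s / N))
      * ∫⁻ y, ENNReal.ofReal (|f x - f y| ^ p / ‖x - y‖ ^ ((N : ℝ) + p * s)) := by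
  set w := (volume (Metric.ball (0 : RN N) 1)).toReal with hw
  have hw0 : 0 < w := volume_unitBall_pos N
  have hN0 : (0 : ℝ) < N := by exact_mod_cast hN
  set α := p * s / N with hα
  have hα0 : 0 < α := by positivity
  have hαN : α * N = p * s := by rw [hα]; field_simp
  set m := |f x| with hm
  rcases (abs_nonneg (f x)).eq_or_lt with hm0 | hm0
  · rw [hm, ← hm0, Real.zero_rpow (by positivity)]; simp
  rw [← hm] at hm0
  set V := 8 * S / (w * m ^ 2) with hV
  have hV0 : 0 < V := by positivity
  set R := V ^ ((N : ℝ)⁻¹) with hR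
  have hR0 : 0 < R := by positivity
  have hRN : R ^ N = V := by
    rw [hR, ← Real.rpow_natCast, ← Real.rpow_mul hV0.le, inv_mul_cancel₀ hN0.ne', Real.rpow_one]
  have hRps : R ^ ((N : ℝ) + p * s) = V * V ^ α := by
    rw [Real.rpow_add hR0, Real.rpow_natCast, hRN, hR, ← Real.rpow_mul hV0.le]
    congr 2
    rw [hα]; field_simp
  set bad := {y : RN N | ENNReal.ofReal ((m / 2) ^ 2) ≤ ENNReal.ofReal (f y ^ 2)} with hbad
  have hbad_meas : MeasurableSet bad :=
    measurableSet_le measurable_const (hf.pow_const 2).ennreal_ofReal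
  have hbadv : volume bad ≤ ENNReal.ofReal (4 * S / m ^ 2) := by
    have h := mul_meas_ge_le_lintegral (μ := (volume : Measure (RN N)))
      (hf.pow_const 2).ennreal_ofReal (ENNReal.ofReal ((m / 2) ^ 2))
    rw [hfS] at h
    have h2 : ENNReal.ofReal (4 * S / m ^ 2) = ENNReal.ofReal S / ENNReal.ofReal ((m / 2) ^ 2) := by
      rw [← ENNReal.ofReal_div_of_pos (by positivity)]
      congr 1; field_simp; norm_num
    rw [h2, ENNReal.le_div_iff_mul_le (by left; simp; positivity) (by left; simp), mul_comm]
    exact h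
  have hgood : ENNReal.ofReal (4 * S / m ^ 2) ≤ volume (Metric.ball x R \ bad) := by
    have h1 : volume (Metric.ball x R) = ENNReal.ofReal (8 * S / m ^ 2) := by
      rw [volume_ball_RN x hR0, ← hw, hRN, hV]
      congr 1; field_simp
    have h2 := le_measure_sdiff (μ := (volume : Measure (RN N))) (s₁ := Metric.ball x R)
      (s₂ := bad)
    refine le_trans ?_ h2
    rw [h1]
    refine le_trans ?_ (tsub_le_tsub_left hbadv _)
    rw [← ENNReal.ofReal_sub _ (by positivity)]
    apply ENNReal.ofReal_le_ofReal
    apply le_of_eq; ring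
  have hlow : ENNReal.ofReal ((m / 2) ^ p / R ^ ((N : ℝ) + p * s) * (4 * S / m ^ 2)) ≤
      ∫⁻ y, ENNReal.ofReal (|f x - f y| ^ p / ‖x - y‖ ^ ((N : ℝ) + p * s)) := by
    calc _ = ENNReal.ofReal ((m / 2) ^ p / R ^ ((N : ℝ) + p * s)) *
          ENNReal.ofReal (4 * S / m ^ 2) := ENNReal.ofReal_mul (by positivity)
      _ ≤ ENNReal.ofReal ((m / 2) ^ p / R ^ ((N : ℝ) + p * s)) *
          volume (Metric.ball x R \ bad) := by gcongr
      _ = ∫⁻ _ in Metric.ball x R \ bad,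
          ENNReal.ofReal ((m / 2) ^ p / R ^ ((N : ℝ) + p * s)) := by
        rw [setLIntegral_const]
      _ ≤ ∫⁻ y in Metric.ball x R \ bad,
          ENNReal.ofReal (|f x - f y| ^ p / ‖x - y‖ ^ ((N : ℝ) + p * s)) := by
        refine setLIntegral_mono' (measurableSet_ball.diff hbad_meas) fun y hy => ?_
        apply ENNReal.ofReal_le_ofReal
        have hy2 : |f y| < m / 2 := by
          have h := hy.2
          rw [hbad, mem_ofPred_eq, not_le, ENNReal.ofReal_lt_ofReal_iff (by positivity)] at h
          exact abs_lt_of_sq_lt_sq h (by positivity)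
        have h3 : m / 2 ≤ |f x - f y| := by
          have := abs_sub_abs_le_abs_sub (f x) (f y)
          rw [← hm] at this; linarith
        have h4 : ‖x - y‖ ≤ R := by
          have := hy.1
          rw [Metric.mem_ball, dist_comm, dist_eq_norm] at this
          exact this.le
        have h5 : 0 < ‖x - y‖ := by
          rw [norm_sub_pos_iff]
          rintro rfl
          simp at h3; linarith
        gcongr
      _ ≤ _ := setLIntegral_le_lintegral _ _
  refine le_trans ?_ (mul_le_mul_right hlow _)
  rw [← ENNReal.ofReal_mul (by positivity)]
  apply ENNReal.ofReal_le_ofReal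
  apply le_of_eq
  have hm2 : (m ^ 2) ^ α = m ^ (2 * α) := by
    rw [← Real.rpow_natCast, ← Real.rpow_mul hm0.le]; norm_num
  have hVα : V ^ α = (8 / w) ^ α * S ^ α / m ^ (2 * α) := by
    rw [← hm2, ← Real.mul_rpow (by positivity) hS.le,
      ← Real.div_rpow (by positivity) (by positivity)]
    congr 1; rw [hV]; field_simp
  rw [hRps, Real.div_rpow hm0.le (by norm_num), Real.rpow_add hm0, Real.rpow_add_one (by norm_num),
    hVα, hV]
  have h2p : (2 : ℝ) ^ p ≠ 0 := by positivity
  have e1 : (8 / w) ^ α ≠ 0 := by positivity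
  have e2 : S ^ α ≠ 0 := by positivity
  have e3 : m ^ (2 * α) ≠ 0 := by positivity
  field_simp
  norm_num

/-- Fractional Gagliardo–Nirenberg inequality
`∫ |f|^{p+2ps/N} ≤ C (∫ f²)^{ps/N} [f]_{s,p}^p`. -/
lemma gagliardo_nirenberg {N : ℕ} (hN : 1 ≤ N) {p s : ℝ} (hp : 1 < p) (hs₀ : 0 < s) :
    ∃ C : ℝ, 0 < C ∧ ∀ f : RN N → ℝ, Measurable f → ∫⁻ y, ENNReal.ofReal (f y ^ 2) ≠ ⊤ →
      ∫⁻ x, ENNReal.ofReal (|f x| ^ (p + 2 * (p * s / N))) ≤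
        ENNReal.ofReal C * (∫⁻ y, ENNReal.ofReal (f y ^ 2)) ^ (p * s / N)
          * gagliardoPow s p univ f := by
  have hN0 : (0 : ℝ) < N := by exact_mod_cast hN
  have hw0 := volume_unitBall_pos N
  refine ⟨2 ^ (p + 1) / (volume (Metric.ball (0 : RN N) 1)).toReal
        * (8 / (volume (Metric.ball (0 : RN N) 1)).toReal) ^ (p * s / N), by positivity, ?_⟩
  intro f hf hfin
  have hmeas : Measurable fun z : RN N × RN N =>
      ENNReal.ofReal (|f z.1 - f z.2| ^ p / ‖z.1 - z.2‖ ^ ((N : ℝ) + p * s)) := by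
    have h1 : Measurable fun z : RN N × RN N => f z.1 := hf.comp measurable_fst
    have h2 : Measurable fun z : RN N × RN N => f z.2 := hf.comp measurable_snd
    fun_prop
  rcases eq_or_ne (∫⁻ y, ENNReal.ofReal (f y ^ 2)) 0 with h0 | h0
  · have hz : ∀ᵐ y, f y = 0 := by
      rw [lintegral_eq_zero_iff (hf.pow_const 2).ennreal_ofReal] at h0
      filter_upwards [h0] with y hy
      simp only [Pi.zero_apply, ENNReal.ofReal_eq_zero] at hy
      nlinarith
    have : ∫⁻ x, ENNReal.ofReal (|f x| ^ (p + 2 * (p * s / N))) = 0 := by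
      rw [← lintegral_zero (μ := (volume : Measure (RN N)))]
      refine lintegral_congr_ae ?_
      filter_upwards [hz] with y hy
      rw [hy, abs_zero, Real.zero_rpow (by positivity)]; simp
    rw [this]; exact zero_le
  · have hS := ENNReal.toReal_pos h0 hfin
    have hfS := (ENNReal.ofReal_toReal hfin).symm
    set S := (∫⁻ y, ENNReal.ofReal (f y ^ 2)).toReal
    rw [gagliardoPow, univ_prod_univ, Measure.restrict_univ, Measure.volume_eq_prod,
      lintegral_prod _ hmeas.aemeasurable, hfS, ENNReal.ofReal_rpow_of_pos hS,
      ← ENNReal.ofReal_mul (by positivity), ← lintegral_const_mul _ hmeas.lintegral_prod_right']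
    exact lintegral_mono fun x => lintegral_gagliardo_ge hN hp hs₀ hf hS hfS x

/-- Continuity of translations of the first variable in `L^p`. -/
lemma tendsto_eLpNorm_translate_fst {E : Type*} [NormedAddCommGroup E] [MeasurableSpace E]
    [BorelSpace E] [SecondCountableTopology E] [LocallyCompactSpace E] {μ : Measure E}
    [IsLocallyFiniteMeasure μ] [SFinite μ]
    {P : ℝ≥0∞} (hP : 1 ≤ P) (hP' : P ≠ ⊤) {f : ℝ × E → ℝ}
    (hf : MemLp f P ((volume : Measure ℝ).prod μ)) :
    Tendsto (fun σ : ℝ => eLpNorm (fun z => f (σ + z.1, z.2) - f z) P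
      ((volume : Measure ℝ).prod μ)) (𝓝 0) (𝓝 0) := by
  have : Fact (1 ≤ P) := ⟨hP⟩
  let g : ℝ → C(ℝ × E, ℝ × E) := fun σ => ⟨fun z => (σ + z.1, z.2), by fun_prop⟩
  have hg : Continuous g := by
    refine ContinuousMap.continuous_of_continuous_uncurry _ ?_
    simp only [Function.uncurry_def, g, ContinuousMap.coe_mk]
    fun_prop
  have hgm : ∀ σ, MeasurePreserving (g σ) ((volume : Measure ℝ).prod μ)
      ((volume : Measure ℝ).prod μ) := fun σ =>
    (measurePreserving_add_left volume σ).prod (MeasurePreserving.id μ)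
  have hc : Continuous fun σ => Lp.compMeasurePreserving (g σ) (hgm σ) (hf.toLp f) :=
    continuous_const.compMeasurePreservingLp hg hgm hP'
  have h1 := (hc.tendsto 0)
  rw [tendsto_iff_edist_tendsto_0] at h1
  refine h1.congr fun σ => ?_
  rw [Lp.edist_def]
  refine eLpNorm_congr_ae ?_
  have e1 := Lp.coeFn_compMeasurePreserving (hf.toLp f) (hgm σ)
  have e2 := Lp.coeFn_compMeasurePreserving (hf.toLp f) (hgm 0)
  have e3 := (hgm σ).quasiMeasurePreserving.ae_eq_comp hf.coeFn_toLp
  have e4 := (hgm 0).quasiMeasurePreserving.ae_eq_comp hf.coeFn_toLp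
  filter_upwards [e1, e2, e3, e4] with z h1 h2 h3 h4
  simp only [Pi.sub_apply]
  rw [h1, h2, h3, h4]
  simp [g]

/-- Fast geometric convergence. -/
lemma tendsto_zero_of_fast_decay {Y : ℕ → ℝ≥0∞} {C b α : ℝ} (hα : 0 < α) (hb : 1 < b)
    (hC : 0 ≤ C)
    (hrec : ∀ n, Y (n + 1) ≤ ENNReal.ofReal (C * b ^ n) * Y n ^ (1 + α))
    (h0 : ENNReal.ofReal C * Y 0 ^ α ≤ ENNReal.ofReal (b ^ (-1 / α))) (hY0 : Y 0 ≠ ⊤) :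
    Tendsto Y atTop (𝓝 0) := by
  have hb0 : 0 < b := by linarith
  set θ := b ^ (-1 / α) with hθ
  have hθ0 : 0 < θ := by positivity
  have hθ1 : θ < 1 := Real.rpow_lt_one_of_one_lt_of_neg hb (by rw [neg_div]; simp; positivity)
  have hbθ : b * θ ^ α = 1 := by
    rw [hθ, ← Real.rpow_mul hb0.le, div_mul_cancel₀ _ hα.ne', Real.rpow_neg_one,
      mul_inv_cancel₀ hb0.ne']
  have hY : ∀ n, Y n ≤ Y 0 * ENNReal.ofReal (θ ^ n) := by
    intro n
    induction n with
    | zero => simp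
    | succ n ih =>
      calc Y (n + 1) ≤ ENNReal.ofReal (C * b ^ n) * Y n ^ (1 + α) := hrec n
        _ ≤ ENNReal.ofReal (C * b ^ n) * (Y 0 * ENNReal.ofReal (θ ^ n)) ^ (1 + α) := by
          gcongr
        _ = (ENNReal.ofReal C * Y 0 ^ α) * Y 0 * ENNReal.ofReal (θ ^ n) := by
          rw [ENNReal.mul_rpow_of_nonneg _ _ (by positivity), ENNReal.ofReal_mul hC,
            ENNReal.ofReal_rpow_of_pos (by positivity),
            ENNReal.rpow_add_of_nonneg _ _ zero_le_one hα.le, ENNReal.rpow_one]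
          have : ENNReal.ofReal ((θ ^ n) ^ (1 + α)) * ENNReal.ofReal (b ^ n)
              = ENNReal.ofReal (θ ^ n) := by
            rw [← ENNReal.ofReal_mul (by positivity)]
            congr 1
            rw [Real.rpow_add (by positivity), Real.rpow_one, mul_assoc]
            have : ((θ ^ n) ^ α) * b ^ n = 1 := by
              rw [← Real.rpow_natCast θ, ← Real.rpow_mul hθ0.le, mul_comm (n : ℝ),
                Real.rpow_mul hθ0.le, Real.rpow_natCast, ← mul_pow, mul_comm, hbθ, one_pow]
            rw [this, mul_one]
          calc _ = ENNReal.ofReal C * (Y 0 * Y 0 ^ α) *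
                (ENNReal.ofReal ((θ ^ n) ^ (1 + α)) * ENNReal.ofReal (b ^ n)) := by ring
            _ = _ := by rw [this]; ring
        _ ≤ ENNReal.ofReal θ * Y 0 * ENNReal.ofReal (θ ^ n) := by gcongr
        _ = Y 0 * ENNReal.ofReal (θ ^ (n + 1)) := by
          rw [pow_succ, ENNReal.ofReal_mul (by positivity)]; ring
  have hlim : Tendsto (fun n => Y 0 * ENNReal.ofReal (θ ^ n)) atTop (𝓝 0) := by
    have h1 : Tendsto (fun n => ENNReal.ofReal (θ ^ n)) atTop (𝓝 0) := by
      rw [← ENNReal.ofReal_zero]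
      exact ENNReal.tendsto_ofReal (tendsto_pow_atTop_nhds_zero_of_lt_one hθ0.le hθ1)
    simpa using ENNReal.Tendsto.const_mul h1 (Or.inr hY0)
  exact tendsto_of_tendsto_of_tendsto_of_le_of_le tendsto_const_nhds hlim (fun _ => zero_le) hY

lemma isOpen_timeDom (T : EReal) : IsOpen (timeDom T) := by
  have h : timeDom T = Ioi 0 ∩ (fun τ : ℝ => (τ : EReal)) ⁻¹' Iio T := rfl
  rw [h]
  exact isOpen_Ioi.inter (isOpen_Iio.preimage continuous_coe_real_ereal)

lemma mem_timeDom_of_lt {T : EReal} {a b t : ℝ} (ha : 0 < a) (hb : (b : EReal) < T) (h1 : a ≤ t)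
    (h2 : t ≤ b) : t ∈ timeDom T :=
  ⟨ha.trans_le h1, lt_of_le_of_lt (by exact_mod_cast h2) hb⟩

lemma Ioo_subset_timeDom {T : EReal} {a b : ℝ} (ha : 0 < a) (hb : (b : EReal) < T) :
    Ioo a b ⊆ timeDom T := fun _ ht => mem_timeDom_of_lt ha hb ht.1.le ht.2.le

/-- An almost everywhere statement on `ℝ^N × (0,T)` holds on almost every time slice. -/
lemma ae_slice {N : ℕ} {I : Set ℝ} {P : RN N × ℝ → Prop}
    (h : ∀ᵐ z ∂(volume.restrict (univ ×ˢ I) : Measure (RN N × ℝ)), P z) :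
    ∀ᵐ τ ∂(volume.restrict I), ∀ᵐ x : RN N, P (x, τ) := by
  rw [Measure.volume_eq_prod, ← Measure.prod_restrict, Measure.restrict_univ] at h
  have h2 : ∀ᵐ w ∂((volume.restrict I : Measure ℝ).prod (volume : Measure (RN N))),
      P w.swap := Measure.measurePreserving_swap.quasiMeasurePreserving.ae h
  exact Measure.ae_ae_of_ae_prod h2

/-- The reordering `(τ, (x, y)) ↦ (x, y, τ)`. -/
def timeLast {N : ℕ} (q : ℝ × (RN N × RN N)) : RN N × RN N × ℝ := (q.2.1, q.2.2, q.1)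

lemma measurePreserving_timeLast (N : ℕ) {I : Set ℝ} :
    MeasurePreserving (timeLast (N := N)) ((volume.restrict I).prod volume)
      (volume.restrict (univ ×ˢ univ ×ˢ I)) := by
  have h1 : (volume.restrict (univ ×ˢ univ ×ˢ I) : Measure (RN N × RN N × ℝ))
      = (volume : Measure (RN N)).prod ((volume : Measure (RN N)).prod (volume.restrict I)) := by
    rw [Measure.volume_eq_prod, ← Measure.prod_restrict, Measure.volume_eq_prod,
      ← Measure.prod_restrict, Measure.restrict_univ]
  rw [h1, Measure.volume_eq_prod]
  have e := (measurePreserving_prodAssoc (volume : Measure (RN N)) (volume : Measure (RN N))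
    (volume.restrict I : Measure ℝ)).comp
    (Measure.measurePreserving_swap (μ := (volume.restrict I : Measure ℝ))
      (ν := (volume : Measure (RN N)).prod (volume : Measure (RN N))))
  exact e

lemma ae_slice_pair {N : ℕ} {I : Set ℝ} {P : RN N × RN N × ℝ → Prop}
    (h : ∀ᵐ z ∂(volume.restrict (univ ×ˢ univ ×ˢ I) : Measure (RN N × RN N × ℝ)), P z) :
    ∀ᵐ τ ∂(volume.restrict I), ∀ᵐ z : RN N × RN N, P (z.1, z.2, τ) :=
  Measure.ae_ae_of_ae_prod ((measurePreserving_timeLast N).quasiMeasurePreserving.ae h)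

/-- A kernel has a measurable version that satisfies the two-sided bound everywhere. -/
lemma IsKernel.exists_measurable {N : ℕ} {p s C₁ C₂ : ℝ} {T : EReal} {K : RN N × RN N × ℝ → ℝ}
    (hC₁ : 0 < C₁) (hC : C₁ ≤ C₂)
    (hK : IsKernel N p s C₁ C₂ T K) :
    ∃ K' : RN N × RN N × ℝ → ℝ, Measurable K' ∧
      (∀ q, C₁ / ‖q.1 - q.2.1‖ ^ ((N : ℝ) + p * s) ≤ K' q) ∧
      (∀ q, K' q ≤ C₂ / ‖q.1 - q.2.1‖ ^ ((N : ℝ) + p * s)) ∧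
      ∀ᵐ τ ∂(volume.restrict (timeDom T)), ∀ᵐ z : RN N × RN N,
        K (z.1, z.2, τ) = K' (z.1, z.2, τ) := by
  set K0 := hK.aemeasurable.mk K with hK0
  have hK0m : Measurable K0 := hK.aemeasurable.measurable_mk
  refine ⟨fun q => max C₁ (min C₂ (K0 q * ‖q.1 - q.2.1‖ ^ ((N : ℝ) + p * s)))
      / ‖q.1 - q.2.1‖ ^ ((N : ℝ) + p * s), ?_, ?_, ?_, ?_⟩
  · fun_prop
  · intro q; dsimp only; gcongr; exact le_max_left _ _
  · intro q; dsimp only; gcongr; exact max_le hC (min_le_left _ _)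
  · refine ae_slice_pair (I := timeDom T) (P := fun q => K q =
      max C₁ (min C₂ (K0 q * ‖q.1 - q.2.1‖ ^ ((N : ℝ) + p * s)))
      / ‖q.1 - q.2.1‖ ^ ((N : ℝ) + p * s)) ?_
    filter_upwards [hK.bounds, hK.aemeasurable.ae_eq_mk] with q h1 h2
    rw [hK0, ← h2, min_eq_right h1.2, max_eq_right h1.1]
    rcases (Real.rpow_nonneg (norm_nonneg (q.1 - q.2.1)) ((N : ℝ) + p * s)).eq_or_lt with h | h
    · rw [← h, mul_zero] at h1; linarith [h1.1]
    · field_simp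

lemma measurable_cutoffKernel {N : ℕ} (p s L : ℝ) : Measurable fun z : RN N × RN N =>
    ENNReal.ofReal (min 1 (L * ‖z.1 - z.2‖) ^ p / ‖z.1 - z.2‖ ^ ((N : ℝ) + p * s)) := by
  fun_prop

lemma lintegral_fst_mul_cutoffKernel {N : ℕ} (hN : 1 ≤ N) {p s L : ℝ} (hp : 1 < p) (hs₀ : 0 < s)
    (hs₁ : s < 1) (hL : 0 < L) {g : RN N → ℝ≥0∞} (hg : Measurable g) :
    ∫⁻ z : RN N × RN N, g z.1 *
      ENNReal.ofReal (min 1 (L * ‖z.1 - z.2‖) ^ p / ‖z.1 - z.2‖ ^ ((N : ℝ) + p * s))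
      = ENNReal.ofReal (L ^ (p * s) * cutoffMass N p s) * ∫⁻ x, g x := by
  have hm : Measurable fun z : RN N × RN N => g z.1 *
      ENNReal.ofReal (min 1 (L * ‖z.1 - z.2‖) ^ p / ‖z.1 - z.2‖ ^ ((N : ℝ) + p * s)) :=
    (hg.comp measurable_fst).mul (measurable_cutoffKernel p s L)
  rw [Measure.volume_eq_prod, lintegral_prod _ hm.aemeasurable, ← lintegral_const_mul _ hg]
  refine lintegral_congr fun x => ?_
  have hm2 : Measurable fun y : RN N =>
      ENNReal.ofReal (min 1 (L * ‖x - y‖) ^ p / ‖x - y‖ ^ ((N : ℝ) + p * s)) := by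
    fun_prop
  calc _ = g x * ∫⁻ y : RN N,
        ENNReal.ofReal (min 1 (L * ‖x - y‖) ^ p / ‖x - y‖ ^ ((N : ℝ) + p * s)) :=
        lintegral_const_mul _ hm2
    _ = _ := by rw [lintegral_cutoffKernel hN hp hs₀ hs₁ hL, mul_comm]

lemma lintegral_snd_mul_cutoffKernel {N : ℕ} (hN : 1 ≤ N) {p s L : ℝ} (hp : 1 < p) (hs₀ : 0 < s)
    (hs₁ : s < 1) (hL : 0 < L) {g : RN N → ℝ≥0∞} (hg : Measurable g) :
    ∫⁻ z : RN N × RN N, g z.2 *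
      ENNReal.ofReal (min 1 (L * ‖z.1 - z.2‖) ^ p / ‖z.1 - z.2‖ ^ ((N : ℝ) + p * s))
      = ENNReal.ofReal (L ^ (p * s) * cutoffMass N p s) * ∫⁻ x, g x := by
  rw [← lintegral_fst_mul_cutoffKernel hN hp hs₀ hs₁ hL hg, Measure.volume_eq_prod,
    ← lintegral_prod_swap]
  refine lintegral_congr fun z => ?_
  simp [norm_sub_rev]

/-- A cutoff function: values in `[0,1]`, `L`-Lipschitz, zero outside `B`. -/
structure IsCutoff {N : ℕ} (L : ℝ) (B : Set (RN N)) (θ : RN N → ℝ) : Prop where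
  nonneg : ∀ x, 0 ≤ θ x
  le_one : ∀ x, θ x ≤ 1
  lip : ∀ x y, |θ x - θ y| ≤ L * ‖x - y‖
  zero : ∀ x, x ∉ B → θ x = 0

lemma IsCutoff.continuous {N : ℕ} {L : ℝ} {B : Set (RN N)} {θ : RN N → ℝ} (h : IsCutoff L B θ) :
    Continuous θ := by
  have : LipschitzWith (Real.toNNReal L) θ := by
    refine LipschitzWith.of_dist_le' fun x y => ?_
    rw [Real.dist_eq, dist_eq_norm]
    exact h.lip x y
  exact this.continuous

lemma IsCutoff.abs_sub_le {N : ℕ} {L : ℝ} {B : Set (RN N)} {θ : RN N → ℝ} (h : IsCutoff L B θ)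
    (x y : RN N) : |θ x - θ y| ≤ min 1 (L * ‖x - y‖) := by
  refine le_min ?_ (h.lip x y)
  rw [abs_le]
  constructor <;> linarith [h.nonneg x, h.nonneg y, h.le_one x, h.le_one y]

lemma IsCutoff.mono {N : ℕ} {L : ℝ} {B B' : Set (RN N)} {θ : RN N → ℝ} (h : IsCutoff L B θ)
    (hB : B ⊆ B') : IsCutoff L B' θ :=
  ⟨h.nonneg, h.le_one, h.lip, fun x hx => h.zero x fun h' => hx (hB h')⟩

lemma IsCutoff.rpow {N : ℕ} {L p : ℝ} {B : Set (RN N)} {θ : RN N → ℝ} (h : IsCutoff L B θ)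
    (hp : 1 < p) (hp2 : p < 2) : IsCutoff (2 * L) B (fun x => θ x ^ p) where
  nonneg x := Real.rpow_nonneg (h.nonneg x) _
  le_one x := Real.rpow_le_one (h.nonneg x) (h.le_one x) (by linarith)
  zero x hx := by simp only [h.zero x hx]; exact Real.zero_rpow (by linarith)
  lip := by
    have key : ∀ x y, θ x ≤ θ y → |θ x ^ p - θ y ^ p| ≤ 2 * L * ‖x - y‖ := by
      intro x y hxy
      have h1 : θ x ^ p ≤ θ y ^ p := Real.rpow_le_rpow (h.nonneg x) hxy (by linarith)
      have h2 := rpow_sub_rpow_le hp (h.nonneg x) hxy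
      have h3 : θ y ^ (p - 1) ≤ 1 := Real.rpow_le_one (h.nonneg y) (h.le_one y) (by linarith)
      have h4 : 0 ≤ θ y ^ (p - 1) := Real.rpow_nonneg (h.nonneg y) _
      have h5 := h.lip x y
      rw [abs_sub_comm, abs_of_nonneg (by linarith)] at h5
      rw [abs_sub_comm, abs_of_nonneg (by linarith)]
      have h6 : p * θ y ^ (p - 1) ≤ 2 := by nlinarith
      have h7 : p * θ y ^ (p - 1) * (θ y - θ x) ≤ 2 * (θ y - θ x) :=
        mul_le_mul_of_nonneg_right h6 (by linarith)
      linarith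
    intro x y
    rcases le_total (θ x) (θ y) with hxy | hxy
    · exact key x y hxy
    · have := key y x hxy
      rwa [abs_sub_comm, norm_sub_rev] at this

lemma exists_isCutoff {N : ℕ} (x₀ : RN N) {r R : ℝ} (hr : r < R) :
    ∃ θ : RN N → ℝ, IsCutoff (1 / (R - r)) (Metric.ball x₀ R) θ ∧
      ∀ x ∈ Metric.ball x₀ r, θ x = 1 := by
  have hd : 0 < R - r := by linarith
  refine ⟨fun x => max 0 (min 1 ((R - ‖x - x₀‖) / (R - r))), ⟨?_, ?_, ?_, ?_⟩, ?_⟩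
  · intro x; exact le_max_left _ _
  · intro x; exact max_le zero_le_one (min_le_left _ _)
  · intro x y
    refine (abs_max_sub_max_le_max _ _ _ _).trans ?_
    rw [sub_self, abs_zero, max_eq_right (abs_nonneg _)]
    refine (abs_min_sub_min_le_max _ _ _ _).trans ?_
    rw [sub_self, abs_zero, max_eq_right (abs_nonneg _), ← sub_div, abs_div, abs_of_pos hd,
      one_div_mul_eq_div]
    gcongr
    have := abs_norm_sub_norm_le (y - x₀) (x - x₀)
    rw [sub_sub_sub_cancel_right, norm_sub_rev y x] at this
    have e : R - ‖x - x₀‖ - (R - ‖y - x₀‖) = ‖y - x₀‖ - ‖x - x₀‖ := by ring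
    rwa [e]
  · intro x hx
    have hx' : R ≤ ‖x - x₀‖ := by
      rw [Metric.mem_ball, not_lt, dist_eq_norm] at hx; exact hx
    refine max_eq_left ((min_le_right _ _).trans ?_)
    exact div_nonpos_of_nonpos_of_nonneg (by linarith) hd.le
  · intro x hx
    rw [Metric.mem_ball, dist_eq_norm] at hx
    have : 1 ≤ (R - ‖x - x₀‖) / (R - r) := by rw [le_div_iff₀ hd]; linarith
    simp [min_eq_left this]

lemma abs_posPart_sub_le (a b k : ℝ) : |max (a - k) 0 - max (b - k) 0| ≤ |a - b| := by
  refine (abs_max_sub_max_le_max _ _ _ _).trans ?_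
  rw [sub_self, abs_zero, max_eq_left (abs_nonneg _)]
  apply le_of_eq; congr 1; ring

/-- The truncated and localized function has finite Gagliardo energy. -/
lemma gagliardoPow_truncation_le {N : ℕ} (hN : 1 ≤ N) {p s L : ℝ} (hp : 1 < p) (hp2 : p < 2)
    (hs₀ : 0 < s) (hs₁ : s < 1) (hL : 0 < L) {U : Set (RN N)} (hU : MeasurableSet U)
    {θ : RN N → ℝ} (hθ : IsCutoff L U θ) {f : RN N → ℝ} (hf : Measurable f) (k : ℝ) :
    gagliardoPow s p univ (fun x => max (f x - k) 0 * θ x) ≤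
      2 * gagliardoPow s p U f + 4 * ENNReal.ofReal (L ^ (p * s) * cutoffMass N p s)
        * ∫⁻ x in U, ENNReal.ofReal (max (f x - k) 0 ^ p) := by
  set w : RN N → ℝ := fun x => max (f x - k) 0 with hw
  have hwm : Measurable w := (hf.sub_const k).max measurable_const
  have hw0 : ∀ x, 0 ≤ w x := fun x => le_max_right _ _
  set g : RN N → ℝ≥0∞ := U.indicator (fun x => ENNReal.ofReal (w x ^ p)) with hg
  have hgm : Measurable g := (hwm.pow_const p).ennreal_ofReal.indicator hU
  set E : RN N × RN N → ℝ≥0∞ := fun z =>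
    ENNReal.ofReal (|f z.1 - f z.2| ^ p / ‖z.1 - z.2‖ ^ ((N : ℝ) + p * s)) with hE
  have hEm : Measurable E := by
    have h1 : Measurable fun z : RN N × RN N => f z.1 := hf.comp measurable_fst
    have h2 : Measurable fun z : RN N × RN N => f z.2 := hf.comp measurable_snd
    fun_prop
  set κ : RN N × RN N → ℝ≥0∞ := fun z =>
    ENNReal.ofReal (min 1 (L * ‖z.1 - z.2‖) ^ p / ‖z.1 - z.2‖ ^ ((N : ℝ) + p * s)) with hκ
  have hκm : Measurable κ := measurable_cutoffKernel p s L
  have hpt : ∀ z : RN N × RN N,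
      ENNReal.ofReal (|w z.1 * θ z.1 - w z.2 * θ z.2| ^ p / ‖z.1 - z.2‖ ^ ((N : ℝ) + p * s)) ≤
        2 * (U ×ˢ U).indicator E z + 2 * (g z.1 * κ z) + 2 * (g z.2 * κ z) := by
    rintro ⟨x, y⟩
    have hd : 0 ≤ ‖x - y‖ ^ ((N : ℝ) + p * s) := by positivity
    have hm := hθ.abs_sub_le x y
    have hmp : |θ x - θ y| ^ p ≤ min 1 (L * ‖x - y‖) ^ p :=
      Real.rpow_le_rpow (abs_nonneg _) hm (by linarith)
    have e2 : ∀ t : ℝ, 2 * ENNReal.ofReal t = ENNReal.ofReal (2 * t) := fun t => by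
      rw [ENNReal.ofReal_mul zero_le_two]; simp
    by_cases hx : x ∈ U
    · have hxy1 : ∀ t : ℝ, t ≤ 2 * (w x ^ p * min 1 (L * ‖x - y‖) ^ p) →
          ENNReal.ofReal (t / ‖x - y‖ ^ ((N : ℝ) + p * s)) ≤ 2 * (g x * κ (x, y)) := by
        intro t ht
        simp only [hg, indicator_of_mem hx, hκ]
        rw [← ENNReal.ofReal_mul (by have := hw0 x; positivity), e2]
        apply ENNReal.ofReal_le_ofReal
        rw [← mul_div_assoc, ← mul_div_assoc]
        gcongr
      by_cases hy : y ∈ U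
      · have hz : ((x, y) : RN N × RN N) ∈ U ×ˢ U := ⟨hx, hy⟩
        have h1 : |w x * θ x - w y * θ y| ≤ |f x - f y| + w x * |θ x - θ y| := by
          have e : w x * θ x - w y * θ y = (w x - w y) * θ y + w x * (θ x - θ y) := by ring
          rw [e]
          refine (abs_add_le _ _).trans ?_
          rw [abs_mul, abs_mul, abs_of_nonneg (hθ.nonneg y), abs_of_nonneg (hw0 x)]
          have h3 := abs_posPart_sub_le (f x) (f y) k
          have : |w x - w y| * θ y ≤ |f x - f y| * 1 :=
            mul_le_mul h3 (hθ.le_one y) (hθ.nonneg y) (abs_nonneg _)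
          linarith
        have h2 : |w x * θ x - w y * θ y| ^ p ≤
            2 * |f x - f y| ^ p + 2 * (w x ^ p * min 1 (L * ‖x - y‖) ^ p) := by
          refine (Real.rpow_le_rpow (abs_nonneg _) h1 (by linarith)).trans ?_
          refine (add_rpow_le_two_mul hp hp2 (abs_nonneg _)
            (mul_nonneg (hw0 x) (abs_nonneg _))).trans ?_
          rw [Real.mul_rpow (hw0 x) (abs_nonneg _)]
          have := mul_le_mul_of_nonneg_left hmp (Real.rpow_nonneg (hw0 x) p)
          linarith
        refine le_trans ?_ (le_self_add)
        rw [indicator_of_mem hz]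
        refine le_trans ?_ (add_le_add_right (hxy1 _ le_rfl) _)
        simp only [hE]
        rw [e2, ← ENNReal.ofReal_add (by positivity)
          (by have := hw0 x; positivity)]
        apply ENNReal.ofReal_le_ofReal
        rw [← mul_div_assoc, ← add_div]
        gcongr
      · have : w y * θ y = 0 := by rw [hθ.zero y hy, mul_zero]
        refine le_trans (hxy1 _ ?_) (le_add_right (le_add_left le_rfl))
        simp only
        rw [this, hθ.zero y hy, sub_zero] at *
        rw [abs_mul, abs_of_nonneg (hw0 x), Real.mul_rpow (hw0 x) (abs_nonneg _)]
        have h8 := mul_le_mul_of_nonneg_left hmp (Real.rpow_nonneg (hw0 x) p)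
        have h9 : 0 ≤ w x ^ p * |θ x| ^ p := by have := hw0 x; positivity
        linarith
    · have h0 : w x * θ x = 0 := by rw [hθ.zero x hx, mul_zero]
      simp only
      rw [h0]
      by_cases hy : y ∈ U
      · refine le_trans ?_ le_add_self
        simp only [hg, indicator_of_mem hy, hκ]
        rw [← ENNReal.ofReal_mul (by have := hw0 y; positivity), e2]
        apply ENNReal.ofReal_le_ofReal
        rw [← mul_div_assoc, ← mul_div_assoc]
        gcongr
        rw [hθ.zero x hx] at hmp
        rw [zero_sub, abs_neg] at hmp ⊢
        rw [abs_mul, abs_of_nonneg (hw0 y), Real.mul_rpow (hw0 y) (abs_nonneg _)]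
        have h8 := mul_le_mul_of_nonneg_left hmp (Real.rpow_nonneg (hw0 y) p)
        have h9 : 0 ≤ w y ^ p * |θ y| ^ p := by have := hw0 y; positivity
        linarith
      · rw [hθ.zero y hy, mul_zero, sub_zero, abs_zero, Real.zero_rpow (by linarith)]
        simp
  have hUU : MeasurableSet (U ×ˢ U) := hU.prod hU
  calc gagliardoPow s p univ (fun x => w x * θ x)
      = ∫⁻ z : RN N × RN N, ENNReal.ofReal
        (|w z.1 * θ z.1 - w z.2 * θ z.2| ^ p / ‖z.1 - z.2‖ ^ ((N : ℝ) + p * s)) := by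
        rw [gagliardoPow, univ_prod_univ, Measure.restrict_univ]
    _ ≤ ∫⁻ z : RN N × RN N, (2 * (U ×ˢ U).indicator E z + 2 * (g z.1 * κ z) + 2 * (g z.2 * κ z)) :=
        lintegral_mono hpt
    _ = 2 * gagliardoPow s p U f +
        2 * (ENNReal.ofReal (L ^ (p * s) * cutoffMass N p s) * ∫⁻ x, g x) +
        2 * (ENNReal.ofReal (L ^ (p * s) * cutoffMass N p s) * ∫⁻ x, g x) := by
        have m1 : Measurable fun z : RN N × RN N => g z.1 * κ z :=
          (hgm.comp measurable_fst).mul hκm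
        have m2 : Measurable fun z : RN N × RN N => g z.2 * κ z :=
          (hgm.comp measurable_snd).mul hκm
        rw [lintegral_add_right _ (m2.const_mul _), lintegral_add_right _ (m1.const_mul _),
          lintegral_const_mul _ (hEm.indicator hUU), lintegral_const_mul _ m1,
          lintegral_const_mul _ m2,
          lintegral_fst_mul_cutoffKernel hN hp hs₀ hs₁ hL hgm,
          lintegral_snd_mul_cutoffKernel hN hp hs₀ hs₁ hL hgm, lintegral_indicator hUU]
        rfl
    _ = _ := by
        rw [hg, lintegral_indicator hU]
        ring

/-- The density `|f(x)-f(y)|^{p-1} |w(x)-w(y)| |x-y|^{-N-ps}`. -/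
noncomputable def crossDensity {N : ℕ} (p s : ℝ) (f w : RN N → ℝ) (z : RN N × RN N) : ℝ≥0∞ :=
  ENNReal.ofReal (|f z.1 - f z.2| ^ (p - 1) * |w z.1 - w z.2| / ‖z.1 - z.2‖ ^ ((N : ℝ) + p * s))

lemma measurable_crossDensity {N : ℕ} (p s : ℝ) {f w : RN N → ℝ} (hf : Measurable f)
    (hw : Measurable w) : Measurable (crossDensity p s f w) := by
  have h1 : Measurable fun z : RN N × RN N => f z.1 := hf.comp measurable_fst
  have h2 : Measurable fun z : RN N × RN N => f z.2 := hf.comp measurable_snd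
  have h3 : Measurable fun z : RN N × RN N => w z.1 := hw.comp measurable_fst
  have h4 : Measurable fun z : RN N × RN N => w z.2 := hw.comp measurable_snd
  unfold crossDensity
  fun_prop

lemma crossDensity_swap {N : ℕ} (p s : ℝ) (f w : RN N → ℝ) (z : RN N × RN N) :
    crossDensity p s f w z.swap = crossDensity p s f w z := by
  simp only [crossDensity, Prod.fst_swap, Prod.snd_swap]
  rw [abs_sub_comm (f z.2), abs_sub_comm (w z.2), norm_sub_rev z.2]

/-- `f` has tail at most `Θ` from the ball of radius `R₁` to the complement of the ball of
radius `R`. -/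
def TailBound {N : ℕ} (p s : ℝ) (x₀ : RN N) (R₁ R Θ : ℝ) (f : RN N → ℝ) : Prop :=
  ∀ x ∈ Metric.ball x₀ R₁, ∫⁻ y in (Metric.ball x₀ R)ᶜ,
    ENNReal.ofReal (|f y| ^ (p - 1) / ‖x - y‖ ^ ((N : ℝ) + p * s)) ≤ ENNReal.ofReal Θ

lemma sub_le_norm_of_mem_ball {N : ℕ} {x₀ x y : RN N} {R₁ R : ℝ} (hx : x ∈ Metric.ball x₀ R₁)
    (hy : y ∈ (Metric.ball x₀ R)ᶜ) : R - R₁ ≤ ‖x - y‖ := by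
  rw [Metric.mem_ball] at hx
  rw [mem_compl_iff, Metric.mem_ball, not_lt] at hy
  have := dist_triangle_left y x₀ x
  rw [dist_eq_norm x y] at this
  linarith

lemma lintegral_compl_ball_le {N : ℕ} (hN : 1 ≤ N) {p s : ℝ} (hp : 1 < p) (hp2 : p < 2)
    (hs₀ : 0 < s) (hs₁ : s < 1) {x₀ : RN N} {R₁ R Θ : ℝ} (hR : R₁ < R) (hΘ : 0 ≤ Θ)
    {f : RN N → ℝ} (hT : TailBound p s x₀ R₁ R Θ f) {x : RN N}
    (hx : x ∈ Metric.ball x₀ R₁) :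
    ∫⁻ y in (Metric.ball x₀ R)ᶜ,
      ENNReal.ofReal (|f x - f y| ^ (p - 1) / ‖x - y‖ ^ ((N : ℝ) + p * s)) ≤
      ENNReal.ofReal (((1 / (R - R₁)) ^ (p * s) * cutoffMass N p s + Θ) * (1 + |f x|)) := by
  have hd : 0 < R - R₁ := by linarith
  set I := (1 / (R - R₁)) ^ (p * s) * cutoffMass N p s with hI
  have hI0 : 0 ≤ I := mul_nonneg (by positivity) (cutoffMass_nonneg N p s)
  calc _ ≤ ∫⁻ y in (Metric.ball x₀ R)ᶜ,
        (ENNReal.ofReal (|f x| ^ (p - 1)) * ENNReal.ofReal (min 1 (1 / (R - R₁) * ‖x - y‖) ^ p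
          / ‖x - y‖ ^ ((N : ℝ) + p * s))
        + ENNReal.ofReal (|f y| ^ (p - 1) / ‖x - y‖ ^ ((N : ℝ) + p * s))) := by
        refine setLIntegral_mono' measurableSet_ball.compl fun y hy => ?_
        rw [← ENNReal.ofReal_mul (by positivity), ← ENNReal.ofReal_add (by positivity)
          (by positivity)]
        apply ENNReal.ofReal_le_ofReal
        have h1 := sub_le_norm_of_mem_ball hx hy
        have h2 : 1 ≤ 1 / (R - R₁) * ‖x - y‖ := by
          rw [one_div_mul_eq_div, le_div_iff₀ hd]; linarith
        rw [min_eq_left h2, Real.one_rpow, mul_one_div, ← add_div]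
        gcongr
        refine (Real.rpow_le_rpow (abs_nonneg _) (abs_sub _ _) (by linarith)).trans ?_
        exact Real.rpow_add_le_add_rpow (abs_nonneg _) (abs_nonneg _) (by linarith) (by linarith)
    _ = ENNReal.ofReal (|f x| ^ (p - 1)) * (∫⁻ y in (Metric.ball x₀ R)ᶜ,
          ENNReal.ofReal (min 1 (1 / (R - R₁) * ‖x - y‖) ^ p / ‖x - y‖ ^ ((N : ℝ) + p * s)))
        + ∫⁻ y in (Metric.ball x₀ R)ᶜ,
          ENNReal.ofReal (|f y| ^ (p - 1) / ‖x - y‖ ^ ((N : ℝ) + p * s)) := by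
        have m1 : Measurable fun y : RN N =>
          ENNReal.ofReal (min 1 (1 / (R - R₁) * ‖x - y‖) ^ p / ‖x - y‖ ^ ((N : ℝ) + p * s)) := by
          fun_prop
        rw [lintegral_add_left (m1.const_mul _), lintegral_const_mul _ m1]
    _ ≤ ENNReal.ofReal (|f x| ^ (p - 1)) * ENNReal.ofReal I + ENNReal.ofReal Θ := by
        gcongr
        · refine (setLIntegral_le_lintegral _ _).trans (le_of_eq ?_)
          exact lintegral_cutoffKernel hN hp hs₀ hs₁ (by positivity) x
        · exact hT x hx
    _ ≤ _ := by
        rw [← ENNReal.ofReal_mul (by positivity), ← ENNReal.ofReal_add (by positivity) hΘ]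
        apply ENNReal.ofReal_le_ofReal
        have h3 : |f x| ^ (p - 1) ≤ 1 + |f x| := by
          rcases le_total |f x| 1 with h | h
          · have := Real.rpow_le_one (abs_nonneg (f x)) h (by linarith : 0 ≤ p - 1)
            linarith [abs_nonneg (f x)]
          · have := Real.rpow_le_rpow_of_exponent_le h (by linarith : p - 1 ≤ 1)
            rw [Real.rpow_one] at this
            linarith
        have h4 := abs_nonneg (f x)
        nlinarith [mul_le_mul_of_nonneg_right h3 hI0, mul_nonneg hΘ h4]

lemma lintegral_crossDensity_le {N : ℕ} (hN : 1 ≤ N) {p s : ℝ} (hp : 1 < p) (hp2 : p < 2)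
    (hs₀ : 0 < s) (hs₁ : s < 1) {x₀ : RN N} {R₁ R Θ : ℝ} (hR : R₁ < R) (hΘ : 0 ≤ Θ)
    {f w : RN N → ℝ} (hf : Measurable f) (hw : Measurable w) (hT : TailBound p s x₀ R₁ R Θ f)
    (hw0 : ∀ x, x ∉ Metric.ball x₀ R₁ → w x = 0) :
    ∫⁻ z, crossDensity p s f w z ≤
      (∫⁻ z in Metric.ball x₀ R ×ˢ Metric.ball x₀ R, crossDensity p s f w z)
      + 2 * (ENNReal.ofReal ((1 / (R - R₁)) ^ (p * s) * cutoffMass N p s + Θ)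
        * ∫⁻ x in Metric.ball x₀ R, ENNReal.ofReal ((1 + |f x|) * |w x|)) := by
  set U := Metric.ball x₀ R with hU
  set B := Metric.ball x₀ R₁ with hB
  have hBU : B ⊆ U := Metric.ball_subset_ball hR.le
  set E := crossDensity p s f w with hE
  have hEm : Measurable E := measurable_crossDensity p s hf hw
  have hd : 0 < R - R₁ := by linarith
  set c := (1 / (R - R₁)) ^ (p * s) * cutoffMass N p s + Θ with hc
  have hc0 : 0 ≤ c := add_nonneg (mul_nonneg (by positivity) (cutoffMass_nonneg N p s)) hΘ
  have mUU : MeasurableSet (U ×ˢ U) := measurableSet_ball.prod measurableSet_ball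
  have mBU : MeasurableSet (B ×ˢ Uᶜ) := measurableSet_ball.prod measurableSet_ball.compl
  have mUB : MeasurableSet (Uᶜ ×ˢ B) := measurableSet_ball.compl.prod measurableSet_ball
  have hpt : ∀ z, E z ≤ (U ×ˢ U).indicator E z + (B ×ˢ Uᶜ).indicator E z
      + (Uᶜ ×ˢ B).indicator E z := by
    rintro ⟨x, y⟩
    by_cases hx : x ∈ U
    · by_cases hy : y ∈ U
      · rw [indicator_of_mem (show (x, y) ∈ U ×ˢ U from ⟨hx, hy⟩)]
        exact le_add_right le_self_add
      · by_cases hxB : x ∈ B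
        · rw [indicator_of_mem (show (x, y) ∈ B ×ˢ Uᶜ from ⟨hxB, hy⟩)]
          exact le_add_right le_add_self
        · have : E (x, y) = 0 := by
            simp [hE, crossDensity, hw0 x hxB, hw0 y (fun h => hy (hBU h))]
          rw [this]; exact zero_le
    · by_cases hy : y ∈ B
      · rw [indicator_of_mem (show (x, y) ∈ Uᶜ ×ˢ B from ⟨hx, hy⟩)]
        exact le_add_self
      · have : E (x, y) = 0 := by
          simp [hE, crossDensity, hw0 y hy, hw0 x (fun h => hx (hBU h))]
        rw [this]; exact zero_le
  have hsw : ∫⁻ z, (Uᶜ ×ˢ B).indicator E z = ∫⁻ z, (B ×ˢ Uᶜ).indicator E z := by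
    rw [Measure.volume_eq_prod, ← lintegral_prod_swap]
    refine lintegral_congr fun z => ?_
    by_cases h : z ∈ B ×ˢ Uᶜ
    · rw [indicator_of_mem h, indicator_of_mem (show z.swap ∈ Uᶜ ×ˢ B from ⟨h.2, h.1⟩), hE,
        crossDensity_swap]
    · rw [indicator_of_notMem h, indicator_of_notMem (fun h' => h ⟨h'.2, h'.1⟩)]
  have htail : ∫⁻ z, (B ×ˢ Uᶜ).indicator E z ≤
      ENNReal.ofReal c * ∫⁻ x in U, ENNReal.ofReal ((1 + |f x|) * |w x|) := by
    rw [lintegral_indicator mBU, Measure.volume_eq_prod, ← Measure.prod_restrict,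
      lintegral_prod _ hEm.aemeasurable]
    have m3 : Measurable fun x => ENNReal.ofReal ((1 + |f x|) * |w x|) := by fun_prop
    rw [← lintegral_const_mul _ m3]
    refine le_trans ?_ (lintegral_mono_set hBU)
    refine setLIntegral_mono' measurableSet_ball fun x hx => ?_
    have h1 : ∫⁻ y in Uᶜ, E (x, y) = ∫⁻ y in Uᶜ, ENNReal.ofReal |w x| *
        ENNReal.ofReal (|f x - f y| ^ (p - 1) / ‖x - y‖ ^ ((N : ℝ) + p * s)) := by
      refine setLIntegral_congr_fun measurableSet_ball.compl fun y hy => ?_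
      simp only [hE, crossDensity]
      rw [hw0 y (fun h => hy (hBU h)), sub_zero, ← ENNReal.ofReal_mul (abs_nonneg _)]
      congr 1; ring
    have m4 : Measurable fun y : RN N =>
        ENNReal.ofReal (|f x - f y| ^ (p - 1) / ‖x - y‖ ^ ((N : ℝ) + p * s)) := by fun_prop
    rw [h1, lintegral_const_mul _ m4]
    refine (mul_le_mul_right (lintegral_compl_ball_le hN hp hp2 hs₀ hs₁ hR hΘ hT hx)
      _).trans ?_
    rw [← ENNReal.ofReal_mul (abs_nonneg _), ← ENNReal.ofReal_mul hc0]
    apply le_of_eq; congr 1; ring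
  calc ∫⁻ z, E z ≤ ∫⁻ z, ((U ×ˢ U).indicator E z + (B ×ˢ Uᶜ).indicator E z
      + (Uᶜ ×ˢ B).indicator E z) := lintegral_mono hpt
    _ = (∫⁻ z in U ×ˢ U, E z) + (∫⁻ z, (B ×ˢ Uᶜ).indicator E z)
        + ∫⁻ z, (B ×ˢ Uᶜ).indicator E z := by
      rw [lintegral_add_right _ (hEm.indicator mUB), lintegral_add_right _ (hEm.indicator mBU),
        lintegral_indicator mUU, hsw]
    _ ≤ _ := by
      rw [add_assoc, ← two_mul]
      gcongr

lemma measurable_slice {N : ℕ} {u : RN N × ℝ → ℝ} (hu : Measurable u) (τ : ℝ) :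
    Measurable fun x => u (x, τ) := hu.comp measurable_prodMk_right

lemma measurable_fst_slice {N : ℕ} {u : RN N × ℝ → ℝ} (hu : Measurable u) :
    Measurable fun q : ℝ × (RN N × RN N) => u (q.2.1, q.1) :=
  hu.comp ((measurable_fst.comp measurable_snd).prodMk measurable_fst)

lemma measurable_snd_slice {N : ℕ} {u : RN N × ℝ → ℝ} (hu : Measurable u) :
    Measurable fun q : ℝ × (RN N × RN N) => u (q.2.2, q.1) :=
  hu.comp ((measurable_snd.comp measurable_snd).prodMk measurable_fst)

lemma measurable_crossDensity_time {N : ℕ} (p s : ℝ) {u w : RN N × ℝ → ℝ} (hu : Measurable u)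
    (hw : Measurable w) : Measurable fun q : ℝ × (RN N × RN N) =>
      crossDensity p s (fun x => u (x, q.1)) (fun x => w (x, q.1)) q.2 := by
  have h1 := measurable_fst_slice hu
  have h2 := measurable_snd_slice hu
  have h3 := measurable_fst_slice hw
  have h4 := measurable_snd_slice hw
  unfold crossDensity
  fun_prop

lemma measurable_gagliardo_density {N : ℕ} (p s : ℝ) {u : RN N × ℝ → ℝ} (hu : Measurable u) :
    Measurable fun q : ℝ × (RN N × RN N) =>
      ENNReal.ofReal
        (|u (q.2.1, q.1) - u (q.2.2, q.1)| ^ p / ‖q.2.1 - q.2.2‖ ^ ((N : ℝ) + p * s)) := by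
  have h1 := measurable_fst_slice hu
  have h2 := measurable_snd_slice hu
  fun_prop

lemma measurable_gagliardoPow {N : ℕ} (p s : ℝ) {u : RN N × ℝ → ℝ} (hu : Measurable u)
    (U : Set (RN N)) : Measurable fun τ => gagliardoPow s p U (fun x => u (x, τ)) :=
  (measurable_gagliardo_density p s hu).lintegral_prod_right'

lemma lintegral_crossDensity_time_le {N : ℕ} (hN : 1 ≤ N) {p s : ℝ} (hp : 1 < p) (hp2 : p < 2)
    (hs₀ : 0 < s) (hs₁ : s < 1) {x₀ : RN N} {R₁ R Θ : ℝ} (hR : R₁ < R) (hΘ : 0 ≤ Θ)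
    {u w : RN N × ℝ → ℝ} (hu : Measurable u) (hw : Measurable w) {J : Set ℝ}
    (hT : ∀ᵐ τ ∂(volume.restrict J), TailBound p s x₀ R₁ R Θ (fun x => u (x, τ)))
    (hw0 : ∀ x τ, x ∉ Metric.ball x₀ R₁ → w (x, τ) = 0) :
    ∫⁻ τ in J, ∫⁻ z, crossDensity p s (fun x => u (x, τ)) (fun x => w (x, τ)) z ≤
      (∫⁻ τ in J, gagliardoPow s p (Metric.ball x₀ R) (fun x => u (x, τ))) ^ ((p - 1) / p)
        * (∫⁻ τ in J, gagliardoPow s p univ (fun x => w (x, τ))) ^ (1 / p)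
      + 2 * (ENNReal.ofReal ((1 / (R - R₁)) ^ (p * s) * cutoffMass N p s + Θ)
        * ((∫⁻ τ in J, ∫⁻ x in Metric.ball x₀ R, ENNReal.ofReal ((1 + |u (x, τ)|) ^ 2))
            ^ (1 / 2 : ℝ)
          * (∫⁻ τ in J, ∫⁻ x in Metric.ball x₀ R, ENNReal.ofReal (w (x, τ) ^ 2))
            ^ (1 / 2 : ℝ))) := by
  set U := Metric.ball x₀ R with hU
  have hm := measurable_crossDensity_time p s hu hw
  have hp0 : 0 < p := by linarith
  calc _ ≤ ∫⁻ τ in J, ((∫⁻ z in U ×ˢ U,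
          crossDensity p s (fun x => u (x, τ)) (fun x => w (x, τ)) z)
      + 2 * (ENNReal.ofReal ((1 / (R - R₁)) ^ (p * s) * cutoffMass N p s + Θ)
        * ∫⁻ x in U, ENNReal.ofReal ((1 + |u (x, τ)|) * |w (x, τ)|))) := by
        refine lintegral_mono_ae ?_
        filter_upwards [hT] with τ hτ
        exact lintegral_crossDensity_le hN hp hp2 hs₀ hs₁ hR hΘ (measurable_slice hu τ)
          (measurable_slice hw τ) hτ (fun x hx => hw0 x τ hx)
    _ = (∫⁻ τ in J, ∫⁻ z in U ×ˢ U,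
          crossDensity p s (fun x => u (x, τ)) (fun x => w (x, τ)) z)
      + 2 * (ENNReal.ofReal ((1 / (R - R₁)) ^ (p * s) * cutoffMass N p s + Θ)
        * ∫⁻ τ in J, ∫⁻ x in U, ENNReal.ofReal ((1 + |u (x, τ)|) * |w (x, τ)|)) := by
        have m1 : Measurable fun τ => ∫⁻ z in U ×ˢ U,
            crossDensity p s (fun x => u (x, τ)) (fun x => w (x, τ)) z := hm.lintegral_prod_right'
        have m0 : Measurable fun q : RN N × ℝ => ENNReal.ofReal ((1 + |u q|) * |w q|) := by
          fun_prop
        have m2 : Measurable fun τ => ∫⁻ x in U, ENNReal.ofReal ((1 + |u (x, τ)|) * |w (x, τ)|) :=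
          m0.lintegral_prod_left'
        rw [lintegral_add_left m1, lintegral_const_mul _ (m2.const_mul _),
          lintegral_const_mul _ m2]
    _ ≤ _ := by
        gcongr
        · have h1 : ∫⁻ τ in J, ∫⁻ z in U ×ˢ U,
              crossDensity p s (fun x => u (x, τ)) (fun x => w (x, τ)) z =
              ∫⁻ q : ℝ × (RN N × RN N), ((fun q : ℝ × (RN N × RN N) => ENNReal.ofReal (
                |u (q.2.1, q.1) - u (q.2.2, q.1)| ^ (p - 1)
                  / ‖q.2.1 - q.2.2‖ ^ (((N : ℝ) + p * s) * ((p - 1) / p)))) *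
              fun q : ℝ × (RN N × RN N) => ENNReal.ofReal (
                |w (q.2.1, q.1) - w (q.2.2, q.1)|
                  / ‖q.2.1 - q.2.2‖ ^ (((N : ℝ) + p * s) * (1 / p)))) q
              ∂((volume.restrict J).prod (volume.restrict (U ×ˢ U))) := by
            rw [← lintegral_prod _ hm.aemeasurable]
            refine lintegral_congr fun q => ?_
            simp only [crossDensity, Pi.mul_apply]
            rw [← ENNReal.ofReal_mul (by positivity), div_mul_div_comm,
              ← Real.rpow_add_of_nonneg (norm_nonneg _)
                (mul_nonneg (by positivity) (div_nonneg (by linarith) hp0.le)) (by positivity)]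
            congr 3
            field_simp; ring
          have hconj : (p / (p - 1)).HolderConjugate p := by
            have := (Real.HolderConjugate.conjExponent hp).symm
            exact this
          rw [h1]
          have f1 := measurable_fst_slice hu
          have f2 := measurable_snd_slice hu
          have g1 := measurable_fst_slice hw
          have g2 := measurable_snd_slice hw
          refine (ENNReal.lintegral_mul_le_Lp_mul_Lq _ hconj (by fun_prop) (by fun_prop)).trans ?_
          have hwu : ∫⁻ τ in J, gagliardoPow s p (Metric.ball x₀ R) (fun x => w (x, τ)) ≤
              ∫⁻ τ in J, gagliardoPow s p univ (fun x => w (x, τ)) := by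
            refine lintegral_mono fun τ => ?_
            exact lintegral_mono_set (prod_mono (subset_univ _) (subset_univ _))
          have e1 : (1 : ℝ) / (p / (p - 1)) = (p - 1) / p := by rw [one_div_div]
          have hpm : p - 1 ≠ 0 := by linarith
          rw [e1]
          gcongr ?_ ^ _ * ?_ ^ _
          · have hgm := measurable_gagliardo_density p s hu
            simp only [gagliardoPow]
            rw [← lintegral_prod _ hgm.aemeasurable]
            refine le_of_eq (lintegral_congr fun q => ?_)
            rw [ENNReal.ofReal_rpow_of_nonneg (by positivity)
              (div_nonneg (by linarith) (by linarith)),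
              Real.div_rpow (by positivity) (by positivity), ← Real.rpow_mul (abs_nonneg _),
              ← Real.rpow_mul (norm_nonneg _)]
            congr 3 <;> field_simp
          · refine le_trans (le_of_eq ?_) hwu
            have hgm := measurable_gagliardo_density p s hw
            simp only [gagliardoPow]
            rw [← lintegral_prod _ hgm.aemeasurable]
            refine (lintegral_congr fun q => ?_)
            rw [ENNReal.ofReal_rpow_of_nonneg (by positivity) hp0.le,
              Real.div_rpow (by positivity) (by positivity), ← Real.rpow_mul (norm_nonneg _)]
            congr 3; field_simp
        · have n1 : Measurable fun q : ℝ × RN N => u (q.2, q.1) := hu.comp measurable_swap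
          have n2 : Measurable fun q : ℝ × RN N => w (q.2, q.1) := hw.comp measurable_swap
          have m0 : Measurable fun q : ℝ × RN N =>
              ENNReal.ofReal ((1 + |u (q.2, q.1)|) * |w (q.2, q.1)|) := by fun_prop
          have m3 : Measurable fun q : ℝ × RN N => ENNReal.ofReal ((1 + |u (q.2, q.1)|) ^ 2) := by
            fun_prop
          have m4 : Measurable fun q : ℝ × RN N => ENNReal.ofReal (w (q.2, q.1) ^ 2) := by
            fun_prop
          have h2 : ∫⁻ τ in J, ∫⁻ x in U, ENNReal.ofReal ((1 + |u (x, τ)|) * |w (x, τ)|) =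
              ∫⁻ q : ℝ × RN N, ((fun q : ℝ × RN N => ENNReal.ofReal (1 + |u (q.2, q.1)|)) *
                fun q : ℝ × RN N => ENNReal.ofReal |w (q.2, q.1)|) q
              ∂((volume.restrict J).prod (volume.restrict U)) := by
            rw [← lintegral_prod _ m0.aemeasurable]
            refine lintegral_congr fun q => ?_
            rw [Pi.mul_apply, ENNReal.ofReal_mul (by positivity)]
          rw [h2]
          refine (ENNReal.lintegral_mul_le_Lp_mul_Lq _ Real.HolderConjugate.two_two (by fun_prop)
            (by fun_prop)).trans ?_
          rw [← lintegral_prod _ m3.aemeasurable, ← lintegral_prod _ m4.aemeasurable]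
          apply le_of_eq
          congr 3
          · funext q
            rw [ENNReal.ofReal_rpow_of_nonneg (by positivity) zero_le_two, Real.rpow_two]
          · funext q
            rw [ENNReal.ofReal_rpow_of_nonneg (by positivity) zero_le_two, Real.rpow_two, sq_abs]

/-- The Gagliardo difference quotient of `v`, as a function on `ℝ × (ℝ^N × ℝ^N)`. -/
noncomputable def diffQuot {N : ℕ} (p s : ℝ) (v : RN N × ℝ → ℝ) (q : ℝ × (RN N × RN N)) : ℝ :=
  (v (q.2.1, q.1) - v (q.2.2, q.1)) / ‖q.2.1 - q.2.2‖ ^ (((N : ℝ) + p * s) * (1 / p))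

lemma measurable_diffQuot {N : ℕ} (p s : ℝ) {v : RN N × ℝ → ℝ} (hv : Measurable v) :
    Measurable (diffQuot p s v) := by
  have h1 := measurable_fst_slice hv
  have h2 := measurable_snd_slice hv
  unfold diffQuot
  fun_prop

lemma enorm_diffQuot_rpow {N : ℕ} {p : ℝ} (hp : 0 < p) (s : ℝ) (v : RN N × ℝ → ℝ)
    (q : ℝ × (RN N × RN N)) :
    ‖diffQuot p s v q‖ₑ ^ p = ENNReal.ofReal
      (|v (q.2.1, q.1) - v (q.2.2, q.1)| ^ p / ‖q.2.1 - q.2.2‖ ^ ((N : ℝ) + p * s)) := by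
  rw [Real.enorm_eq_ofReal_abs, ENNReal.ofReal_rpow_of_nonneg (abs_nonneg _) hp.le, diffQuot,
    abs_div, abs_of_nonneg (Real.rpow_nonneg (norm_nonneg _) _),
    Real.div_rpow (abs_nonneg _) (by positivity), ← Real.rpow_mul (norm_nonneg _)]
  congr 3; field_simp

lemma eLpNorm_diffQuot {N : ℕ} {p : ℝ} (hp : 0 < p) (s : ℝ) {v : RN N × ℝ → ℝ}
    (hv : Measurable v) :
    eLpNorm (diffQuot p s v) (ENNReal.ofReal p) ((volume : Measure ℝ).prod volume)
      = (∫⁻ τ, gagliardoPow s p univ (fun x => v (x, τ))) ^ (1 / p) := by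
  rw [eLpNorm_eq_lintegral_rpow_enorm_toReal (by simpa using hp) (by simp),
    ENNReal.toReal_ofReal hp.le]
  congr 1
  simp only [enorm_diffQuot_rpow hp, gagliardoPow, univ_prod_univ, Measure.restrict_univ]
  rw [lintegral_prod _ (measurable_gagliardo_density p s hv).aemeasurable]

lemma eLpNorm_two_eq {N : ℕ} {v : RN N × ℝ → ℝ} (hv : Measurable v) (U : Set (RN N)) :
    eLpNorm (fun q : ℝ × RN N => v (q.2, q.1)) 2 ((volume : Measure ℝ).prod (volume.restrict U))
      = (∫⁻ τ, ∫⁻ x in U, ENNReal.ofReal (v (x, τ) ^ 2)) ^ (1 / 2 : ℝ) := by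
  have n2 : Measurable fun q : ℝ × RN N => v (q.2, q.1) := hv.comp measurable_swap
  have m4 : Measurable fun q : ℝ × RN N => ENNReal.ofReal (v (q.2, q.1) ^ 2) := by fun_prop
  rw [eLpNorm_eq_lintegral_rpow_enorm_toReal (by simp) (by simp),
    ← lintegral_prod _ m4.aemeasurable, ENNReal.toReal_ofNat]
  congr 1
  refine lintegral_congr fun q => ?_
  rw [Real.enorm_eq_ofReal_abs, ENNReal.ofReal_rpow_of_nonneg (abs_nonneg _) zero_le_two,
    Real.rpow_two, sq_abs]

/-- The flux of `u` paired with the time increments of `v` tends to zero. -/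
lemma tendsto_lintegral_crossDensity_translate {N : ℕ} (hN : 1 ≤ N) {p s : ℝ} (hp : 1 < p)
    (hp2 : p < 2) (hs₀ : 0 < s) (hs₁ : s < 1) {x₀ : RN N} {R₁ R Θ : ℝ} (hR : R₁ < R) (hΘ : 0 ≤ Θ)
    {u v : RN N × ℝ → ℝ} (hu : Measurable u) (hv : Measurable v) {J : Set ℝ}
    (hT : ∀ᵐ τ ∂(volume.restrict J), TailBound p s x₀ R₁ R Θ (fun x => u (x, τ)))
    (hv0 : ∀ x τ, x ∉ Metric.ball x₀ R₁ → v (x, τ) = 0)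
    (hX : ∫⁻ τ in J, gagliardoPow s p (Metric.ball x₀ R) (fun x => u (x, τ)) ≠ ⊤)
    (hU : ∫⁻ τ in J, ∫⁻ x in Metric.ball x₀ R, ENNReal.ofReal ((1 + |u (x, τ)|) ^ 2) ≠ ⊤)
    (hG : ∫⁻ τ, gagliardoPow s p univ (fun x => v (x, τ)) ≠ ⊤)
    (hV : ∫⁻ τ, ∫⁻ x in Metric.ball x₀ R, ENNReal.ofReal (v (x, τ) ^ 2) ≠ ⊤) :
    Tendsto (fun σ => ∫⁻ τ in J, ∫⁻ z, crossDensity p s (fun x => u (x, τ))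
      (fun x => v (x, σ + τ) - v (x, τ)) z) (𝓝 0) (𝓝 0) := by
  have hp0 : 0 < p := by linarith
  set U := Metric.ball x₀ R
  have hwm : ∀ σ : ℝ, Measurable fun q : RN N × ℝ => v (q.1, σ + q.2) - v q := by
    intro σ
    have : Measurable fun q : RN N × ℝ => v (q.1, σ + q.2) :=
      hv.comp (measurable_fst.prodMk (measurable_const.add measurable_snd))
    exact this.sub hv
  have memV : MemLp (diffQuot p s v) (ENNReal.ofReal p) ((volume : Measure ℝ).prod volume) := by
    refine ⟨(measurable_diffQuot p s hv).aestronglyMeasurable, ?_⟩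
    rw [eLpNorm_diffQuot hp0 s hv]
    exact ENNReal.rpow_lt_top_of_nonneg (by positivity) hG
  have memv : MemLp (fun q : ℝ × RN N => v (q.2, q.1)) 2
      ((volume : Measure ℝ).prod (volume.restrict U)) := by
    refine ⟨(hv.comp measurable_swap).aestronglyMeasurable, ?_⟩
    rw [eLpNorm_two_eq hv]
    exact ENNReal.rpow_lt_top_of_nonneg (by positivity) hV
  have hA := tendsto_eLpNorm_translate_fst (by simpa using hp.le) (by simp) memV
  have hB := tendsto_eLpNorm_translate_fst (by norm_num) (by simp) memv
  set c := ENNReal.ofReal ((1 / (R - R₁)) ^ (p * s) * cutoffMass N p s + Θ)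
  set X := (∫⁻ τ in J, gagliardoPow s p U (fun x => u (x, τ))) ^ ((p - 1) / p) with hXdef
  set Y := (∫⁻ τ in J, ∫⁻ x in U, ENNReal.ofReal ((1 + |u (x, τ)|) ^ 2)) ^ (1 / 2 : ℝ) with hYdef
  have hXt : X ≠ ⊤ :=
    (ENNReal.rpow_lt_top_of_nonneg (div_nonneg (by linarith) hp0.le) hX).ne
  have hYt : Y ≠ ⊤ := (ENNReal.rpow_lt_top_of_nonneg (by norm_num) hU).ne
  have hlim : Tendsto (fun σ : ℝ => X * eLpNorm (fun z => diffQuot p s v (σ + z.1, z.2)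
      - diffQuot p s v z) (ENNReal.ofReal p) ((volume : Measure ℝ).prod volume)
      + 2 * (c * (Y * eLpNorm (fun z : ℝ × RN N => v (z.2, σ + z.1) - v (z.2, z.1)) 2
        ((volume : Measure ℝ).prod (volume.restrict U))))) (𝓝 0) (𝓝 0) := by
    have h1 := ENNReal.Tendsto.const_mul hA (Or.inr hXt)
    have h2 := ENNReal.Tendsto.const_mul (a := 2) (ENNReal.Tendsto.const_mul (a := c)
      (ENNReal.Tendsto.const_mul hB (Or.inr hYt)) (Or.inr (by simp [c]))) (Or.inr (by simp))
    simpa using h1.add h2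
  refine tendsto_of_tendsto_of_tendsto_of_le_of_le tendsto_const_nhds hlim (fun _ => zero_le) ?_
  intro σ
  refine (lintegral_crossDensity_time_le hN hp hp2 hs₀ hs₁ hR hΘ hu (hwm σ) hT ?_).trans ?_
  · intro x τ hx
    simp only
    rw [hv0 x _ hx, hv0 x _ hx, sub_zero]
  · have e1 : (fun z => diffQuot p s v (σ + z.1, z.2) - diffQuot p s v z)
        = diffQuot p s (fun q : RN N × ℝ => v (q.1, σ + q.2) - v q) := by
      funext z
      simp only [diffQuot]
      rw [← sub_div]; congr 1; ring
    have e2 : (fun z : ℝ × RN N => v (z.2, σ + z.1) - v (z.2, z.1)) =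
        fun q : ℝ × RN N => (fun q : RN N × ℝ => v (q.1, σ + q.2) - v q) (q.2, q.1) := rfl
    dsimp only
    rw [e1, e2, eLpNorm_diffQuot hp0 s (hwm σ), eLpNorm_two_eq (hwm σ)]
    gcongr
    · exact Measure.restrict_le_self
    · exact Measure.restrict_le_self

lemma le_of_integral_sub_shift_le {H : ℝ → ℝ} {a b t₁ t₂ : ℝ} (hH : ContinuousOn H (Icc a b))
    (h1 : a < t₁) (h12 : t₁ < t₂) (h2 : t₂ < b)
    (h : ∀ ε > 0, ∀ᶠ δ in 𝓝[>] (0 : ℝ), ∫ t in t₁..t₂, (H t - H (t - δ)) ≤ ε * δ) :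
    H t₂ ≤ H t₁ := by
  by_contra! hcon
  set ε := (H t₂ - H t₁) / 4 with hε
  have hε0 : 0 < ε := by rw [hε]; linarith
  have hc2 : ContinuousAt H t₂ := hH.continuousAt (Icc_mem_nhds (by linarith) h2)
  have hc1 : ContinuousAt H t₁ := hH.continuousAt (Icc_mem_nhds h1 (by linarith))
  obtain ⟨d2, hd2, hd2'⟩ := Metric.continuousAt_iff.1 hc2 ε hε0
  obtain ⟨d1, hd1, hd1'⟩ := Metric.continuousAt_iff.1 hc1 ε hε0
  have hev : ∀ᶠ δ in 𝓝[>] (0 : ℝ), δ < min (min d1 d2) (t₁ - a) :=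
    mem_nhdsWithin_of_mem_nhds (Iio_mem_nhds (lt_min (lt_min hd1 hd2) (by linarith)))
  obtain ⟨δ, ⟨hδ, hδ2⟩, hδ0⟩ := ((h ε hε0).and hev).and self_mem_nhdsWithin |>.exists
  have hδ0 : 0 < δ := hδ0
  have hδ1 : δ < d1 := hδ2.trans_le ((min_le_left _ _).trans (min_le_left _ _))
  have hδ2' : δ < d2 := hδ2.trans_le ((min_le_left _ _).trans (min_le_right _ _))
  have hδ3 : δ < t₁ - a := hδ2.trans_le (min_le_right _ _)
  have hint : ∀ c d, a ≤ c → c ≤ b → a ≤ d → d ≤ b → IntervalIntegrable H volume c d := by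
    intro c d hc hc' hd hd'
    apply ContinuousOn.intervalIntegrable
    exact hH.mono (uIcc_subset_Icc ⟨hc, hc'⟩ ⟨hd, hd'⟩)
  have i1 := hint t₁ t₂ (by linarith) (by linarith) (by linarith) (by linarith)
  have i2 := hint (t₁ - δ) (t₂ - δ) (by linarith) (by linarith) (by linarith) (by linarith)
  have i3 := hint t₁ (t₁ - δ) (by linarith) (by linarith) (by linarith) (by linarith)
  have i2' : IntervalIntegrable (fun t => H (t - δ)) volume t₁ t₂ := by
    simpa using i2.comp_sub_right δ
  rw [intervalIntegral.integral_sub i1 i2', intervalIntegral.integral_comp_sub_right,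
    intervalIntegral.integral_interval_sub_interval_comm i1 i2 i3,
    intervalIntegral.integral_symm (t₁ - δ), intervalIntegral.integral_symm (t₂ - δ)] at hδ
  have k1 : ∫ t in (t₁ - δ)..t₁, H t ≤ δ * (H t₁ + ε) := by
    have := intervalIntegral.integral_mono_on (a := t₁ - δ) (b := t₁) (by linarith) i3.symm
      (intervalIntegrable_const (c := H t₁ + ε)) (fun t ht => by
        have := hd1' (x := t) (by rw [Real.dist_eq, abs_lt]; constructor <;> linarith [ht.1, ht.2])
        rw [Real.dist_eq, abs_lt] at this
        linarith [this.2])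
    rw [intervalIntegral.integral_const, smul_eq_mul] at this
    linarith
  have k2 : δ * (H t₂ - ε) ≤ ∫ t in (t₂ - δ)..t₂, H t := by
    have := intervalIntegral.integral_mono_on (a := t₂ - δ) (b := t₂) (by linarith)
      (intervalIntegrable_const (c := H t₂ - ε))
      (hint (t₂ - δ) t₂ (by linarith) (by linarith) (by linarith) (by linarith)) (fun t ht => by
        have := hd2' (x := t) (by rw [Real.dist_eq, abs_lt]; constructor <;> linarith [ht.1, ht.2])
        rw [Real.dist_eq, abs_lt] at this
        linarith [this.1])
    rw [intervalIntegral.integral_const, smul_eq_mul] at this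
    linarith
  have : H t₂ = H t₁ + 4 * ε := by rw [hε]; ring
  nlinarith [mul_pos hδ0 hε0]

/-- Functions of `W^{s,p}_0(U) ∩ L²(U)`, constant in time, are test functions. -/
lemma isTestFunction_const {N : ℕ} {s p : ℝ} {U : Set (RN N)} (hU : MeasurableSet U) (T : EReal)
    {φ : RN N → ℝ} (hφ : AEMeasurable φ) (h0 : ∀ x, x ∉ U → φ x = 0)
    (hS : sobolevPow s p univ φ ≠ ⊤) (h2 : MemLp φ 2 (volume.restrict U)) :
    IsTestFunction s p U T (fun z => φ z.1) (fun _ => 0) where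
  aemeasurable := by
    rw [Measure.volume_eq_prod, ← Measure.prod_restrict, Measure.restrict_univ]
    exact hφ.comp_fst
  vanish := by
    have := ae_restrict_mem (μ := (volume : Measure (RN N × ℝ)))
      (hU.compl.prod (isOpen_timeDom T).measurableSet)
    filter_upwards [this] with z hz
    exact h0 _ hz.1
  sobolev := by
    intro t₁ t₂ _ _ _
    dsimp only
    rw [lintegral_const]
    refine ENNReal.mul_lt_top hS.lt_top ?_
    simp
  cont := ⟨fun _ _ => h2, fun _ _ => by simp⟩
  deriv_aemeasurable := aemeasurable_const
  deriv_sq := by simp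
  weak_deriv := by
    intro η hη hc hs
    refine Eventually.of_forall fun x => ?_
    have hd : ∫ τ in timeDom T, deriv η τ = 0 := by
      rw [setIntegral_eq_integral_of_forall_compl_eq_zero]
      · have hcd : HasCompactSupport (deriv η) := hc.deriv
        have hcont : Continuous (deriv η) := hη.continuous_deriv (by simp)
        have hi := hcont.integrable_of_hasCompactSupport hcd (μ := volume)
        have h1 := hc.is_zero_at_infty
        rw [cocompact_eq_atBot_atTop] at h1
        have := integral_of_hasDerivAt_of_tendsto (f := η) (f' := deriv η) (m := 0) (n := 0)
          (fun τ => (hη.differentiable (by simp) τ).hasDerivAt) hi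
          (h1.mono_left le_sup_left) (h1.mono_left le_sup_right)
        simpa using this
      · intro τ hτ
        by_contra hne
        exact hτ (hs (support_deriv_subset hne))
    simp only
    rw [integral_const_mul, hd]
    simp

/-- `u'` and `K'` are everywhere measurable versions of a local weak solution `u` and its
kernel `K`. -/
structure MeasurableVersion {N : ℕ} (p s C₁ C₂ : ℝ) (Ω : Set (RN N)) (T : EReal)
    (K : RN N × RN N × ℝ → ℝ) (u : RN N × ℝ → ℝ) (K' : RN N × RN N × ℝ → ℝ)
    (u' : RN N × ℝ → ℝ) : Prop where
  one_le_dim : 1 ≤ N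
  one_lt_p : 1 < p
  p_lt_two : p < 2
  s_pos : 0 < s
  s_lt_one : s < 1
  C₁_pos : 0 < C₁
  sol : IsLocalWeakSolution p s Ω T K u
  meas : Measurable u'
  ae_eq : ∀ᵐ τ ∂(volume.restrict (timeDom T)), ∀ᵐ x : RN N, u (x, τ) = u' (x, τ)
  kernel_meas : Measurable K'
  kernel_ge : ∀ q, C₁ / ‖q.1 - q.2.1‖ ^ ((N : ℝ) + p * s) ≤ K' q
  kernel_le : ∀ q, K' q ≤ C₂ / ‖q.1 - q.2.1‖ ^ ((N : ℝ) + p * s)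
  kernel_ae_eq : ∀ᵐ τ ∂(volume.restrict (timeDom T)), ∀ᵐ z : RN N × RN N,
    K (z.1, z.2, τ) = K' (z.1, z.2, τ)

lemma exists_measurableVersion {N : ℕ} {p s C₁ C₂ : ℝ} {Ω : Set (RN N)} {T : EReal}
    {K : RN N × RN N × ℝ → ℝ} {u : RN N × ℝ → ℝ} (hN : 1 ≤ N) (hp : 1 < p) (hp2 : p < 2)
    (hs₀ : 0 < s) (hs₁ : s < 1) (hC₁ : 0 < C₁) (hC₂ : C₁ ≤ C₂)
    (hK : IsKernel N p s C₁ C₂ T K) (hu : IsLocalWeakSolution p s Ω T K u) :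
    ∃ K' u', MeasurableVersion p s C₁ C₂ Ω T K u K' u' ∧
      ∀ᵐ z ∂(volume.restrict (univ ×ˢ timeDom T) : Measure (RN N × ℝ)), u z = u' z := by
  obtain ⟨K', h1, h2, h3, h4⟩ := hK.exists_measurable hC₁ hC₂
  refine ⟨K', hu.aemeasurable.mk u, ⟨hN, hp, hp2, hs₀, hs₁, hC₁, hu,
    hu.aemeasurable.measurable_mk, ?_, h1, h2, h3, h4⟩, hu.aemeasurable.ae_eq_mk⟩
  exact ae_slice hu.aemeasurable.ae_eq_mk

variable {N : ℕ} {p s C₁ C₂ : ℝ} {Ω : Set (RN N)} {T : EReal}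
  {K : RN N × RN N × ℝ → ℝ} {u : RN N × ℝ → ℝ} {K' : RN N × RN N × ℝ → ℝ} {u' : RN N × ℝ → ℝ}

lemma ae_prod_of_ae {P : RN N → Prop} (h : ∀ᵐ x, P x) :
    ∀ᵐ z : RN N × RN N, P z.1 ∧ P z.2 := by
  rw [Measure.volume_eq_prod]
  exact (Measure.quasiMeasurePreserving_fst.ae h).and (Measure.quasiMeasurePreserving_snd.ae h)

lemma gagliardoPow_congr {U : Set (RN N)} {f g : RN N → ℝ} (h : ∀ᵐ x, f x = g x) :
    gagliardoPow s p U f = gagliardoPow s p U g := by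
  refine lintegral_congr_ae (ae_restrict_of_ae ?_)
  filter_upwards [ae_prod_of_ae h] with z hz
  rw [hz.1, hz.2]

namespace MeasurableVersion

lemma ae_eq_of_subset (h : MeasurableVersion p s C₁ C₂ Ω T K u K' u') {J : Set ℝ}
    (hJ : J ⊆ timeDom T) : ∀ᵐ τ ∂(volume.restrict J), ∀ᵐ x : RN N, u (x, τ) = u' (x, τ) :=
  ae_restrict_of_ae_restrict_of_subset hJ h.ae_eq

lemma exists_tailBound (h : MeasurableVersion p s C₁ C₂ Ω T K u K' u') {a b : ℝ} (ha : 0 < a)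
    (hab : a < b) (hb : (b : EReal) < T) (x₀ : RN N) {R₁ R : ℝ} (hR : R₁ < R) :
    ∃ Θ : ℝ, 0 ≤ Θ ∧ ∀ᵐ τ ∂(volume.restrict (Ioo a b)),
      TailBound p s x₀ R₁ R Θ (fun x => u' (x, τ)) := by
  have hν : 0 < (N : ℝ) + p * s := by
    have := h.s_pos; have := h.one_lt_p; positivity
  have ht := h.sol.tail a b ha hab hb
  set M := essSup (fun τ => ∫⁻ x : RN N,
        ENNReal.ofReal (|u (x, τ)| ^ (p - 1) / (1 + ‖x‖) ^ ((N : ℝ) + p * s)))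
      (volume.restrict (Ioo a b)) with hM
  have hle := ae_le_essSup (μ := volume.restrict (Ioo a b)) (f := fun τ => ∫⁻ x : RN N,
        ENNReal.ofReal (|u (x, τ)| ^ (p - 1) / (1 + ‖x‖) ^ ((N : ℝ) + p * s)))
  rw [← hM] at hle
  have hd : 0 < R - R₁ := by linarith
  set c := (1 + (1 + ‖x₀‖ + |R₁|) / (R - R₁)) ^ ((N : ℝ) + p * s) with hc
  have hc0 : 0 ≤ c := by positivity
  refine ⟨c * M.toReal, by positivity, ?_⟩
  filter_upwards [hle, h.ae_eq_of_subset (Ioo_subset_timeDom ha hb)] with τ h1 h2 x hx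
  rw [ENNReal.ofReal_mul hc0, ENNReal.ofReal_toReal ht.ne]
  refine le_trans ?_ (mul_le_mul_right h1 _)
  have m0 : AEMeasurable (fun x => ENNReal.ofReal (|u (x, τ)| ^ (p - 1)
      / (1 + ‖x‖) ^ ((N : ℝ) + p * s))) := by
    have m1 := measurable_slice h.meas τ
    have m3 := h.meas
    have m2 : Measurable (fun x => ENNReal.ofReal (|u' (x, τ)| ^ (p - 1)
      / (1 + ‖x‖) ^ ((N : ℝ) + p * s))) := by fun_prop
    refine m2.aemeasurable.congr ?_
    filter_upwards [h2] with x hx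
    rw [hx]
  rw [← lintegral_const_mul'' _ m0]
  refine le_trans ?_ (setLIntegral_le_lintegral (Metric.ball x₀ R)ᶜ _)
  refine lintegral_mono_ae ?_
  filter_upwards [ae_restrict_of_ae h2, ae_restrict_mem measurableSet_ball.compl] with y hy hyU
  rw [hy, ← ENNReal.ofReal_mul hc0]
  apply ENNReal.ofReal_le_ofReal
  have e1 := sub_le_norm_of_mem_ball hx hyU
  have e2 : 1 + ‖y‖ ≤ (1 + (1 + ‖x₀‖ + |R₁|) / (R - R₁)) * ‖x - y‖ := by
    have e3 : (1 + ‖x₀‖ + |R₁|) ≤ (1 + ‖x₀‖ + |R₁|) / (R - R₁) * ‖x - y‖ := by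
      rw [div_mul_eq_mul_div, le_div_iff₀ hd]
      gcongr
    have e4 : ‖y‖ ≤ ‖x - y‖ + ‖x₀‖ + |R₁| := by
      have f1 : ‖y‖ ≤ ‖x - y‖ + ‖x‖ := by
        have := norm_sub_norm_le y x
        rw [norm_sub_rev] at this; linarith
      have f2 : ‖x‖ ≤ ‖x - x₀‖ + ‖x₀‖ := by
        have := norm_sub_norm_le x x₀
        linarith
      rw [Metric.mem_ball, dist_eq_norm] at hx
      linarith [le_abs_self R₁]
    linarith
  have hxy : 0 < ‖x - y‖ := by linarith
  have hy1 : 0 < 1 + ‖y‖ := by positivity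
  rw [mul_div_assoc', div_le_div_iff₀ (by positivity) (by positivity)]
  have e5 : (1 + ‖y‖) ^ ((N : ℝ) + p * s) ≤ c * ‖x - y‖ ^ ((N : ℝ) + p * s) := by
    rw [hc, ← Real.mul_rpow (by positivity) hxy.le]
    exact Real.rpow_le_rpow hy1.le e2 hν.le
  have e6 : 0 ≤ |u' (x, τ)| ^ (p - 1) := by positivity
  calc |u' (y, τ)| ^ (p - 1) * (1 + ‖y‖) ^ ((N : ℝ) + p * s)
      ≤ |u' (y, τ)| ^ (p - 1) * (c * ‖x - y‖ ^ ((N : ℝ) + p * s)) := by gcongr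
    _ = _ := by ring

lemma lintegral_gagliardoPow_ne_top (h : MeasurableVersion p s C₁ C₂ Ω T K u K' u') {a b : ℝ}
    (ha : 0 < a) (hab : a < b) (hb : (b : EReal) < T) {U : Set (RN N)} (hU : CompactlyIn U Ω) :
    ∫⁻ τ in Ioo a b, gagliardoPow s p U (fun x => u' (x, τ)) ≠ ⊤ := by
  refine ne_top_of_le_ne_top (h.sol.sobolev U hU a b ha hab hb).ne ?_
  refine lintegral_mono_ae ?_
  filter_upwards [h.ae_eq_of_subset (Ioo_subset_timeDom ha hb)] with τ hτ
  rw [← gagliardoPow_congr hτ]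
  exact le_add_self

lemma exists_L2_bound (h : MeasurableVersion p s C₁ C₂ Ω T K u K' u') {a b : ℝ}
    (ha : 0 < a) (hb : (b : EReal) < T) {U : Set (RN N)} (hU : CompactlyIn U Ω) :
    ∃ M : ℝ≥0∞, M ≠ ⊤ ∧ ∀ τ ∈ Icc a b,
      eLpNorm (fun x => u (x, τ)) 2 (volume.restrict U) ≤ M := by
  obtain ⟨hm, hc⟩ := h.sol.cont U hU
  have hsub : ∀ τ ∈ Icc a b, τ ∈ timeDom T := fun τ hτ => mem_timeDom_of_lt ha hb hτ.1 hτ.2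
  refine isCompact_Icc.induction_on (p := fun S => ∃ M : ℝ≥0∞, M ≠ ⊤ ∧ ∀ τ ∈ S,
      eLpNorm (fun x => u (x, τ)) 2 (volume.restrict U) ≤ M) ⟨0, by simp, by simp⟩ ?_ ?_ ?_
  · rintro S S' hSS' ⟨M, hM, h⟩
    exact ⟨M, hM, fun τ hτ => h τ (hSS' hτ)⟩
  · rintro S S' ⟨M, hM, h⟩ ⟨M', hM', h'⟩
    refine ⟨M + M', by simp [hM, hM'], ?_⟩
    rintro τ (hτ | hτ)
    · exact (h τ hτ).trans le_self_add
    · exact (h' τ hτ).trans le_add_self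
  · intro τ₀ hτ₀
    have h1 := (hc τ₀ (hsub τ₀ hτ₀)).eventually_le_const (u := 1) (by simp)
    have h2 : ∀ᶠ τ in 𝓝 τ₀, τ ∈ timeDom T :=
      (isOpen_timeDom T).mem_nhds (hsub τ₀ hτ₀)
    refine ⟨{τ | eLpNorm (fun x => u (x, τ) - u (x, τ₀)) 2 (volume.restrict U) ≤ 1 ∧
      τ ∈ timeDom T}, mem_nhdsWithin_of_mem_nhds (h1.and h2),
      eLpNorm (fun x => u (x, τ₀)) 2 (volume.restrict U) + 1, ?_, ?_⟩
    · exact ENNReal.add_ne_top.2 ⟨(hm τ₀ (hsub τ₀ hτ₀)).2.ne, by simp⟩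
    · rintro τ ⟨hτ1, hτ2⟩
      have e : (fun x => u (x, τ)) = (fun x => u (x, τ₀)) + fun x => u (x, τ) - u (x, τ₀) := by
        funext x; simp
      rw [e]
      refine (eLpNorm_add_le (hm τ₀ (hsub τ₀ hτ₀)).1
        ((hm τ hτ2).1.sub (hm τ₀ (hsub τ₀ hτ₀)).1) (by norm_num)).trans ?_
      gcongr
      exact hτ1

lemma lintegral_sq_eq {f : RN N → ℝ} (U : Set (RN N)) :
    ∫⁻ x in U, ENNReal.ofReal (f x ^ 2) = eLpNorm f 2 (volume.restrict U) ^ (2 : ℝ) := by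
  rw [eLpNorm_eq_lintegral_rpow_enorm_toReal (by simp) (by simp), ENNReal.toReal_ofNat,
    ← ENNReal.rpow_mul]
  norm_num
  refine lintegral_congr fun x => ?_
  rw [Real.enorm_eq_ofReal_abs, ← ENNReal.ofReal_pow (abs_nonneg _), sq_abs]

lemma lintegral_sq_ne_top (h : MeasurableVersion p s C₁ C₂ Ω T K u K' u') {a b : ℝ}
    (ha : 0 < a) (hb : (b : EReal) < T) {U : Set (RN N)} (hU : CompactlyIn U Ω) (c : ℝ) :
    ∫⁻ τ in Ioo a b, ∫⁻ x in U, ENNReal.ofReal ((c + |u' (x, τ)|) ^ 2) ≠ ⊤ := by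
  obtain ⟨M, hM, hle⟩ := h.exists_L2_bound ha hb hU
  have hUfin : volume U ≠ ⊤ :=
    ne_top_of_le_ne_top hU.2.1.measure_lt_top.ne (measure_mono subset_closure)
  have hbound : ∫⁻ τ in Ioo a b, ∫⁻ x in U, ENNReal.ofReal ((c + |u' (x, τ)|) ^ 2) ≤
      ∫⁻ _ in Ioo a b, (ENNReal.ofReal (2 * c ^ 2) * volume U + 2 * M ^ (2 : ℝ)) := by
    refine lintegral_mono_ae ?_
    filter_upwards [h.ae_eq_of_subset (Ioo_subset_timeDom ha hb),
      ae_restrict_mem measurableSet_Ioo] with τ hτ hτJ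
    calc _ ≤ ∫⁻ x in U, (ENNReal.ofReal (2 * c ^ 2) + 2 * ENNReal.ofReal (u (x, τ) ^ 2)) := by
          refine lintegral_mono_ae ?_
          filter_upwards [ae_restrict_of_ae hτ] with x hx
          rw [← hx]
          have e2 : 2 * ENNReal.ofReal (u (x, τ) ^ 2) = ENNReal.ofReal (2 * u (x, τ) ^ 2) := by
            rw [ENNReal.ofReal_mul zero_le_two]; simp
          rw [e2, ← ENNReal.ofReal_add (by positivity) (by positivity)]
          apply ENNReal.ofReal_le_ofReal
          nlinarith [sq_nonneg (c - |u (x, τ)|), sq_abs (u (x, τ))]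
      _ = ENNReal.ofReal (2 * c ^ 2) * volume U
          + 2 * ∫⁻ x in U, ENNReal.ofReal (u (x, τ) ^ 2) := by
          rw [lintegral_add_left measurable_const, lintegral_const_mul' _ _ (by simp)]
          simp
      _ ≤ _ := by
          rw [lintegral_sq_eq]
          gcongr
          exact hle τ ⟨hτJ.1.le, hτJ.2.le⟩
  refine ne_top_of_le_ne_top ?_ hbound
  rw [lintegral_const]
  refine ENNReal.mul_ne_top (ENNReal.add_ne_top.2 ⟨ENNReal.mul_ne_top ENNReal.ofReal_ne_top hUfin,
    ENNReal.mul_ne_top (by simp) (ENNReal.rpow_lt_top_of_nonneg (by norm_num) hM).ne⟩) (by simp)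

/-- The weak formulation with a test function that does not depend on time. -/
lemma weak_const (h : MeasurableVersion p s C₁ C₂ Ω T K u K' u') {a b : ℝ}
    (ha : 0 < a) (hab : a < b) (hb : (b : EReal) < T) {U : Set (RN N)} (hU : CompactlyIn U Ω)
    {φ : RN N → ℝ} (hφ : AEMeasurable φ) (h0 : ∀ x, x ∉ U → φ x = 0)
    (hS : sobolevPow s p univ φ ≠ ⊤) (h2 : MemLp φ 2 (volume.restrict U)) :
    (∫ x in U, (u (x, b) - u (x, a)) * φ x) =
      -∫ τ in Ioo a b, ∫ z : RN N × RN N,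
        oddPow p (u' (z.1, τ) - u' (z.2, τ)) * K' (z.1, z.2, τ) * (φ z.1 - φ z.2) := by
  have hw := h.sol.weak U hU a b ha hab hb _ _
    (isTestFunction_const hU.1.measurableSet T hφ h0 hS h2)
  have hm := (h.sol.cont U hU).1
  have i1 : Integrable (fun x => u (x, b) * φ x) (volume.restrict U) :=
    (hm b (mem_timeDom_of_lt ha hb hab.le le_rfl)).integrable_mul h2
  have i2 : Integrable (fun x => u (x, a) * φ x) (volume.restrict U) :=
    (hm a (mem_timeDom_of_lt ha hb le_rfl hab.le)).integrable_mul h2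
  have e1 : (∫ x in U, (u (x, b) - u (x, a)) * φ x) =
      (∫ x in U, u (x, b) * φ x) - ∫ x in U, u (x, a) * φ x := by
    rw [← integral_sub i1 i2]
    congr 1; funext x; ring
  have e2 : ∫ τ in Ioo a b, ∫ z : RN N × RN N,
            |u (z.1, τ) - u (z.2, τ)| ^ (p - 2) * (u (z.1, τ) - u (z.2, τ))
              * (φ z.1 - φ z.2) * K (z.1, z.2, τ) =
      ∫ τ in Ioo a b, ∫ z : RN N × RN N,
        oddPow p (u' (z.1, τ) - u' (z.2, τ)) * K' (z.1, z.2, τ) * (φ z.1 - φ z.2) := by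
    refine integral_congr_ae ?_
    filter_upwards [h.ae_eq_of_subset (Ioo_subset_timeDom ha hb),
      ae_restrict_of_ae_restrict_of_subset (Ioo_subset_timeDom ha hb) h.kernel_ae_eq]
      with τ hτ hτ2
    refine integral_congr_ae ?_
    filter_upwards [ae_prod_of_ae hτ, hτ2] with z hz hz2
    rw [hz.1, hz.2, hz2, oddPow]
    ring
  simp only [mul_zero, integral_zero, sub_zero] at hw
  rw [e2] at hw
  rw [e1]
  linarith

end MeasurableVersion

/-- The localized truncation `(u - k)_+ θ`. -/
noncomputable def truncation (u : RN N × ℝ → ℝ) (k : ℝ) (θ : RN N → ℝ) (q : RN N × ℝ) : ℝ :=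
  max (u q - k) 0 * θ q.1

lemma measurable_truncation (hu : Measurable u) (k : ℝ) {θ : RN N → ℝ} (hθ : Continuous θ) :
    Measurable (truncation u k θ) := by
  have := hθ.measurable
  unfold truncation
  fun_prop

/-- The flux `|u(x)-u(y)|^{p-2}(u(x)-u(y)) K(x,y)`. -/
noncomputable def flux (p : ℝ) (K : RN N × RN N × ℝ → ℝ) (u : RN N × ℝ → ℝ)
    (q : ℝ × (RN N × RN N)) : ℝ :=
  oddPow p (u (q.2.1, q.1) - u (q.2.2, q.1)) * K (q.2.1, q.2.2, q.1)

lemma measurable_flux (p : ℝ) (hK : Measurable K) (hu : Measurable u) :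
    Measurable (flux p K u) := by
  have h1 := measurable_fst_slice hu
  have h2 := measurable_snd_slice hu
  have h3 : Measurable fun q : ℝ × (RN N × RN N) => K (q.2.1, q.2.2, q.1) :=
    hK.comp (by fun_prop)
  exact ((measurable_oddPow p).comp (h1.sub h2)).mul h3

lemma half_sq_sub_half_sq_le (a b k : ℝ) :
    1 / 2 * max (a - k) 0 ^ 2 - 1 / 2 * max (b - k) 0 ^ 2 ≤ (a - b) * max (a - k) 0 := by
  rcases le_total (a - k) 0 with h | h
  · rw [max_eq_right h]; nlinarith [sq_nonneg (max (b - k) 0)]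
  · rw [max_eq_left h]
    rcases le_total (b - k) 0 with h' | h'
    · rw [max_eq_right h']; nlinarith
    · rw [max_eq_left h']; nlinarith [sq_nonneg (a - b)]

lemma abs_truncation_le {k : ℝ} {θ : RN N → ℝ} {L : ℝ} {B : Set (RN N)} (hθ : IsCutoff L B θ)
    (q : RN N × ℝ) : |truncation u k θ q| ≤ |k| + |u q| := by
  rw [truncation, abs_mul, abs_of_nonneg (hθ.nonneg _), abs_of_nonneg (le_max_right _ _)]
  have h1 : max (u q - k) 0 ≤ |k| + |u q| := by
    apply max_le
    · linarith [le_abs_self (u q), neg_abs_le k]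
    · positivity
  calc _ ≤ (|k| + |u q|) * 1 := mul_le_mul h1 (hθ.le_one _) (hθ.nonneg _) (by positivity)
    _ = _ := mul_one _

lemma continuousOn_lintegral_toReal_sq {U : Set (RN N)} {θ : RN N → ℝ} {L : ℝ} {B : Set (RN N)}
    (hu : ContL2 U T u) (hU : volume U ≠ ⊤) (k : ℝ) (hθ : IsCutoff L B θ) :
    (∀ t ∈ timeDom T, Integrable (fun x => max (u (x, t) - k) 0 ^ 2 * θ x) (volume.restrict U)) ∧
    ContinuousOn (fun t => ∫ x in U, max (u (x, t) - k) 0 ^ 2 * θ x) (timeDom T) := by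
  have hfin : IsFiniteMeasure (volume.restrict U) := ⟨by simpa using hU.lt_top⟩
  obtain ⟨hm, hc⟩ := hu
  set W : ℝ → RN N → ℝ := fun t x => max (u (x, t) - k) 0 * Real.sqrt (θ x) with hW
  have hsq : ∀ t x, max (u (x, t) - k) 0 ^ 2 * θ x = W t x ^ 2 := by
    intro t x
    rw [hW, mul_pow, Real.sq_sqrt (hθ.nonneg x)]
  have hs1 : ∀ x, Real.sqrt (θ x) ≤ 1 := fun x => by
    exact Real.sqrt_le_one.2 (hθ.le_one x)
  have hWae : ∀ t ∈ timeDom T, AEStronglyMeasurable (W t) (volume.restrict U) := by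
    intro t ht
    have h1 := (hm t ht).1.aemeasurable
    have h2 := hθ.continuous.measurable
    have h3 : Measurable fun x => Real.sqrt (θ x) := by fun_prop
    exact (((h1.sub_const k).max aemeasurable_const).mul h3.aemeasurable).aestronglyMeasurable
  have hWdiff : ∀ t t₀ x, ‖W t x - W t₀ x‖ ≤ ‖u (x, t) - u (x, t₀)‖ := by
    intro t t₀ x
    rw [hW, Real.norm_eq_abs, Real.norm_eq_abs, ← sub_mul, abs_mul,
      abs_of_nonneg (Real.sqrt_nonneg _)]
    calc _ ≤ |u (x, t) - u (x, t₀)| * 1 :=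
          mul_le_mul (abs_posPart_sub_le _ _ _) (hs1 x) (Real.sqrt_nonneg _) (abs_nonneg _)
      _ = _ := mul_one _
  have hWm : ∀ t ∈ timeDom T, MemLp (W t) 2 (volume.restrict U) := by
    intro t ht
    have h1 : MemLp (fun x => |k| + |u (x, t)|) 2 (volume.restrict U) :=
      (memLp_const |k|).add (hm t ht).abs
    refine h1.mono' (hWae t ht) (Eventually.of_forall fun x => ?_)
    rw [hW, Real.norm_eq_abs, abs_mul, abs_of_nonneg (Real.sqrt_nonneg _),
      abs_of_nonneg (le_max_right _ _)]
    have h2 : max (u (x, t) - k) 0 ≤ |k| + |u (x, t)| := by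
      apply max_le
      · linarith [le_abs_self (u (x, t)), neg_abs_le k]
      · positivity
    calc _ ≤ (|k| + |u (x, t)|) * 1 := mul_le_mul h2 (hs1 x) (Real.sqrt_nonneg _) (by positivity)
      _ = _ := mul_one _
  have hint : ∀ t ∈ timeDom T, ∫ x in U, max (u (x, t) - k) 0 ^ 2 * θ x
      = (eLpNorm (W t) 2 (volume.restrict U)).toReal ^ 2 := by
    intro t ht
    simp_rw [hsq]
    rw [integral_eq_lintegral_of_nonneg_ae (Eventually.of_forall fun x => sq_nonneg _)
      ((hWae t ht).pow 2), MeasurableVersion.lintegral_sq_eq]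
    norm_num
  refine ⟨fun t ht => ?_, ?_⟩
  · simp_rw [hsq]; exact (hWm t ht).integrable_sq
  · have hcW : ContinuousOn (fun t => (eLpNorm (W t) 2 (volume.restrict U)).toReal)
        (timeDom T) := by
      intro t₀ ht₀
      have h1 := (ENNReal.tendsto_toReal ENNReal.zero_ne_top).comp
        ((hc t₀ ht₀).mono_left nhdsWithin_le_nhds : Tendsto _ (𝓝[timeDom T] t₀) _)
      rw [ENNReal.toReal_zero] at h1
      refine tendsto_iff_norm_sub_tendsto_zero.2 ?_
      refine squeeze_zero' (Eventually.of_forall fun _ => norm_nonneg _) ?_ h1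
      filter_upwards [self_mem_nhdsWithin] with t ht
      have hd : MemLp (fun x => u (x, t) - u (x, t₀)) 2 (volume.restrict U) :=
        (hm t ht).sub (hm t₀ ht₀)
      have key : ∀ t t', t ∈ timeDom T → t' ∈ timeDom T →
          (∀ x, ‖W t x - W t' x‖ ≤ ‖u (x, t) - u (x, t')‖) →
          (eLpNorm (W t) 2 (volume.restrict U)).toReal ≤
          (eLpNorm (W t') 2 (volume.restrict U)).toReal +
            (eLpNorm (fun x => u (x, t) - u (x, t')) 2 (volume.restrict U)).toReal := by
        intro t t' ht ht' hle
        have hd : MemLp (fun x => u (x, t) - u (x, t')) 2 (volume.restrict U) :=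
          (hm t ht).sub (hm t' ht')
        rw [← ENNReal.toReal_add (hWm t' ht').2.ne hd.2.ne]
        refine ENNReal.toReal_mono (ENNReal.add_ne_top.2 ⟨(hWm t' ht').2.ne, hd.2.ne⟩) ?_
        have e : W t = W t' + (W t - W t') := by simp
        rw [e]
        refine (eLpNorm_add_le (hWae t' ht') ((hWae t ht).sub (hWae t' ht')) (by norm_num)).trans ?_
        refine add_le_add le_rfl ?_
        exact eLpNorm_mono hle
      have k1 := key t t₀ ht ht₀ (hWdiff t t₀)
      have k2 := key t₀ t ht₀ ht (hWdiff t₀ t)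
      have e3 : eLpNorm (fun x => u (x, t₀) - u (x, t)) 2 (volume.restrict U)
          = eLpNorm (fun x => u (x, t) - u (x, t₀)) 2 (volume.restrict U) := by
        rw [← eLpNorm_neg]
        congr 1; funext x; simp
      rw [e3] at k2
      rw [Real.norm_eq_abs, abs_le]
      simp only [Function.comp]
      constructor <;> linarith
    exact (hcW.pow 2).congr hint

namespace MeasurableVersion

lemma enorm_flux_mul_le (h : MeasurableVersion p s C₁ C₂ Ω T K u K' u') (w : RN N → ℝ) (τ : ℝ)
    (z : RN N × RN N) : ‖flux p K' u' (τ, z) * (w z.1 - w z.2)‖ₑ ≤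
      ENNReal.ofReal C₂ * crossDensity p s (fun x => u' (x, τ)) w z := by
  have hK0 : 0 ≤ K' (z.1, z.2, τ) :=
    le_trans (by have := h.C₁_pos; positivity) (h.kernel_ge (z.1, z.2, τ))
  have hK := h.kernel_le (z.1, z.2, τ)
  rw [Real.enorm_eq_ofReal_abs, crossDensity, flux, ← ENNReal.ofReal_mul' (by positivity)]
  apply ENNReal.ofReal_le_ofReal
  rw [abs_mul, abs_mul, abs_oddPow h.one_lt_p, abs_of_nonneg hK0]
  calc _ ≤ |u' (z.1, τ) - u' (z.2, τ)| ^ (p - 1) * (C₂ / ‖z.1 - z.2‖ ^ ((N : ℝ) + p * s))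
        * |w z.1 - w z.2| := by gcongr
    _ = _ := by ring

lemma lintegral_truncation_rpow_ne_top (h : MeasurableVersion p s C₁ C₂ Ω T K u K' u') {a b : ℝ}
    (ha : 0 < a) (hb : (b : EReal) < T) {U : Set (RN N)} (hU : CompactlyIn U Ω) (k : ℝ) :
    ∫⁻ τ in Ioo a b, ∫⁻ x in U, ENNReal.ofReal (max (u' (x, τ) - k) 0 ^ p) ≠ ⊤ := by
  refine ne_top_of_le_ne_top (h.lintegral_sq_ne_top (a := a) ha hb hU (1 + |k|)) ?_
  refine lintegral_mono fun τ => lintegral_mono fun x => ?_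
  apply ENNReal.ofReal_le_ofReal
  have h1 : max (u' (x, τ) - k) 0 ≤ 1 + |k| + |u' (x, τ)| := by
    apply max_le
    · linarith [le_abs_self (u' (x, τ)), neg_abs_le k]
    · positivity
  have h2 : 1 ≤ 1 + |k| + |u' (x, τ)| := by linarith [abs_nonneg k, abs_nonneg (u' (x, τ))]
  calc max (u' (x, τ) - k) 0 ^ p ≤ (1 + |k| + |u' (x, τ)|) ^ p :=
        Real.rpow_le_rpow (le_max_right _ _) h1 (by linarith [h.one_lt_p])
    _ ≤ (1 + |k| + |u' (x, τ)|) ^ (2 : ℝ) :=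
        Real.rpow_le_rpow_of_exponent_le h2 h.p_lt_two.le
    _ = _ := Real.rpow_two _

lemma lintegral_gagliardoPow_truncation_ne_top (h : MeasurableVersion p s C₁ C₂ Ω T K u K' u')
    {a b : ℝ} (ha : 0 < a) (hab : a < b) (hb : (b : EReal) < T) {U : Set (RN N)}
    (hU : CompactlyIn U Ω) (k : ℝ) {L : ℝ} (hL : 0 < L) {θ : RN N → ℝ} (hθ : IsCutoff L U θ) :
    ∫⁻ τ in Ioo a b, gagliardoPow s p univ (fun x => truncation u' k θ (x, τ)) ≠ ⊤ := by
  have hle : ∫⁻ τ in Ioo a b, gagliardoPow s p univ (fun x => truncation u' k θ (x, τ)) ≤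
      ∫⁻ τ in Ioo a b, (2 * gagliardoPow s p U (fun x => u' (x, τ))
        + 4 * ENNReal.ofReal (L ^ (p * s) * cutoffMass N p s)
        * ∫⁻ x in U, ENNReal.ofReal (max (u' (x, τ) - k) 0 ^ p)) :=
    lintegral_mono fun τ => gagliardoPow_truncation_le h.one_le_dim h.one_lt_p h.p_lt_two h.s_pos
      h.s_lt_one hL hU.1.measurableSet hθ (measurable_slice h.meas τ) k
  refine ne_top_of_le_ne_top ?_ hle
  rw [lintegral_add_left ((measurable_gagliardoPow p s h.meas U).const_mul _),
    lintegral_const_mul' _ _ (by simp), lintegral_const_mul' _ _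
    (ENNReal.mul_ne_top (by simp) ENNReal.ofReal_ne_top)]
  refine ENNReal.add_ne_top.2 ⟨ENNReal.mul_ne_top (by simp)
    (h.lintegral_gagliardoPow_ne_top ha hab hb hU), ENNReal.mul_ne_top
    (ENNReal.mul_ne_top (by simp) ENNReal.ofReal_ne_top)
    (h.lintegral_truncation_rpow_ne_top ha hb hU k)⟩

/-- Testing at a fixed time with the truncation, by convexity. -/
lemma truncation_step (h : MeasurableVersion p s C₁ C₂ Ω T K u K' u') {a b : ℝ}
    (ha : 0 < a) (hab : a < b) (hb : (b : EReal) < T) {U : Set (RN N)}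
    (hU : CompactlyIn U Ω) (k : ℝ) {L : ℝ} {θ : RN N → ℝ} (hθ : IsCutoff L U θ)
    (hub : ∀ᵐ x : RN N, u (x, b) = u' (x, b))
    (hG : gagliardoPow s p univ (fun x => truncation u' k θ (x, b)) ≠ ⊤) :
    (1 / 2 * ∫ x in U, max (u (x, b) - k) 0 ^ 2 * θ x)
      - (1 / 2 * ∫ x in U, max (u (x, a) - k) 0 ^ 2 * θ x)
      ≤ -∫ τ in Ioo a b, ∫ z : RN N × RN N, flux p K' u' (τ, z) *
        (truncation u' k θ (z.1, b) - truncation u' k θ (z.2, b)) := by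
  set φ : RN N → ℝ := fun x => truncation u' k θ (x, b) with hφ
  have hφm : Measurable φ := measurable_slice (measurable_truncation h.meas k hθ.continuous) b
  have hUfin : volume U ≠ ⊤ :=
    ne_top_of_le_ne_top hU.2.1.measure_lt_top.ne (measure_mono subset_closure)
  have hfin : IsFiniteMeasure (volume.restrict U) := ⟨by simpa using hUfin.lt_top⟩
  have hcont := h.sol.cont U hU
  have hbT : b ∈ timeDom T := mem_timeDom_of_lt ha hb hab.le le_rfl
  have haT : a ∈ timeDom T := mem_timeDom_of_lt ha hb le_rfl hab.le
  have hφ0 : ∀ x, x ∉ U → φ x = 0 := fun x hx => by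
    simp only [hφ, truncation]; rw [hθ.zero x hx, mul_zero]
  have hφ2 : MemLp φ 2 (volume.restrict U) := by
    have h1 : MemLp (fun x => |k| + |u (x, b)|) 2 (volume.restrict U) :=
      (memLp_const |k|).add (hcont.1 b hbT).abs
    refine h1.mono' hφm.aestronglyMeasurable ?_
    filter_upwards [ae_restrict_of_ae hub] with x hx
    rw [hx]
    exact abs_truncation_le hθ (x, b)
  have hφp : ∫⁻ x, ENNReal.ofReal (|φ x| ^ p) ≠ ⊤ := by
    have e1 : ∫⁻ x, ENNReal.ofReal (|φ x| ^ p) = ∫⁻ x in U, ENNReal.ofReal (|φ x| ^ p) := by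
      rw [← lintegral_indicator hU.1.measurableSet]
      refine lintegral_congr fun x => ?_
      by_cases hx : x ∈ U
      · rw [indicator_of_mem hx]
      · rw [indicator_of_notMem hx, hφ0 x hx, abs_zero,
          Real.zero_rpow (by linarith [h.one_lt_p]), ENNReal.ofReal_zero]
    have e2 : ∫⁻ x in U, ENNReal.ofReal (|φ x| ^ p) ≤
        ∫⁻ x in U, (1 + ENNReal.ofReal (φ x ^ 2)) := by
      refine lintegral_mono fun x => ?_
      rw [← ENNReal.ofReal_one, ← ENNReal.ofReal_add zero_le_one (sq_nonneg _)]
      apply ENNReal.ofReal_le_ofReal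
      rcases le_total |φ x| 1 with h1 | h1
      · have := Real.rpow_le_one (abs_nonneg (φ x)) h1 (by linarith [h.one_lt_p] : 0 ≤ p)
        nlinarith [sq_nonneg (φ x)]
      · have := Real.rpow_le_rpow_of_exponent_le h1 h.p_lt_two.le
        rw [Real.rpow_two, sq_abs] at this
        linarith
    rw [e1]
    refine ne_top_of_le_ne_top ?_ e2
    rw [lintegral_add_left measurable_const, lintegral_sq_eq]
    refine ENNReal.add_ne_top.2 ⟨by simpa using hUfin, ?_⟩
    exact (ENNReal.rpow_lt_top_of_nonneg (by norm_num) hφ2.2.ne).ne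
  have hS : sobolevPow s p univ φ ≠ ⊤ := by
    rw [sobolevPow, Measure.restrict_univ]
    exact ENNReal.add_ne_top.2 ⟨hφp, hG⟩
  have hw := h.weak_const ha hab hb hU hφm.aemeasurable hφ0 hS hφ2
  refine le_trans ?_ hw.le
  obtain ⟨hi, -⟩ := continuousOn_lintegral_toReal_sq hcont hUfin k hθ
  rw [← integral_const_mul, ← integral_const_mul,
    ← integral_sub ((hi b hbT).const_mul _) ((hi a haT).const_mul _)]
  refine integral_mono_ae (((hi b hbT).const_mul _).sub ((hi a haT).const_mul _)) ?_ ?_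
  · exact ((hcont.1 b hbT).sub (hcont.1 a haT)).integrable_mul hφ2
  · filter_upwards [ae_restrict_of_ae hub] with x hx
    have h1 := half_sq_sub_half_sq_le (u (x, b)) (u (x, a)) k
    have h2 := mul_le_mul_of_nonneg_right h1 (hθ.nonneg x)
    simp only [hφ, truncation]
    rw [← hx]
    linarith

end MeasurableVersion

/-- The energy density: the flux times the increment of the test function. -/
noncomputable def fluxEnergy (p : ℝ) (K : RN N × RN N × ℝ → ℝ) (u v : RN N × ℝ → ℝ)
    (q : ℝ × (RN N × RN N)) : ℝ :=
  flux p K u q * (v (q.2.1, q.1) - v (q.2.2, q.1))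

lemma measurable_fluxEnergy (p : ℝ) (hK : Measurable K) (hu : Measurable u)
    {v : RN N × ℝ → ℝ} (hv : Measurable v) : Measurable (fluxEnergy p K u v) :=
  (measurable_flux p hK hu).mul ((measurable_fst_slice hv).sub (measurable_snd_slice hv))

lemma ofReal_integral_le_lintegral {α : Type*} [MeasurableSpace α] {μ : Measure α} {f : α → ℝ}
    (hf : Integrable f μ) : ENNReal.ofReal (∫ x, f x ∂μ) ≤ ∫⁻ x, ENNReal.ofReal (f x) ∂μ := by
  have h1 : ∫ x, f x ∂μ ≤ ∫ x, max (f x) 0 ∂μ :=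
    integral_mono hf hf.pos_part fun x => le_max_left _ _
  refine (ENNReal.ofReal_le_ofReal h1).trans ?_
  rw [ofReal_integral_eq_lintegral_ofReal hf.pos_part
    (Eventually.of_forall fun x => le_max_right _ _)]
  refine lintegral_mono fun x => ?_
  rw [ENNReal.ofReal_max]; simp

lemma lintegral_lintegral_shift {Φ : ℝ → ℝ → ℝ≥0∞} (hΦ : Measurable (Function.uncurry Φ))
    {t₁ t₂ δ : ℝ} :
    ∫⁻ t in Ioo t₁ t₂, ∫⁻ τ in Ioo (t - δ) t, Φ τ t =
      ∫⁻ σ in Ioo 0 δ, ∫⁻ τ in Ioo (t₁ - σ) (t₂ - σ), Φ τ (σ + τ) := by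
  set D : Set (ℝ × ℝ) := {q | t₁ < q.2 ∧ q.2 < t₂ ∧ q.2 - δ < q.1 ∧ q.1 < q.2} with hD
  have hDm : MeasurableSet D := by
    have h1 : MeasurableSet {q : ℝ × ℝ | t₁ < q.2} := measurableSet_lt (by fun_prop) (by fun_prop)
    have h2 : MeasurableSet {q : ℝ × ℝ | q.2 < t₂} := measurableSet_lt (by fun_prop) (by fun_prop)
    have h3 : MeasurableSet {q : ℝ × ℝ | q.2 - δ < q.1} :=
      measurableSet_lt (by fun_prop) (by fun_prop)
    have h4 : MeasurableSet {q : ℝ × ℝ | q.1 < q.2} := measurableSet_lt (by fun_prop) (by fun_prop)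
    exact h1.inter (h2.inter (h3.inter h4))
  set F : ℝ × ℝ → ℝ≥0∞ := D.indicator (Function.uncurry Φ) with hF
  have hFm : Measurable F := hΦ.indicator hDm
  have e1 : ∫⁻ t in Ioo t₁ t₂, ∫⁻ τ in Ioo (t - δ) t, Φ τ t = ∫⁻ t, ∫⁻ τ, F (τ, t) := by
    rw [← lintegral_indicator measurableSet_Ioo]
    refine lintegral_congr fun t => ?_
    by_cases ht : t ∈ Ioo t₁ t₂
    · rw [indicator_of_mem ht, ← lintegral_indicator measurableSet_Ioo]
      refine lintegral_congr fun τ => ?_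
      by_cases hτ : τ ∈ Ioo (t - δ) t
      · rw [indicator_of_mem hτ, hF,
          indicator_of_mem (show (τ, t) ∈ D from ⟨ht.1, ht.2, hτ.1, hτ.2⟩)]
        rfl
      · rw [indicator_of_notMem hτ, hF, indicator_of_notMem (fun h : (τ, t) ∈ D => hτ h.2.2)]
    · rw [indicator_of_notMem ht]
      symm
      rw [lintegral_eq_zero_iff' (by fun_prop)]
      refine Eventually.of_forall fun τ => ?_
      simp only [hF]
      rw [indicator_of_notMem (fun h : (τ, t) ∈ D => ht ⟨h.1, h.2.1⟩)]
      rfl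
  have e2 : ∫⁻ σ in Ioo 0 δ, ∫⁻ τ in Ioo (t₁ - σ) (t₂ - σ), Φ τ (σ + τ) =
      ∫⁻ σ, ∫⁻ τ, F (τ, σ + τ) := by
    rw [← lintegral_indicator measurableSet_Ioo]
    refine lintegral_congr fun σ => ?_
    have hm : Measurable fun τ => F (τ, σ + τ) := hFm.comp (by fun_prop)
    by_cases hσ : σ ∈ Ioo 0 δ
    · rw [indicator_of_mem hσ, ← lintegral_indicator measurableSet_Ioo]
      refine lintegral_congr fun τ => ?_
      by_cases hτ : τ ∈ Ioo (t₁ - σ) (t₂ - σ)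
      · have : (τ, σ + τ) ∈ D :=
          ⟨by simp only; linarith [hτ.1], by simp only; linarith [hτ.2],
            by simp only; linarith [hσ.2], by simp only; linarith [hσ.1]⟩
        rw [indicator_of_mem hτ, hF, indicator_of_mem this]
        rfl
      · have : (τ, σ + τ) ∉ D := fun h => hτ
          ⟨by have := h.1; simp only at this; linarith,
            by have := h.2.1; simp only at this; linarith⟩
        rw [indicator_of_notMem hτ, hF, indicator_of_notMem this]
    · rw [indicator_of_notMem hσ]
      symm
      rw [lintegral_eq_zero_iff' hm.aemeasurable]
      refine Eventually.of_forall fun τ => ?_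
      have : (τ, σ + τ) ∉ D := fun h => hσ
          ⟨by have := h.2.2.2; simp only at this; linarith,
            by have := h.2.2.1; simp only at this; linarith⟩
      simp only [hF]
      rw [indicator_of_notMem this]
      rfl
  rw [e1, e2, lintegral_lintegral_swap (f := fun t τ => F (τ, t))
    (hFm.comp measurable_swap).aemeasurable,
    lintegral_lintegral_swap (f := fun σ τ => F (τ, σ + τ))
    (hFm.comp (by fun_prop)).aemeasurable]
  refine lintegral_congr fun τ => ?_
  exact (lintegral_add_right_eq_self (fun t => F (τ, t)) τ).symm

lemma truncation_eq_zero {k : ℝ} {θ : RN N → ℝ} {L : ℝ} {B : Set (RN N)} (hθ : IsCutoff L B θ)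
    {x : RN N} (hx : x ∉ B) (τ : ℝ) : truncation u k θ (x, τ) = 0 := by
  rw [truncation, hθ.zero x hx, mul_zero]

namespace MeasurableVersion

lemma lintegral_truncation_sq_ne_top (h : MeasurableVersion p s C₁ C₂ Ω T K u K' u') {a b : ℝ}
    (ha : 0 < a) (hb : (b : EReal) < T) {U : Set (RN N)} (hU : CompactlyIn U Ω) (k : ℝ)
    {L : ℝ} {B : Set (RN N)} {θ : RN N → ℝ} (hθ : IsCutoff L B θ) :
    ∫⁻ τ in Ioo a b, ∫⁻ x in U, ENNReal.ofReal (truncation u' k θ (x, τ) ^ 2) ≠ ⊤ := by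
  refine ne_top_of_le_ne_top (h.lintegral_sq_ne_top (a := a) ha hb hU |k|) ?_
  refine lintegral_mono fun τ => lintegral_mono fun x => ?_
  apply ENNReal.ofReal_le_ofReal
  rw [← sq_abs]
  exact pow_le_pow_left₀ (abs_nonneg _) (abs_truncation_le hθ _) 2

lemma integrable_fluxEnergy (h : MeasurableVersion p s C₁ C₂ Ω T K u K' u') {a b : ℝ}
    (ha : 0 < a) (hab : a < b) (hb : (b : EReal) < T) {x₀ : RN N} {R₁ R : ℝ} (hR : R₁ < R)
    (hU : CompactlyIn (Metric.ball x₀ R) Ω) (k : ℝ) {L : ℝ} (hL : 0 < L) {θ : RN N → ℝ}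
    (hθ : IsCutoff L (Metric.ball x₀ R₁) θ) :
    Integrable (fluxEnergy p K' u' (truncation u' k θ))
      ((volume.restrict (Ioo a b) : Measure ℝ).prod volume) := by
  have hvm := measurable_truncation h.meas k hθ.continuous
  have hm := measurable_fluxEnergy p h.kernel_meas h.meas hvm
  refine ⟨hm.aestronglyMeasurable, ?_⟩
  rw [HasFiniteIntegral, lintegral_prod _ hm.enorm.aemeasurable]
  have hθ' := hθ.mono (Metric.ball_subset_ball hR.le)
  obtain ⟨Θ, hΘ, hT⟩ := h.exists_tailBound ha hab hb x₀ hR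
  refine lt_of_le_of_lt (b := ENNReal.ofReal C₂ * ∫⁻ τ in Ioo a b, ∫⁻ z, crossDensity p s
    (fun x => u' (x, τ)) (fun x => truncation u' k θ (x, τ)) z) ?_ ?_
  · rw [← lintegral_const_mul' _ _ ENNReal.ofReal_ne_top]
    refine lintegral_mono fun τ => ?_
    rw [← lintegral_const_mul' _ _ ENNReal.ofReal_ne_top]
    refine lintegral_mono fun z => ?_
    exact h.enorm_flux_mul_le (fun x => truncation u' k θ (x, τ)) τ z
  · refine ENNReal.mul_lt_top ENNReal.ofReal_lt_top ?_
    refine lt_of_le_of_lt (lintegral_crossDensity_time_le h.one_le_dim h.one_lt_p h.p_lt_two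
      h.s_pos h.s_lt_one hR hΘ h.meas hvm hT fun x τ hx => truncation_eq_zero hθ hx τ) ?_
    have hp1 := h.one_lt_p
    refine ENNReal.add_lt_top.2 ⟨ENNReal.mul_lt_top ?_ ?_, ENNReal.mul_lt_top (by simp)
      (ENNReal.mul_lt_top ENNReal.ofReal_lt_top (ENNReal.mul_lt_top ?_ ?_))⟩
    · exact ENNReal.rpow_lt_top_of_nonneg (div_nonneg (by linarith) (by linarith))
        (h.lintegral_gagliardoPow_ne_top ha hab hb hU)
    · exact ENNReal.rpow_lt_top_of_nonneg (by positivity)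
        (h.lintegral_gagliardoPow_truncation_ne_top ha hab hb hU k hL hθ')
    · exact ENNReal.rpow_lt_top_of_nonneg (by norm_num) (h.lintegral_sq_ne_top ha hb hU 1)
    · exact ENNReal.rpow_lt_top_of_nonneg (by norm_num)
        (h.lintegral_truncation_sq_ne_top ha hb hU k hθ)

/-- Replacing the test function at the final time by the running test function. -/
lemma ofReal_increment_le (h : MeasurableVersion p s C₁ C₂ Ω T K u K' u') {a b : ℝ}
    (ha : 0 < a) (hab : a < b) (hb : (b : EReal) < T) {x₀ : RN N} {R₁ R : ℝ} (hR : R₁ < R)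
    (hU : CompactlyIn (Metric.ball x₀ R) Ω) (k : ℝ) {L : ℝ} (hL : 0 < L) {θ : RN N → ℝ}
    (hθ : IsCutoff L (Metric.ball x₀ R₁) θ)
    (hub : ∀ᵐ x : RN N, u (x, b) = u' (x, b))
    (hG : gagliardoPow s p univ (fun x => truncation u' k θ (x, b)) ≠ ⊤) :
    ENNReal.ofReal ((1 / 2 * ∫ x in Metric.ball x₀ R, max (u (x, b) - k) 0 ^ 2 * θ x)
      - (1 / 2 * ∫ x in Metric.ball x₀ R, max (u (x, a) - k) 0 ^ 2 * θ x)
      + ∫ q, fluxEnergy p K' u' (truncation u' k θ) q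
        ∂((volume.restrict (Ioo a b) : Measure ℝ).prod volume)) ≤
    ENNReal.ofReal C₂ * ∫⁻ τ in Ioo a b, ∫⁻ z, crossDensity p s (fun x => u' (x, τ))
      (fun x => truncation u' k θ (x, b) - truncation u' k θ (x, τ)) z := by
  set v := truncation u' k θ with hv
  set μ := (volume.restrict (Ioo a b) : Measure ℝ).prod (volume : Measure (RN N × RN N)) with hμ
  set RHS := ∫⁻ τ in Ioo a b, ∫⁻ z, crossDensity p s (fun x => u' (x, τ))
      (fun x => v (x, b) - v (x, τ)) z with hRHS
  rcases eq_or_ne (ENNReal.ofReal C₂ * RHS) ⊤ with htop | htop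
  · rw [htop]; exact le_top
  have hvm : Measurable v := measurable_truncation h.meas k hθ.continuous
  have hstep := h.truncation_step ha hab hb hU k (hθ.mono (Metric.ball_subset_ball hR.le)) hub hG
  have i1 : Integrable (fluxEnergy p K' u' v) μ := h.integrable_fluxEnergy ha hab hb hR hU k hL hθ
  set d : ℝ × (RN N × RN N) → ℝ := fun q => flux p K' u' q *
    ((v (q.2.1, b) - v (q.2.1, q.1)) - (v (q.2.2, b) - v (q.2.2, q.1))) with hd
  have hvb : Measurable fun q : RN N × ℝ => v (q.1, b) := hvm.comp (by fun_prop)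
  have hdm : Measurable d := (measurable_flux p h.kernel_meas h.meas).mul
    (((measurable_fst_slice hvb).sub (measurable_fst_slice hvm)).sub
      ((measurable_snd_slice hvb).sub (measurable_snd_slice hvm)))
  have hdle : ∫⁻ q, ‖d q‖ₑ ∂μ ≤ ENNReal.ofReal C₂ * RHS := by
    rw [hμ, lintegral_prod _ hdm.enorm.aemeasurable, hRHS,
      ← lintegral_const_mul' _ _ ENNReal.ofReal_ne_top]
    refine lintegral_mono fun τ => ?_
    rw [← lintegral_const_mul' _ _ ENNReal.ofReal_ne_top]
    refine lintegral_mono fun z => ?_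
    exact h.enorm_flux_mul_le (fun x => v (x, b) - v (x, τ)) τ z
  have i2 : Integrable d μ :=
    ⟨hdm.aestronglyMeasurable, lt_of_le_of_lt hdle htop.lt_top⟩
  have e3 : ∫ τ in Ioo a b, ∫ z : RN N × RN N, flux p K' u' (τ, z) * (v (z.1, b) - v (z.2, b))
      = ∫ q, (fluxEnergy p K' u' v q + d q) ∂μ := by
    rw [hμ, integral_prod (fun q => fluxEnergy p K' u' v q + d q) (i1.add i2)]
    congr 1; funext τ; congr 1; funext z
    simp only [fluxEnergy, hd]
    ring
  rw [e3, integral_add i1 i2] at hstep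
  refine le_trans ?_ hdle
  refine le_trans (ENNReal.ofReal_le_ofReal (q := ‖∫ q, d q ∂μ‖) ?_) ?_
  · rw [Real.norm_eq_abs]
    linarith [neg_abs_le (∫ q, d q ∂μ)]
  · rw [ofReal_norm]
    exact enorm_integral_le_lintegral_enorm _

end MeasurableVersion

/-- Restriction of a function to a set of times, extended by zero. -/
noncomputable def timeRestrict (J : Set ℝ) (v : RN N × ℝ → ℝ) (q : RN N × ℝ) : ℝ :=
  J.indicator (fun τ => v (q.1, τ)) q.2

lemma timeRestrict_of_mem {J : Set ℝ} {v : RN N × ℝ → ℝ} {τ : ℝ} (hτ : τ ∈ J) (x : RN N) :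
    timeRestrict J v (x, τ) = v (x, τ) := indicator_of_mem hτ _

lemma timeRestrict_of_notMem {J : Set ℝ} {v : RN N × ℝ → ℝ} {τ : ℝ} (hτ : τ ∉ J) (x : RN N) :
    timeRestrict J v (x, τ) = 0 := indicator_of_notMem hτ _

lemma measurable_timeRestrict {J : Set ℝ} (hJ : MeasurableSet J) {v : RN N × ℝ → ℝ}
    (hv : Measurable v) : Measurable (timeRestrict J v) := by
  have e : timeRestrict J v = (Prod.snd ⁻¹' J).indicator v := by
    funext q
    by_cases hq : q.2 ∈ J
    · rw [indicator_of_mem (show q ∈ Prod.snd ⁻¹' J from hq)]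
      exact timeRestrict_of_mem hq q.1
    · rw [indicator_of_notMem (show q ∉ Prod.snd ⁻¹' J from hq)]
      exact timeRestrict_of_notMem hq q.1
  rw [e]
  exact hv.indicator (measurable_snd hJ)

lemma lintegral_gagliardoPow_timeRestrict (hp : 0 < p) {J : Set ℝ} (hJ : MeasurableSet J)
    (v : RN N × ℝ → ℝ) (U : Set (RN N)) :
    ∫⁻ τ, gagliardoPow s p U (fun x => timeRestrict J v (x, τ)) =
      ∫⁻ τ in J, gagliardoPow s p U (fun x => v (x, τ)) := by
  rw [← lintegral_indicator hJ]
  refine lintegral_congr fun τ => ?_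
  by_cases hτ : τ ∈ J
  · rw [indicator_of_mem hτ]
    simp_rw [timeRestrict_of_mem hτ]
  · rw [indicator_of_notMem hτ]
    simp_rw [timeRestrict_of_notMem hτ]
    simp [gagliardoPow, Real.zero_rpow hp.ne']

lemma lintegral_sq_timeRestrict {J : Set ℝ} (hJ : MeasurableSet J)
    (v : RN N × ℝ → ℝ) (U : Set (RN N)) :
    ∫⁻ τ, ∫⁻ x in U, ENNReal.ofReal (timeRestrict J v (x, τ) ^ 2) =
      ∫⁻ τ in J, ∫⁻ x in U, ENNReal.ofReal (v (x, τ) ^ 2) := by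
  rw [← lintegral_indicator hJ]
  refine lintegral_congr fun τ => ?_
  by_cases hτ : τ ∈ J
  · rw [indicator_of_mem hτ]
    simp_rw [timeRestrict_of_mem hτ]
  · rw [indicator_of_notMem hτ]
    simp_rw [timeRestrict_of_notMem hτ]
    simp

lemma measurable_lintegral_crossDensity_increment (p s : ℝ) (hu : Measurable u)
    {v : RN N × ℝ → ℝ} (hv : Measurable v) :
    Measurable (Function.uncurry fun τ t : ℝ => ∫⁻ z, crossDensity p s (fun x => u (x, τ))
      (fun x => v (x, t) - v (x, τ)) z) := by
  have h : Measurable fun q : (ℝ × ℝ) × (RN N × RN N) =>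
      crossDensity p s (fun x => u (x, q.1.1)) (fun x => v (x, q.1.2) - v (x, q.1.1)) q.2 := by
    have m1 : Measurable fun q : (ℝ × ℝ) × (RN N × RN N) => u (q.2.1, q.1.1) :=
      hu.comp (by fun_prop)
    have m2 : Measurable fun q : (ℝ × ℝ) × (RN N × RN N) => u (q.2.2, q.1.1) :=
      hu.comp (by fun_prop)
    have m3 : Measurable fun q : (ℝ × ℝ) × (RN N × RN N) => v (q.2.1, q.1.1) :=
      hv.comp (by fun_prop)
    have m4 : Measurable fun q : (ℝ × ℝ) × (RN N × RN N) => v (q.2.2, q.1.1) :=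
      hv.comp (by fun_prop)
    have m5 : Measurable fun q : (ℝ × ℝ) × (RN N × RN N) => v (q.2.1, q.1.2) :=
      hv.comp (by fun_prop)
    have m6 : Measurable fun q : (ℝ × ℝ) × (RN N × RN N) => v (q.2.2, q.1.2) :=
      hv.comp (by fun_prop)
    unfold crossDensity
    fun_prop
  exact h.lintegral_prod_right'

namespace MeasurableVersion

/-- The energy inequality. -/
lemma energy_le (h : MeasurableVersion p s C₁ C₂ Ω T K u K' u') {a b : ℝ}
    (ha : 0 < a) (hb : (b : EReal) < T) {x₀ : RN N} {R₁ R : ℝ} (hR : R₁ < R)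
    (hU : CompactlyIn (Metric.ball x₀ R) Ω) (k : ℝ) {L : ℝ} (hL : 0 < L) {θ : RN N → ℝ}
    (hθ : IsCutoff L (Metric.ball x₀ R₁) θ) {t₁ t₂ : ℝ} (h1 : a < t₁) (h12 : t₁ < t₂)
    (h2 : t₂ < b) :
    (1 / 2 * ∫ x in Metric.ball x₀ R, max (u (x, t₂) - k) 0 ^ 2 * θ x)
      + ∫ q, fluxEnergy p K' u' (truncation u' k θ) q
        ∂((volume.restrict (Ioo t₁ t₂) : Measure ℝ).prod volume)
      ≤ 1 / 2 * ∫ x in Metric.ball x₀ R, max (u (x, t₁) - k) 0 ^ 2 * θ x := by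
  have hab : a < b := by linarith
  set v := truncation u' k θ with hv
  have hvm : Measurable v := measurable_truncation h.meas k hθ.continuous
  set J := Ioo a b with hJ
  set U := Metric.ball x₀ R with hUdef
  have hθ' := hθ.mono (Metric.ball_subset_ball hR.le)
  have hUfin : volume U ≠ ⊤ := measure_ball_lt_top.ne
  have hp0 : 0 < p := by linarith [h.one_lt_p]
  set g : ℝ → ℝ := fun t => 1 / 2 * ∫ x in U, max (u (x, t) - k) 0 ^ 2 * θ x with hg
  set e : ℝ → ℝ := fun τ => ∫ z, fluxEnergy p K' u' v (τ, z) with he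
  have hI : Integrable (fluxEnergy p K' u' v) ((volume.restrict J : Measure ℝ).prod volume) :=
    h.integrable_fluxEnergy ha hab hb hR hU k hL hθ
  have heI : IntegrableOn e (Ioo a b) := hI.integral_prod_left
  have hsplit : ∀ c d, a ≤ c → c ≤ d → d ≤ b → ∫ q, fluxEnergy p K' u' v q
        ∂((volume.restrict (Ioo c d) : Measure ℝ).prod volume) = ∫ τ in c..d, e τ := by
    intro c d hc hcd hd
    rw [intervalIntegral.integral_of_le hcd, integral_Ioc_eq_integral_Ioo, integral_prod]
    refine hI.mono_measure ?_
    exact Measure.prod_mono (Measure.restrict_mono (Ioo_subset_Ioo hc hd) le_rfl) le_rfl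
  have heII : ∀ c d, a ≤ c → c ≤ b → a ≤ d → d ≤ b → IntervalIntegrable e volume c d := by
    intro c d hc hc' hd hd'
    have : IntegrableOn e (Icc a b) := by
      rw [integrableOn_Icc_iff_integrableOn_Ioo]; exact heI
    exact (this.mono_set (uIcc_subset_Icc ⟨hc, hc'⟩ ⟨hd, hd'⟩)).intervalIntegrable
  set H : ℝ → ℝ := fun t => g t + ∫ τ in a..t, e τ with hH
  have hHc : ContinuousOn H (Icc a b) := by
    refine ContinuousOn.add ?_ ?_
    · refine continuousOn_const.mul ?_
      refine (continuousOn_lintegral_toReal_sq (h.sol.cont U hU) hUfin k hθ).2.mono ?_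
      exact fun t ht => mem_timeDom_of_lt ha hb ht.1 ht.2
    · have := intervalIntegral.continuousOn_primitive_interval (μ := volume) (f := e) (a := a)
        (b := b) (by rw [uIcc_of_le hab.le]; rw [integrableOn_Icc_iff_integrableOn_Ioo]; exact heI)
      rwa [uIcc_of_le hab.le] at this
  have hmono : H t₂ ≤ H t₁ := by
    refine le_of_integral_sub_shift_le hHc h1 h12 h2 fun ε hε => ?_
    obtain ⟨Θ, hΘ, hT⟩ := h.exists_tailBound ha hab hb x₀ hR
    have hlim := tendsto_lintegral_crossDensity_translate h.one_le_dim h.one_lt_p h.p_lt_two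
      h.s_pos h.s_lt_one hR hΘ h.meas (measurable_timeRestrict (J := J) measurableSet_Ioo hvm) hT
      (fun x τ hx => by
        by_cases hτ : τ ∈ J
        · rw [timeRestrict_of_mem hτ]; exact truncation_eq_zero hθ hx τ
        · exact timeRestrict_of_notMem hτ x)
      (h.lintegral_gagliardoPow_ne_top ha hab hb hU)
      (h.lintegral_sq_ne_top ha hb hU 1)
      (by
        rw [lintegral_gagliardoPow_timeRestrict hp0 measurableSet_Ioo]
        exact h.lintegral_gagliardoPow_truncation_ne_top ha hab hb hU k hL hθ')
      (by
        rw [lintegral_sq_timeRestrict measurableSet_Ioo]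
        exact h.lintegral_truncation_sq_ne_top ha hb hU k hθ)
    set ε' := ε / (|C₂| + 1) with hε'
    have hε'0 : 0 < ε' := by positivity
    have hev := hlim.eventually_le_const (u := ENNReal.ofReal ε') (by simpa using hε'0)
    obtain ⟨r, hr, hrball⟩ := Metric.eventually_nhds_iff.1 hev
    have hδev : ∀ᶠ δ in 𝓝[>] (0 : ℝ), δ < min r (t₁ - a) :=
      mem_nhdsWithin_of_mem_nhds (Iio_mem_nhds (lt_min hr (by linarith)))
    filter_upwards [hδev, self_mem_nhdsWithin] with δ hδ hδ0
    have hδ0 : 0 < δ := hδ0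
    have hδr : δ < r := hδ.trans_le (min_le_left _ _)
    have hδa : δ < t₁ - a := hδ.trans_le (min_le_right _ _)
    have hHi : IntegrableOn (fun t => H t - H (t - δ)) (Ioo t₁ t₂) := by
      have c1 : ContinuousOn (fun t => H t - H (t - δ)) (Icc t₁ t₂) := by
        refine (hHc.mono (Icc_subset_Icc h1.le h2.le)).sub (hHc.comp (by fun_prop) ?_)
        intro t ht
        exact ⟨by linarith [ht.1], by linarith [ht.2]⟩
      exact (c1.integrableOn_Icc).mono_set Ioo_subset_Icc_self
    rw [intervalIntegral.integral_of_le h12.le, integral_Ioc_eq_integral_Ioo]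
    rw [← ENNReal.ofReal_le_ofReal_iff (by positivity)]
    refine (ofReal_integral_le_lintegral hHi).trans ?_
    set Φ : ℝ → ℝ → ℝ≥0∞ := fun τ t => ∫⁻ z, crossDensity p s (fun x => u' (x, τ))
      (fun x => timeRestrict J v (x, t) - timeRestrict J v (x, τ)) z with hΦ
    have hΦm : Measurable (Function.uncurry Φ) :=
      measurable_lintegral_crossDensity_increment p s h.meas
        (measurable_timeRestrict (J := J) measurableSet_Ioo hvm)
    have hgood : ∀ᵐ t ∂(volume.restrict (Ioo t₁ t₂)), (∀ᵐ x : RN N, u (x, t) = u' (x, t)) ∧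
        gagliardoPow s p univ (fun x => v (x, t)) < ⊤ := by
      refine ae_restrict_of_ae_restrict_of_subset (Ioo_subset_Ioo h1.le h2.le)
        ((h.ae_eq_of_subset (Ioo_subset_timeDom ha hb)).and ?_)
      exact ae_lt_top (measurable_gagliardoPow p s hvm univ)
        (h.lintegral_gagliardoPow_truncation_ne_top ha hab hb hU k hL hθ')
    calc ∫⁻ t in Ioo t₁ t₂, ENNReal.ofReal (H t - H (t - δ))
        ≤ ∫⁻ t in Ioo t₁ t₂, ENNReal.ofReal C₂ * ∫⁻ τ in Ioo (t - δ) t, Φ τ t := by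
          refine lintegral_mono_ae ?_
          filter_upwards [hgood, ae_restrict_mem measurableSet_Ioo] with t ht htI
          have hat : a < t - δ := by linarith [htI.1]
          have htb : t ≤ b := by linarith [htI.2]
          have htT : (t : EReal) < T := lt_of_le_of_lt (by exact_mod_cast htb) hb
          have hinc := h.ofReal_increment_le (a := t - δ) (b := t) (by linarith) (by linarith)
            htT hR hU k hL hθ ht.1 ht.2.ne
          have e1 : H t - H (t - δ) = (1 / 2 * ∫ x in U, max (u (x, t) - k) 0 ^ 2 * θ x)
              - (1 / 2 * ∫ x in U, max (u (x, t - δ) - k) 0 ^ 2 * θ x)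
              + ∫ q, fluxEnergy p K' u' v q
                ∂((volume.restrict (Ioo (t - δ) t) : Measure ℝ).prod volume) := by
            rw [hsplit (t - δ) t hat.le (by linarith) htb,
              ← intervalIntegral.integral_interval_sub_left
                (heII a t le_rfl hab.le (by linarith) htb)
                (heII a (t - δ) le_rfl hab.le hat.le (by linarith))]
            simp only [hH, hg]
            ring
          rw [e1]
          refine hinc.trans (le_of_eq ?_)
          congr 1
          refine setLIntegral_congr_fun measurableSet_Ioo fun τ hτ => ?_
          have m1 : t ∈ J := ⟨by linarith, by linarith [htI.2]⟩
          have m2 : τ ∈ J := ⟨by linarith [hτ.1], by linarith [hτ.2, htI.2]⟩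
          simp only [hΦ, timeRestrict_of_mem m1, timeRestrict_of_mem m2, hv]
      _ = ENNReal.ofReal C₂ * ∫⁻ t in Ioo t₁ t₂, ∫⁻ τ in Ioo (t - δ) t, Φ τ t :=
          lintegral_const_mul' _ _ ENNReal.ofReal_ne_top
      _ = ENNReal.ofReal C₂ * ∫⁻ σ in Ioo 0 δ, ∫⁻ τ in Ioo (t₁ - σ) (t₂ - σ), Φ τ (σ + τ) := by
          rw [lintegral_lintegral_shift hΦm]
      _ ≤ ENNReal.ofReal C₂ * ∫⁻ _ in Ioo 0 δ, ENNReal.ofReal ε' := by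
          gcongr ENNReal.ofReal C₂ * ?_
          refine setLIntegral_mono' measurableSet_Ioo fun σ hσ => ?_
          refine le_trans (lintegral_mono_set (t := J) ?_) (hrball (y := σ) ?_)
          · exact Ioo_subset_Ioo (by linarith [hσ.2]) (by linarith [hσ.1])
          · rw [Real.dist_eq, sub_zero, abs_of_pos hσ.1]; linarith [hσ.2]
      _ ≤ ENNReal.ofReal (ε * δ) := by
          rw [setLIntegral_const, Real.volume_Ioo, sub_zero, ← ENNReal.ofReal_mul hε'0.le,
            ← ENNReal.ofReal_mul' (by positivity)]
          apply ENNReal.ofReal_le_ofReal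
          have : C₂ * ε' ≤ ε := by
            rw [hε', mul_div_assoc', div_le_iff₀ (by positivity)]
            nlinarith [le_abs_self C₂]
          nlinarith
  rw [hsplit t₁ t₂ h1.le h12.le h2.le, ← intervalIntegral.integral_interval_sub_left
    (heII a t₂ le_rfl hab.le (by linarith) h2.le) (heII a t₁ le_rfl hab.le h1.le (by linarith))]
  simp only [hH, hg] at hmono
  linarith

end MeasurableVersion

/-- The integrand on the right-hand side of the Caccioppoli estimate. -/
noncomputable def caccioppoliError (p s L : ℝ) (B U : Set (RN N)) (k : ℝ) (f : RN N → ℝ)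
    (z : RN N × RN N) : ℝ≥0∞ :=
  9 * (U.indicator (fun x => ENNReal.ofReal (max (f x - k) 0 ^ p)) z.1 * ENNReal.ofReal
      (min 1 (L * ‖z.1 - z.2‖) ^ p / ‖z.1 - z.2‖ ^ ((N : ℝ) + p * s)))
    + 9 * (U.indicator (fun x => ENNReal.ofReal (max (f x - k) 0 ^ p)) z.2 * ENNReal.ofReal
      (min 1 (L * ‖z.1 - z.2‖) ^ p / ‖z.1 - z.2‖ ^ ((N : ℝ) + p * s)))
    + (B ×ˢ Uᶜ).indicator (fun z => ENNReal.ofReal (max (f z.1 - k) 0) * ENNReal.ofReal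
      (|max (f z.2) 0| ^ (p - 1) / ‖z.1 - z.2‖ ^ ((N : ℝ) + p * s))) z
    + (B ×ˢ Uᶜ).indicator (fun z => ENNReal.ofReal (max (f z.1 - k) 0) * ENNReal.ofReal
      (|max (f z.2) 0| ^ (p - 1) / ‖z.1 - z.2‖ ^ ((N : ℝ) + p * s))) z.swap

lemma lintegral_caccioppoliError_le (hN : 1 ≤ N) (hp : 1 < p) (hs₀ : 0 < s)
    (hs₁ : s < 1) {x₀ : RN N} {R₁ R D L : ℝ} (hR : R₁ ≤ R) (hL : 0 < L)
    {f : RN N → ℝ} (hf : Measurable f) (k : ℝ)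
    (hT : TailBound p s x₀ R₁ R D (fun x => max (f x) 0)) :
    ∫⁻ z, caccioppoliError p s L (Metric.ball x₀ R₁) (Metric.ball x₀ R) k f z ≤
      18 * (ENNReal.ofReal (L ^ (p * s) * cutoffMass N p s)
        * ∫⁻ x in Metric.ball x₀ R, ENNReal.ofReal (max (f x - k) 0 ^ p))
      + 2 * (ENNReal.ofReal D * ∫⁻ x in Metric.ball x₀ R, ENNReal.ofReal (max (f x - k) 0)) := by
  set U := Metric.ball x₀ R with hU
  set B := Metric.ball x₀ R₁ with hB
  have hBU : B ⊆ U := Metric.ball_subset_ball hR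
  set g : RN N → ℝ≥0∞ := U.indicator (fun x => ENNReal.ofReal (max (f x - k) 0 ^ p)) with hg
  have hgm : Measurable g := by
    refine Measurable.indicator ?_ measurableSet_ball
    fun_prop
  set κ : RN N × RN N → ℝ≥0∞ := fun z => ENNReal.ofReal
      (min 1 (L * ‖z.1 - z.2‖) ^ p / ‖z.1 - z.2‖ ^ ((N : ℝ) + p * s)) with hκ
  have hκm : Measurable κ := measurable_cutoffKernel p s L
  set E : RN N × RN N → ℝ≥0∞ := fun z => ENNReal.ofReal (max (f z.1 - k) 0) * ENNReal.ofReal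
      (|max (f z.2) 0| ^ (p - 1) / ‖z.1 - z.2‖ ^ ((N : ℝ) + p * s)) with hE
  have hEm : Measurable E := by
    have h1 : Measurable fun z : RN N × RN N => f z.1 := hf.comp measurable_fst
    have h2 : Measurable fun z : RN N × RN N => f z.2 := hf.comp measurable_snd
    fun_prop
  have mBU : MeasurableSet (B ×ˢ Uᶜ) := measurableSet_ball.prod measurableSet_ball.compl
  have hEi : Measurable ((B ×ˢ Uᶜ).indicator E) := hEm.indicator mBU
  have htail : ∫⁻ z, (B ×ˢ Uᶜ).indicator E z ≤
      ENNReal.ofReal D * ∫⁻ x in U, ENNReal.ofReal (max (f x - k) 0) := by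
    rw [lintegral_indicator mBU, Measure.volume_eq_prod, ← Measure.prod_restrict,
      lintegral_prod _ hEm.aemeasurable]
    have m3 : Measurable fun x => ENNReal.ofReal (max (f x - k) 0) := by fun_prop
    rw [← lintegral_const_mul _ m3]
    refine le_trans ?_ (lintegral_mono_set hBU)
    refine setLIntegral_mono' measurableSet_ball fun x hx => ?_
    simp only [hE]
    rw [lintegral_const_mul' _ _ ENNReal.ofReal_ne_top, mul_comm]
    gcongr
    exact hT x hx
  have hswap : ∫⁻ z, (B ×ˢ Uᶜ).indicator E (Prod.swap z) = ∫⁻ z, (B ×ˢ Uᶜ).indicator E z := by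
    rw [Measure.volume_eq_prod, lintegral_prod_swap]
  have m1 : Measurable fun z : RN N × RN N => g z.1 * κ z := (hgm.comp measurable_fst).mul hκm
  have m2 : Measurable fun z : RN N × RN N => g z.2 * κ z := (hgm.comp measurable_snd).mul hκm
  calc ∫⁻ z, caccioppoliError p s L B U k f z
      = ∫⁻ z : RN N × RN N, (9 * (g z.1 * κ z) + 9 * (g z.2 * κ z) + (B ×ˢ Uᶜ).indicator E z
        + (B ×ˢ Uᶜ).indicator E z.swap) := rfl
    _ = 9 * (ENNReal.ofReal (L ^ (p * s) * cutoffMass N p s) * ∫⁻ x, g x)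
        + 9 * (ENNReal.ofReal (L ^ (p * s) * cutoffMass N p s) * ∫⁻ x, g x)
        + (∫⁻ z, (B ×ˢ Uᶜ).indicator E z) + ∫⁻ z, (B ×ˢ Uᶜ).indicator E z := by
      have hEsw : Measurable fun z : RN N × RN N => (B ×ˢ Uᶜ).indicator E z.swap :=
        hEi.comp measurable_swap
      rw [lintegral_add_right _ hEsw, lintegral_add_right _ hEi,
        lintegral_add_right _ (m2.const_mul _), lintegral_const_mul _ m1,
        lintegral_const_mul _ m2, lintegral_fst_mul_cutoffKernel hN hp hs₀ hs₁ hL hgm,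
        lintegral_snd_mul_cutoffKernel hN hp hs₀ hs₁ hL hgm, hswap]
    _ = 18 * (ENNReal.ofReal (L ^ (p * s) * cutoffMass N p s) * ∫⁻ x, g x)
        + 2 * ∫⁻ z, (B ×ˢ Uᶜ).indicator E z := by ring
    _ ≤ _ := by
      rw [hg, lintegral_indicator measurableSet_ball]
      gcongr

lemma measurable_caccioppoliError (L : ℝ) {B U : Set (RN N)} (hB : MeasurableSet B)
    (hU : MeasurableSet U) (k : ℝ) (hu : Measurable u) :
    Measurable fun q : ℝ × (RN N × RN N) =>
      caccioppoliError p s L B U k (fun x => u (x, q.1)) q.2 := by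
  have h1 := measurable_fst_slice hu
  have h2 := measurable_snd_slice hu
  have hx : Measurable fun q : ℝ × (RN N × RN N) => q.2.1 := by fun_prop
  have hy : Measurable fun q : ℝ × (RN N × RN N) => q.2.2 := by fun_prop
  have i1 : Measurable fun q : ℝ × (RN N × RN N) =>
      U.indicator (fun x => ENNReal.ofReal (max (u (x, q.1) - k) 0 ^ p)) q.2.1 := by
    have : (fun q : ℝ × (RN N × RN N) =>
      U.indicator (fun x => ENNReal.ofReal (max (u (x, q.1) - k) 0 ^ p)) q.2.1) =
      ((fun q : ℝ × (RN N × RN N) => q.2.1) ⁻¹' U).indicator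
        (fun q => ENNReal.ofReal (max (u (q.2.1, q.1) - k) 0 ^ p)) := rfl
    rw [this]
    exact Measurable.indicator (by fun_prop) (hx hU)
  have i2 : Measurable fun q : ℝ × (RN N × RN N) =>
      U.indicator (fun x => ENNReal.ofReal (max (u (x, q.1) - k) 0 ^ p)) q.2.2 := by
    have : (fun q : ℝ × (RN N × RN N) =>
      U.indicator (fun x => ENNReal.ofReal (max (u (x, q.1) - k) 0 ^ p)) q.2.2) =
      ((fun q : ℝ × (RN N × RN N) => q.2.2) ⁻¹' U).indicator
        (fun q => ENNReal.ofReal (max (u (q.2.2, q.1) - k) 0 ^ p)) := rfl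
    rw [this]
    exact Measurable.indicator (by fun_prop) (hy hU)
  have i3 : Measurable fun q : ℝ × (RN N × RN N) =>
      (B ×ˢ Uᶜ).indicator (fun z => ENNReal.ofReal (max (u (z.1, q.1) - k) 0) * ENNReal.ofReal
      (|max (u (z.2, q.1)) 0| ^ (p - 1) / ‖z.1 - z.2‖ ^ ((N : ℝ) + p * s))) q.2 := by
    have : (fun q : ℝ × (RN N × RN N) =>
      (B ×ˢ Uᶜ).indicator (fun z => ENNReal.ofReal (max (u (z.1, q.1) - k) 0) * ENNReal.ofReal
      (|max (u (z.2, q.1)) 0| ^ (p - 1) / ‖z.1 - z.2‖ ^ ((N : ℝ) + p * s))) q.2) =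
      ((fun q : ℝ × (RN N × RN N) => q.2) ⁻¹' (B ×ˢ Uᶜ)).indicator
        (fun q => ENNReal.ofReal (max (u (q.2.1, q.1) - k) 0) * ENNReal.ofReal
      (|max (u (q.2.2, q.1)) 0| ^ (p - 1) / ‖q.2.1 - q.2.2‖ ^ ((N : ℝ) + p * s))) := rfl
    rw [this]
    exact Measurable.indicator (by fun_prop) (measurable_snd (hB.prod hU.compl))
  have i4 : Measurable fun q : ℝ × (RN N × RN N) =>
      (B ×ˢ Uᶜ).indicator (fun z => ENNReal.ofReal (max (u (z.1, q.1) - k) 0) * ENNReal.ofReal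
      (|max (u (z.2, q.1)) 0| ^ (p - 1) / ‖z.1 - z.2‖ ^ ((N : ℝ) + p * s))) q.2.swap :=
    i3.comp (measurable_fst.prodMk (measurable_swap.comp measurable_snd))
  unfold caccioppoliError
  fun_prop

/-- The pointwise inequality behind the Caccioppoli estimate. -/
lemma oddPow_mul_cutoff_ge (hp : 1 < p) (hp2 : p < 2) {L k : ℝ} (hk : 0 ≤ k) {B U : Set (RN N)}
    (hBU : B ⊆ U) {ζ : RN N → ℝ} (hζ : IsCutoff L B ζ) (f : RN N → ℝ) (x y : RN N) :
    ∃ P : ℝ, 0 ≤ P ∧ ENNReal.ofReal (P / ‖x - y‖ ^ ((N : ℝ) + p * s)) ≤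
        caccioppoliError p s L B U k f (x, y) ∧
      1 / 4 * |max (f x - k) 0 * ζ x - max (f y - k) 0 * ζ y| ^ p ≤
        oddPow p (f x - f y) * (max (f x - k) 0 * ζ x ^ p - max (f y - k) 0 * ζ y ^ p) + P := by
  have hp0 : 0 < p := by linarith
  set W : RN N → ℝ := fun x => max (f x - k) 0 with hW
  have hW0 : ∀ x, 0 ≤ W x := fun x => le_max_right _ _
  set d := ‖x - y‖ ^ ((N : ℝ) + p * s) with hd
  have hd0 : 0 ≤ d := by positivity
  have hm : |ζ x - ζ y| ^ p ≤ min 1 (L * ‖x - y‖) ^ p :=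
    Real.rpow_le_rpow (abs_nonneg _) (hζ.abs_sub_le x y) hp0.le
  have h9 : ∀ A C : ℝ, 0 ≤ A → ENNReal.ofReal (9 * (A * C)) =
      9 * (ENNReal.ofReal A * ENNReal.ofReal C) := by
    intro A C hA
    rw [← ENNReal.ofReal_mul hA, ENNReal.ofReal_mul (by norm_num : (0:ℝ) ≤ 9)]; simp
  have hm0 : 0 ≤ min 1 (L * ‖x - y‖) ^ p := le_trans (by positivity) hm
  set m := min 1 (L * ‖x - y‖) ^ p with hmdef
  have hWp : ∀ x, 0 ≤ W x ^ p := fun x => Real.rpow_nonneg (hW0 x) _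
  have hζp : ∀ x, 0 ≤ ζ x ^ p := fun x => Real.rpow_nonneg (hζ.nonneg x) _
  have hζp1 : ∀ x, ζ x ^ p ≤ 1 := fun x => Real.rpow_le_one (hζ.nonneg x) (hζ.le_one x) hp0.le
  have hb0 : ∀ y, 0 ≤ |max (f y) 0| ^ (p - 1) := fun y => by positivity
  have htail : ∀ x y : RN N, x ∈ B → y ∉ U → |ζ x - ζ y| ^ p ≤ m →
      1 / 4 * |W x * ζ x - W y * ζ y| ^ p ≤
      oddPow p (f x - f y) * (W x * ζ x ^ p - W y * ζ y ^ p) + (9 * (W x ^ p * m)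
        + W x * |max (f y) 0| ^ (p - 1)) := by
    intro x y hx hy hm
    have hy0 : ζ y = 0 := hζ.zero y fun h => hy (hBU h)
    rw [hy0, sub_zero, abs_of_nonneg (hζ.nonneg x)] at hm
    rw [hy0, Real.zero_rpow hp0.ne', mul_zero, sub_zero, sub_zero,
      abs_of_nonneg (mul_nonneg (hW0 x) (hζ.nonneg x)), Real.mul_rpow (hW0 x) (hζ.nonneg x),
      abs_of_nonneg (le_max_right _ _)]
    have h1 := oddPow_mul_ge_tail (a := f x) (b := f y) hp hk (hζp x)
    have h2 : max (f y) 0 ^ (p - 1) * (W x * ζ x ^ p) ≤ W x * max (f y) 0 ^ (p - 1) := by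
      have h3 : 0 ≤ max (f y) 0 ^ (p - 1) := Real.rpow_nonneg (le_max_right _ _) _
      have h4 : W x * ζ x ^ p ≤ W x * 1 := mul_le_mul_of_nonneg_left (hζp1 x) (hW0 x)
      nlinarith
    have h5 := mul_le_mul_of_nonneg_left hm (hWp x)
    have h6 := mul_nonneg (hWp x) (hζp x)
    simp only [hW] at *
    linarith
  by_cases hx : x ∈ U
  · by_cases hy : y ∈ U
    · refine ⟨9 * (W x ^ p * m) + 9 * (W y ^ p * m), by have := hWp x; have := hWp y; positivity,
        ?_, ?_⟩
      · rw [add_div, mul_div_assoc, mul_div_assoc, mul_div_assoc, mul_div_assoc]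
        refine ENNReal.ofReal_add_le.trans ?_
        rw [h9 _ _ (hWp x), h9 _ _ (hWp y)]
        unfold caccioppoliError
        simp only [indicator_of_mem hx, indicator_of_mem hy]
        rw [add_assoc]
        exact le_self_add
      · have key := oddPow_mul_ge (a := f x) (b := f y) (k := k) hp hp2 (hζ.nonneg x)
          (hζ.nonneg y)
        have h1 : 0 ≤ 9 * (W x ^ p + W y ^ p) := by have := hWp x; have := hWp y; positivity
        have h2 := mul_le_mul_of_nonneg_left hm h1
        simp only [hW] at *
        linarith
    · by_cases hxB : x ∈ B
      · refine ⟨_, ?_, ?_, htail x y hxB hy hm⟩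
        · have := hWp x; have := hW0 x; have := hb0 y; positivity
        · rw [add_div, mul_div_assoc, mul_div_assoc, mul_div_assoc]
          refine ENNReal.ofReal_add_le.trans ?_
          rw [h9 _ _ (hWp x), ENNReal.ofReal_mul (hW0 x)]
          unfold caccioppoliError
          simp only [indicator_of_mem hx, indicator_of_mem (show (x, y) ∈ B ×ˢ Uᶜ from ⟨hxB, hy⟩)]
          refine le_trans ?_ le_self_add
          exact add_le_add le_self_add le_rfl
      · refine ⟨0, le_rfl, by simp, ?_⟩
        rw [hζ.zero x hxB, hζ.zero y fun h => hy (hBU h)]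
        simp [Real.zero_rpow hp0.ne']
  · have hx0 : ζ x = 0 := hζ.zero x fun h => hx (hBU h)
    by_cases hy : y ∈ B
    · have hm' : |ζ y - ζ x| ^ p ≤ m := by rwa [abs_sub_comm]
      have e1 : oddPow p (f x - f y) * (W x * ζ x ^ p - W y * ζ y ^ p) =
          oddPow p (f y - f x) * (W y * ζ y ^ p - W x * ζ x ^ p) := by
        rw [← neg_sub (f y), oddPow_neg]; ring
      change ∃ P : ℝ, 0 ≤ P ∧ _ ∧ 1 / 4 * |W x * ζ x - W y * ζ y| ^ p ≤
        oddPow p (f x - f y) * (W x * ζ x ^ p - W y * ζ y ^ p) + P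
      rw [e1, abs_sub_comm]
      refine ⟨_, ?_, ?_, htail y x hy hx hm'⟩
      · have := hWp y; have := hW0 y; have := hb0 x; positivity
      · rw [add_div, mul_div_assoc, mul_div_assoc, mul_div_assoc]
        refine ENNReal.ofReal_add_le.trans ?_
        rw [h9 _ _ (hWp y), ENNReal.ofReal_mul (hW0 y)]
        unfold caccioppoliError
        simp only [indicator_of_mem (hBU hy), Prod.swap_prod_mk, norm_sub_rev y x,
          indicator_of_mem (show (y, x) ∈ B ×ˢ Uᶜ from ⟨hy, hx⟩)]
        exact add_le_add (le_trans le_add_self le_self_add) le_rfl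
    · refine ⟨0, le_rfl, by simp, ?_⟩
      rw [hx0, hζ.zero y hy]
      simp [Real.zero_rpow hp0.ne']

lemma MeasurableVersion.ofReal_gagliardo_add_le (h : MeasurableVersion p s C₁ C₂ Ω T K u K' u')
    {L k : ℝ} (hk : 0 ≤ k) {B U : Set (RN N)} (hBU : B ⊆ U) {ζ : RN N → ℝ} (hζ : IsCutoff L B ζ)
    (q : ℝ × (RN N × RN N)) :
    ENNReal.ofReal (C₁ / 4) * ENNReal.ofReal
        (|truncation u' k ζ (q.2.1, q.1) - truncation u' k ζ (q.2.2, q.1)| ^ p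
          / ‖q.2.1 - q.2.2‖ ^ ((N : ℝ) + p * s))
      + ENNReal.ofReal (-fluxEnergy p K' u' (truncation u' k fun x => ζ x ^ p) q) ≤
    ENNReal.ofReal (fluxEnergy p K' u' (truncation u' k fun x => ζ x ^ p) q)
      + ENNReal.ofReal C₂ * caccioppoliError p s L B U k (fun x => u' (x, q.1)) q.2 := by
  obtain ⟨τ, x, y⟩ := q
  obtain ⟨P, hP0, hP1, hP2⟩ := oddPow_mul_cutoff_ge (s := s) h.one_lt_p h.p_lt_two hk hBU hζ
    (fun x => u' (x, τ)) x y
  have hge := h.kernel_ge (x, y, τ)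
  have hle := h.kernel_le (x, y, τ)
  have hC₁ := h.C₁_pos
  simp only [fluxEnergy, flux, truncation] at *
  set S := oddPow p (u' (x, τ) - u' (y, τ)) *
    (max (u' (x, τ) - k) 0 * ζ x ^ p - max (u' (y, τ) - k) 0 * ζ y ^ p) with hS
  set A := |max (u' (x, τ) - k) 0 * ζ x - max (u' (y, τ) - k) 0 * ζ y| ^ p with hA
  have hA0 : 0 ≤ A := Real.rpow_nonneg (abs_nonneg _) _
  set d := ‖x - y‖ ^ ((N : ℝ) + p * s) with hd
  have hd0 : 0 ≤ d := by positivity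
  have e : oddPow p (u' (x, τ) - u' (y, τ)) * K' (x, y, τ) *
    (max (u' (x, τ) - k) 0 * ζ x ^ p - max (u' (y, τ) - k) 0 * ζ y ^ p) = S * K' (x, y, τ) := by
    rw [hS]; ring
  rw [e]
  set F := S * K' (x, y, τ) with hF
  have hC₂ : 0 ≤ C₂ / d := le_trans (by positivity) (hge.trans hle)
  have main : C₁ / 4 * (A / d) ≤ F + C₂ * (P / d) := by
    have e1 : C₁ / 4 * (A / d) = 1 / 4 * A * (C₁ / d) := by ring
    have e2 : C₂ * (P / d) = P * (C₂ / d) := by ring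
    rw [e1, e2, hF]
    have hK0 : 0 ≤ K' (x, y, τ) := le_trans (by positivity) hge
    calc 1 / 4 * A * (C₁ / d) ≤ 1 / 4 * A * K' (x, y, τ) := by gcongr
      _ ≤ (S + P) * K' (x, y, τ) := by gcongr
      _ = S * K' (x, y, τ) + P * K' (x, y, τ) := by ring
      _ ≤ _ := by gcongr
  rcases hd0.eq_or_lt with hd00 | hdpos
  · have : K' (x, y, τ) = 0 := by
      rw [← hd00, div_zero] at hge hle
      exact le_antisymm hle hge
    rw [hF, this, ← hd00]
    simp
  have hC₂' : 0 ≤ C₂ := by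
    by_contra hc
    push Not at hc
    exact absurd hC₂ (not_le.2 (div_neg_of_neg_of_pos hc hdpos))
  rw [← ENNReal.ofReal_mul (by positivity)]
  refine le_trans ?_ (add_le_add le_rfl (mul_le_mul_right hP1 _))
  rw [← ENNReal.ofReal_mul hC₂']
  have hCP : 0 ≤ C₂ * (P / d) := by positivity
  have hCA : 0 ≤ C₁ / 4 * (A / d) := by positivity
  rcases le_total 0 F with hF0 | hF0
  · rw [ENNReal.ofReal_of_nonpos (by linarith : -F ≤ 0), add_zero,
      ← ENNReal.ofReal_add hF0 hCP]
    exact ENNReal.ofReal_le_ofReal main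
  · rw [ENNReal.ofReal_of_nonpos hF0, zero_add, ← ENNReal.ofReal_add hCA (by linarith)]
    exact ENNReal.ofReal_le_ofReal (by linarith)

/-- **Caccioppoli inequality** for the truncations of a local weak solution. -/
theorem MeasurableVersion.caccioppoli (h : MeasurableVersion p s C₁ C₂ Ω T K u K' u') {a b : ℝ}
    (ha : 0 < a) (hb : (b : EReal) < T) {x₀ : RN N} {R₁ R : ℝ} (hR : R₁ < R)
    (hU : CompactlyIn (Metric.ball x₀ R) Ω) {k : ℝ} (hk : 0 ≤ k) {L : ℝ} (hL : 0 < L)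
    {ζ : RN N → ℝ} (hζ : IsCutoff L (Metric.ball x₀ R₁) ζ) {D : ℝ}
    (hD : ∀ᵐ τ ∂(volume.restrict (Ioo a b)),
      TailBound p s x₀ R₁ R D (fun x => max (u' (x, τ)) 0))
    {t₁ t₂ : ℝ} (h1 : a < t₁) (h12 : t₁ < t₂) (h2 : t₂ < b) :
    ENNReal.ofReal (1 / 2 * ∫ x in Metric.ball x₀ R, max (u (x, t₂) - k) 0 ^ 2 * ζ x ^ p)
      + ENNReal.ofReal (C₁ / 4)
        * ∫⁻ τ in Ioo t₁ t₂, gagliardoPow s p univ (fun x => truncation u' k ζ (x, τ)) ≤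
    ENNReal.ofReal (1 / 2 * ∫ x in Metric.ball x₀ R, max (u (x, t₁) - k) 0 ^ 2 * ζ x ^ p)
      + ENNReal.ofReal C₂ * ∫⁻ τ in Ioo t₁ t₂,
        (18 * (ENNReal.ofReal (L ^ (p * s) * cutoffMass N p s)
          * ∫⁻ x in Metric.ball x₀ R, ENNReal.ofReal (max (u' (x, τ) - k) 0 ^ p))
        + 2 * (ENNReal.ofReal D
          * ∫⁻ x in Metric.ball x₀ R, ENNReal.ofReal (max (u' (x, τ) - k) 0))) := by
  have hab : a < b := by linarith
  have hp := h.one_lt_p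
  have hζp := hζ.rpow hp h.p_lt_two
  have hL2 : 0 < 2 * L := by linarith
  set U := Metric.ball x₀ R with hUdef
  set B := Metric.ball x₀ R₁ with hBdef
  have hBU : B ⊆ U := Metric.ball_subset_ball hR.le
  have energy := h.energy_le ha hb hR hU k hL2 hζp h1 h12 h2
  set μ := (volume.restrict (Ioo t₁ t₂) : Measure ℝ).prod (volume : Measure (RN N × RN N)) with hμ
  set F := fluxEnergy p K' u' (truncation u' k fun x => ζ x ^ p) with hF
  have hFint : Integrable F μ :=
    h.integrable_fluxEnergy (by linarith) h12 (lt_trans (by exact_mod_cast h2) hb) hR hU k hL2 hζp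
  have hvm := measurable_truncation h.meas k hζ.continuous
  have hFm : Measurable F := measurable_fluxEnergy p h.kernel_meas h.meas
    (measurable_truncation h.meas k hζp.continuous)
  have hGm := measurable_gagliardo_density (p := p) (s := s) hvm
  have hEm := measurable_caccioppoliError (p := p) (s := s) L (B := B) (U := U) measurableSet_ball
    measurableSet_ball k h.meas
  set G : ℝ × (RN N × RN N) → ℝ≥0∞ := fun q => ENNReal.ofReal
        (|truncation u' k ζ (q.2.1, q.1) - truncation u' k ζ (q.2.2, q.1)| ^ p
          / ‖q.2.1 - q.2.2‖ ^ ((N : ℝ) + p * s)) with hG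
  set E : ℝ × (RN N × RN N) → ℝ≥0∞ := fun q =>
    caccioppoliError p s L B U k (fun x => u' (x, q.1)) q.2 with hE
  have hGint : ∫⁻ q, G q ∂μ =
      ∫⁻ τ in Ioo t₁ t₂, gagliardoPow s p univ (fun x => truncation u' k ζ (x, τ)) := by
    rw [hμ, lintegral_prod _ hGm.aemeasurable]
    simp only [gagliardoPow, univ_prod_univ, Measure.restrict_univ]
    rfl
  have hEint : ∫⁻ q, E q ∂μ ≤ ∫⁻ τ in Ioo t₁ t₂,
        (18 * (ENNReal.ofReal (L ^ (p * s) * cutoffMass N p s)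
          * ∫⁻ x in U, ENNReal.ofReal (max (u' (x, τ) - k) 0 ^ p))
        + 2 * (ENNReal.ofReal D * ∫⁻ x in U, ENNReal.ofReal (max (u' (x, τ) - k) 0))) := by
    rw [hμ, lintegral_prod _ hEm.aemeasurable]
    refine lintegral_mono_ae ?_
    have hsub : Ioo t₁ t₂ ⊆ Ioo a b := Ioo_subset_Ioo h1.le h2.le
    filter_upwards [ae_restrict_of_ae_restrict_of_subset hsub hD] with τ hτ
    exact lintegral_caccioppoliError_le h.one_le_dim hp h.s_pos h.s_lt_one hR.le hL
      (measurable_slice h.meas τ) k hτ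
  have hint : ENNReal.ofReal (C₁ / 4) * ∫⁻ q, G q ∂μ + ∫⁻ q, ENNReal.ofReal (-F q) ∂μ ≤
      ∫⁻ q, ENNReal.ofReal (F q) ∂μ + ENNReal.ofReal C₂ * ∫⁻ q, E q ∂μ := by
    have m1 : Measurable fun q => ENNReal.ofReal (-F q) := by fun_prop
    have m2 : Measurable fun q => ENNReal.ofReal C₂ * E q := hEm.const_mul _
    rw [← lintegral_const_mul _ hGm, ← lintegral_const_mul _ hEm, ← lintegral_add_right _ m1,
      ← lintegral_add_right _ m2]
    exact lintegral_mono fun q => h.ofReal_gagliardo_add_le hk hBU hζ q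
  rw [← hGint]
  refine le_trans ?_ (add_le_add le_rfl (mul_le_mul_right hEint _))
  have hFi := integral_eq_lintegral_pos_part_sub_lintegral_neg_part hFint
  have fin : ∀ f : ℝ × (RN N × RN N) → ℝ, Integrable f μ → ∫⁻ q, ENNReal.ofReal (f q) ∂μ ≠ ⊤ :=
    fun f hf => (hf.lintegral_lt_top).ne
  have f1 := fin F hFint
  have f2 := fin (fun q => -F q) hFint.neg
  set P := ∫⁻ q, ENNReal.ofReal (F q) ∂μ with hP
  set Q := ∫⁻ q, ENNReal.ofReal (-F q) ∂μ with hQ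
  set X := 1 / 2 * ∫ x in U, max (u (x, t₁) - k) 0 ^ 2 * ζ x ^ p with hX
  set Y := 1 / 2 * ∫ x in U, max (u (x, t₂) - k) 0 ^ 2 * ζ x ^ p with hY
  have nn : ∀ t, 0 ≤ 1 / 2 * ∫ x in U, max (u (x, t) - k) 0 ^ 2 * ζ x ^ p := fun t =>
    mul_nonneg (by norm_num) (integral_nonneg fun x =>
      mul_nonneg (sq_nonneg _) (Real.rpow_nonneg (hζ.nonneg x) _))
  have hY0 : 0 ≤ Y := nn t₂
  have hX0 : 0 ≤ X := nn t₁
  rw [hFi] at energy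
  have energy' : ENNReal.ofReal Y + P ≤ ENNReal.ofReal X + Q := by
    rw [← ENNReal.ofReal_toReal f1, ← ENNReal.ofReal_toReal f2,
      ← ENNReal.ofReal_add hY0 ENNReal.toReal_nonneg,
      ← ENNReal.ofReal_add hX0 ENNReal.toReal_nonneg]
    exact ENNReal.ofReal_le_ofReal (by linarith)
  have fPQ : P + Q ≠ ⊤ := ENNReal.add_ne_top.2 ⟨f1, f2⟩
  refine (ENNReal.add_le_add_iff_right fPQ).1 ?_
  calc _ = (ENNReal.ofReal Y + P) + (ENNReal.ofReal (C₁ / 4) * ∫⁻ q, G q ∂μ + Q) := by ring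
    _ ≤ (ENNReal.ofReal X + Q) + (P + ENNReal.ofReal C₂ * ∫⁻ q, E q ∂μ) := add_le_add energy' hint
    _ = _ := by ring

/-- The integral of `(u - k)_+ ^ e` over the cylinder `B_R(x₀) × (a,b)`. -/
noncomputable def levelIntegral (u : RN N × ℝ → ℝ) (x₀ : RN N) (R a b k e : ℝ) : ℝ≥0∞ :=
  ∫⁻ τ in Ioo a b, ∫⁻ x in Metric.ball x₀ R, ENNReal.ofReal (max (u (x, τ) - k) 0 ^ e)

/-- `D` bounds the integrals `∫_{|y-x₀| ≥ ρ} u_+^{p-1} / |y-x₀|^{N+ps}` at almost all times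
in `(a,b)`. -/
def CenteredTailBound (p s : ℝ) (x₀ : RN N) (ρ a b D : ℝ) (u : RN N × ℝ → ℝ) : Prop :=
  ∀ᵐ τ ∂(volume.restrict (Ioo a b)), ∫⁻ y in (Metric.ball x₀ ρ)ᶜ,
    ENNReal.ofReal (max (u (y, τ)) 0 ^ (p - 1) / ‖y - x₀‖ ^ ((N : ℝ) + p * s)) ≤ ENNReal.ofReal D

lemma tailBound_of_centered (hp : 1 < p) (hs₀ : 0 < s) {x₀ : RN N} {ρ R₁ R D : ℝ} (hR₁ : 0 ≤ R₁)
    (hR : R₁ < R) (hρ : ρ ≤ R) {f : RN N → ℝ}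
    (h : ∫⁻ y in (Metric.ball x₀ ρ)ᶜ,
      ENNReal.ofReal (max (f y) 0 ^ (p - 1) / ‖y - x₀‖ ^ ((N : ℝ) + p * s)) ≤ ENNReal.ofReal D) :
    TailBound p s x₀ R₁ R ((R / (R - R₁)) ^ ((N : ℝ) + p * s) * D) (fun x => max (f x) 0) := by
  intro x hx
  have hR0 : 0 < R := by linarith
  have hd : 0 < R - R₁ := by linarith
  have hν : 0 < (N : ℝ) + p * s := by positivity
  have hc : 0 ≤ (R / (R - R₁)) ^ ((N : ℝ) + p * s) := by positivity
  rw [ENNReal.ofReal_mul hc]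
  refine le_trans ?_ (mul_le_mul_right h _)
  rw [← lintegral_const_mul' _ _ ENNReal.ofReal_ne_top]
  refine le_trans ?_ (lintegral_mono_set (compl_subset_compl.2 (Metric.ball_subset_ball hρ)))
  refine setLIntegral_mono' measurableSet_ball.compl fun y hy => ?_
  rw [← ENNReal.ofReal_mul hc]
  refine ENNReal.ofReal_le_ofReal ?_
  have hyR : R ≤ ‖y - x₀‖ := by
    rw [← dist_eq_norm]; rwa [mem_compl_iff, Metric.mem_ball, not_lt] at hy
  have hxR : ‖x - x₀‖ < R₁ := by rwa [← dist_eq_norm]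
  have hy0 : 0 < ‖y - x₀‖ := by linarith
  have htri : ‖y - x₀‖ - R₁ ≤ ‖x - y‖ := by
    have := norm_sub_norm_le (y - x₀) (x - x₀)
    rw [sub_sub_sub_cancel_right, norm_sub_rev y x] at this
    linarith
  have key : ‖y - x₀‖ ≤ R / (R - R₁) * ‖x - y‖ := by
    rw [div_mul_eq_mul_div, le_div_iff₀ hd]
    nlinarith
  have hxy : 0 < ‖x - y‖ := by linarith
  have hpow : ‖y - x₀‖ ^ ((N : ℝ) + p * s) ≤
      (R / (R - R₁)) ^ ((N : ℝ) + p * s) * ‖x - y‖ ^ ((N : ℝ) + p * s) := by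
    rw [← Real.mul_rpow (by positivity) (by positivity)]
    exact Real.rpow_le_rpow hy0.le key hν.le
  rw [abs_of_nonneg (le_max_right _ _), ← mul_div_assoc, div_le_div_iff₀ (by positivity)
    (by positivity)]
  have h0 : 0 ≤ max (f y) 0 ^ (p - 1) := Real.rpow_nonneg (le_max_right _ _) _
  nlinarith

lemma lintegral_Ioo_le_of_ae {F : ℝ → ℝ≥0∞} {a b : ℝ} (hab : a < b) {X : ℝ≥0∞}
    (h : ∀ᵐ t ∂(volume.restrict (Ioo a b)), ∫⁻ τ in Ioo a t, F τ ≤ X) :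
    ∫⁻ τ in Ioo a b, F τ ≤ X := by
  have hall : ∀ t, a < t → t < b → ∫⁻ τ in Ioo a t, F τ ≤ X := by
    intro t h1 h2
    have h3 : ∀ᵐ t' ∂(volume.restrict (Ioo t b)), ∫⁻ τ in Ioo a t', F τ ≤ X :=
      ae_restrict_of_ae_restrict_of_subset (Ioo_subset_Ioo_left h1.le) h
    have hne : (ae (volume.restrict (Ioo t b))).NeBot := by
      rw [ae_neBot, Ne, Measure.restrict_eq_zero, Real.volume_Ioo]
      simpa using h2
    obtain ⟨t', h4, h5⟩ := (h3.and (ae_restrict_mem measurableSet_Ioo)).exists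
    exact (lintegral_mono_set (Ioo_subset_Ioo_right h5.1.le)).trans h4
  obtain ⟨c, hcm, hclt, hct⟩ := exists_seq_strictMono_tendsto' hab
  have hun : Ioo a b = ⋃ n, Ioo a (c n) := by
    ext x
    simp only [mem_iUnion, mem_Ioo]
    constructor
    · rintro ⟨h1, h2⟩
      obtain ⟨n, hn⟩ := (hct.eventually (lt_mem_nhds h2)).exists
      exact ⟨n, h1, hn⟩
    · rintro ⟨n, h1, h2⟩
      exact ⟨h1, h2.trans (hclt n).2⟩
  have hdir : Directed (· ⊆ ·) fun n => Ioo a (c n) :=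
    Monotone.directed_le fun m n hmn => Ioo_subset_Ioo_right (hcm.monotone hmn)
  rw [hun, setLIntegral_iUnion_of_directed _ hdir]
  exact iSup_le fun n => hall _ (hclt n).1 (hclt n).2

lemma measurable_levelSlice (hu : Measurable u) (U : Set (RN N)) (k e : ℝ) :
    Measurable fun τ => ∫⁻ x in U, ENNReal.ofReal (max (u (x, τ) - k) 0 ^ e) := by
  have h1 : Measurable fun z : ℝ × RN N => ENNReal.ofReal (max (u (z.2, z.1) - k) 0 ^ e) := by
    have h2 : Measurable fun z : ℝ × RN N => u (z.2, z.1) := hu.comp measurable_swap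
    fun_prop
  exact h1.lintegral_prod_right'

lemma ofReal_setIntegral_le {α : Type*} [MeasurableSpace α] {μ : Measure α} (f : α → ℝ) :
    ENNReal.ofReal (∫ x, f x ∂μ) ≤ ∫⁻ x, ENNReal.ofReal (f x) ∂μ := by
  by_cases h : Integrable f μ
  · exact ofReal_integral_le_lintegral h
  · rw [integral_undef h]; simp

/-- The right-hand side of the Caccioppoli inequality on a cylinder. -/
noncomputable def cylinderExcess (p : ℝ) (u : RN N × ℝ → ℝ) (x₀ : RN N) (R a b k A H D : ℝ) :
    ℝ≥0∞ :=
  ENNReal.ofReal A * levelIntegral u x₀ R a b k 2 + ENNReal.ofReal H * levelIntegral u x₀ R a b k p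
    + ENNReal.ofReal D * levelIntegral u x₀ R a b k 1

/-- Caccioppoli inequality, averaged over the initial time. -/
lemma MeasurableVersion.averaged_caccioppoli (h : MeasurableVersion p s C₁ C₂ Ω T K u K' u')
    (hC : 0 ≤ C₂) {a₀ a₁ b : ℝ}
    (ha : 0 < a₀) (h01 : a₀ < a₁) (hb : (b : EReal) < T) {x₀ : RN N} {R₁ R : ℝ} (hR : R₁ < R)
    (hU : CompactlyIn (Metric.ball x₀ R) Ω) {k : ℝ} (hk : 0 ≤ k) {L : ℝ} (hL : 0 < L)
    {ζ : RN N → ℝ} (hζ : IsCutoff L (Metric.ball x₀ R₁) ζ) {D : ℝ}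
    (hD : ∀ᵐ τ ∂(volume.restrict (Ioo a₀ b)),
      TailBound p s x₀ R₁ R D (fun x => max (u' (x, τ)) 0)) :
    ∀ᵐ t ∂(volume.restrict (Ioo a₁ b)),
      ENNReal.ofReal (1 / 2 * ∫ x in Metric.ball x₀ R, max (u (x, t) - k) 0 ^ 2 * ζ x ^ p)
        + ENNReal.ofReal (C₁ / 4)
          * ∫⁻ τ in Ioo a₁ t, gagliardoPow s p univ (fun x => truncation u' k ζ (x, τ)) ≤
      ENNReal.ofReal (1 + C₂ * (18 * cutoffMass N p s + 2))
        * cylinderExcess p u' x₀ R a₀ b k (1 / (a₁ - a₀)) (L ^ (p * s)) D := by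
  refine (ae_restrict_mem measurableSet_Ioo).mono fun t ht => ?_
  set U := Metric.ball x₀ R
  set M := cutoffMass N p s with hM
  have hM0 : 0 ≤ M := cutoffMass_nonneg N p s
  set Φ := ENNReal.ofReal (1 / 2 * ∫ x in U, max (u (x, t) - k) 0 ^ 2 * ζ x ^ p)
        + ENNReal.ofReal (C₁ / 4)
          * ∫⁻ τ in Ioo a₁ t, gagliardoPow s p univ (fun x => truncation u' k ζ (x, τ)) with hΦ
  set w : ℝ → ℝ≥0∞ := fun τ => ∫⁻ x in U, ENNReal.ofReal (max (u' (x, τ) - k) 0 ^ (2 : ℝ)) with hw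
  set Y := ENNReal.ofReal C₂ * (18 * (ENNReal.ofReal (L ^ (p * s) * M) *
    levelIntegral u' x₀ R a₀ b k p) + 2 * (ENNReal.ofReal D * levelIntegral u' x₀ R a₀ b k 1))
    with hY
  have hsub : Ioo a₀ a₁ ⊆ timeDom T := fun τ hτ =>
    mem_timeDom_of_lt ha hb hτ.1.le (hτ.2.le.trans (ht.1.le.trans ht.2.le))
  have step : ∀ᵐ t₁ ∂(volume.restrict (Ioo a₀ a₁)), Φ ≤ w t₁ + Y := by
    filter_upwards [ae_restrict_mem measurableSet_Ioo, h.ae_eq_of_subset hsub] with t₁ ht₁ heq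
    have hc := h.caccioppoli ha hb hR hU hk hL hζ hD ht₁.1 (ht₁.2.trans ht.1) ht.2
    calc Φ ≤ _ := by
          rw [hΦ]
          exact add_le_add le_rfl (mul_le_mul_right
            (lintegral_mono_set (Ioo_subset_Ioo_left ht₁.2.le)) _)
      _ ≤ _ := hc
      _ ≤ _ := by
        refine add_le_add ?_ ?_
        · have h0 : ∀ x, 0 ≤ max (u (x, t₁) - k) 0 ^ 2 * ζ x ^ p := fun x =>
            mul_nonneg (sq_nonneg _) (Real.rpow_nonneg (hζ.nonneg x) _)
          have h1 : 0 ≤ ∫ x in U, max (u (x, t₁) - k) 0 ^ 2 * ζ x ^ p := integral_nonneg h0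
          refine (ENNReal.ofReal_le_ofReal (by linarith : _ ≤
            ∫ x in U, max (u (x, t₁) - k) 0 ^ 2 * ζ x ^ p)).trans ?_
          refine (ofReal_setIntegral_le _).trans ?_
          refine lintegral_mono_ae ?_
          filter_upwards [ae_restrict_of_ae heq] with x hx
          rw [hx, Real.rpow_two]
          refine ENNReal.ofReal_le_ofReal ?_
          have h2 := Real.rpow_le_one (hζ.nonneg x) (hζ.le_one x) (by linarith [h.one_lt_p] : 0 ≤ p)
          nlinarith [sq_nonneg (max (u' (x, t₁) - k) 0)]
        · have m1 := measurable_levelSlice h.meas U k p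
          have m2 := measurable_levelSlice h.meas U k 1
          simp only [Real.rpow_one] at m2
          rw [hY]
          refine mul_le_mul_right ?_ _
          rw [lintegral_add_right _ ((m2.const_mul _).const_mul _),
            lintegral_const_mul _ (m1.const_mul _), lintegral_const_mul _ m1,
            lintegral_const_mul _ (m2.const_mul _), lintegral_const_mul _ m2]
          unfold levelIntegral
          simp only [Real.rpow_one]
          have hs2 : Ioo t₁ t ⊆ Ioo a₀ b := Ioo_subset_Ioo ht₁.1.le ht.2.le
          gcongr
  have hint : Φ * ENNReal.ofReal (a₁ - a₀) ≤
      (∫⁻ τ in Ioo a₀ a₁, w τ) + Y * ENNReal.ofReal (a₁ - a₀) := by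
    have := lintegral_mono_ae step
    rwa [setLIntegral_const, lintegral_add_right w measurable_const, setLIntegral_const,
      Real.volume_Ioo] at this
  have hw2 : ∫⁻ τ in Ioo a₀ a₁, w τ ≤ levelIntegral u' x₀ R a₀ b k 2 :=
    lintegral_mono_set (Ioo_subset_Ioo_right (ht.1.le.trans ht.2.le))
  have hd : 0 < a₁ - a₀ := by linarith
  have hinv : ENNReal.ofReal (1 / (a₁ - a₀)) * ENNReal.ofReal (a₁ - a₀) = 1 := by
    rw [← ENNReal.ofReal_mul (by positivity), one_div_mul_cancel hd.ne', ENNReal.ofReal_one]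
  have hΦle : Φ ≤ ENNReal.ofReal (1 / (a₁ - a₀)) * levelIntegral u' x₀ R a₀ b k 2 + Y := by
    calc Φ = (ENNReal.ofReal (1 / (a₁ - a₀)) * ENNReal.ofReal (a₁ - a₀)) * Φ := by
          rw [hinv, one_mul]
      _ = ENNReal.ofReal (1 / (a₁ - a₀)) * (Φ * ENNReal.ofReal (a₁ - a₀)) := by ring
      _ ≤ ENNReal.ofReal (1 / (a₁ - a₀)) *
          (levelIntegral u' x₀ R a₀ b k 2 + Y * ENNReal.ofReal (a₁ - a₀)) :=
        mul_le_mul_right (hint.trans (add_le_add hw2 le_rfl)) _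
      _ = ENNReal.ofReal (1 / (a₁ - a₀)) * levelIntegral u' x₀ R a₀ b k 2
          + (ENNReal.ofReal (1 / (a₁ - a₀)) * ENNReal.ofReal (a₁ - a₀)) * Y := by ring
      _ = _ := by rw [hinv, one_mul]
  refine hΦle.trans ?_
  set c := ENNReal.ofReal (1 + C₂ * (18 * M + 2)) with hc
  have c1 : 1 ≤ c := by
    rw [hc, ENNReal.one_le_ofReal]
    have : 0 ≤ C₂ * (18 * M + 2) := by positivity
    linarith
  have c2 : ENNReal.ofReal C₂ * (18 * ENNReal.ofReal M) ≤ c := by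
    have : (18 : ℝ≥0∞) = ENNReal.ofReal 18 := by simp
    rw [this, ← ENNReal.ofReal_mul (by norm_num), ← ENNReal.ofReal_mul hC]
    refine ENNReal.ofReal_le_ofReal ?_
    nlinarith
  have c3 : ENNReal.ofReal C₂ * 2 ≤ c := by
    have : ∀ t : ℝ, 0 ≤ t → ENNReal.ofReal t * 2 = ENNReal.ofReal (t * 2) := by
      intro t ht
      rw [ENNReal.ofReal_mul ht]; simp
    rw [this _ hC]
    refine ENNReal.ofReal_le_ofReal ?_
    have : 0 ≤ C₂ * M := by positivity
    nlinarith
  rw [hY, cylinderExcess, ENNReal.ofReal_mul (by positivity : 0 ≤ L ^ (p * s)), mul_add, mul_add,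
    mul_add, add_assoc]
  refine add_le_add (le_mul_of_one_le_left' c1) (add_le_add ?_ ?_)
  · calc _ = ENNReal.ofReal C₂ * (18 * ENNReal.ofReal M) *
          (ENNReal.ofReal (L ^ (p * s)) * levelIntegral u' x₀ R a₀ b k p) := by ring
      _ ≤ _ := mul_le_mul_left c2 _
  · calc _ = ENNReal.ofReal C₂ * 2 * (ENNReal.ofReal D * levelIntegral u' x₀ R a₀ b k 1) := by ring
      _ ≤ _ := mul_le_mul_left c3 _

/-- One step of the De Giorgi iteration: higher integrability on a smaller cylinder. -/
theorem exists_levelIntegral_le (hN : 1 ≤ N) (hp : 1 < p) (hs₀ : 0 < s) (hC₁ : 0 < C₁)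
    (hC₂ : C₁ ≤ C₂) : ∃ C : ℝ, 0 < C ∧
    ∀ {Ω : Set (RN N)} {T : EReal} {K K' : RN N × RN N × ℝ → ℝ} {u u' : RN N × ℝ → ℝ},
      MeasurableVersion p s C₁ C₂ Ω T K u K' u' →
      ∀ {a₀ a₁ b ρ R₂ R D k : ℝ} {x₀ : RN N}, 0 < a₀ → a₀ < a₁ → a₁ < b → (b : EReal) < T →
        0 < R₂ → R₂ < R → ρ ≤ R → CompactlyIn (Metric.ball x₀ R) Ω → 0 ≤ k →
        CenteredTailBound p s x₀ ρ a₀ b D u' →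
        levelIntegral u' x₀ R₂ a₁ b k (p + 2 * (p * s / N)) ≤ ENNReal.ofReal C *
          cylinderExcess p u' x₀ R a₀ b k (1 / (a₁ - a₀)) ((2 / (R - R₂)) ^ (p * s))
            ((2 * R / (R - R₂)) ^ ((N : ℝ) + p * s) * D) ^ (1 + p * s / N) := by
  obtain ⟨G, hG0, hG⟩ := gagliardo_nirenberg hN hp hs₀
  have hM0 := cutoffMass_nonneg N p s
  have hC0 : 0 < C₂ := by linarith
  set c := 1 + C₂ * (18 * cutoffMass N p s + 2) with hc
  have hcpos : 0 < c := by positivity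
  have hN0 : (0 : ℝ) < N := by exact_mod_cast hN
  refine ⟨G * (2 * c) ^ (p * s / N) * (4 / C₁ * c), by positivity, ?_⟩
  intro Ω T K K' u u' h a₀ a₁ b ρ R₂ R D k x₀ ha h01 h1b hb hR₂ hR hρ hU hk hD
  set α := p * s / N with hα
  have hα0 : 0 < α := by positivity
  set R₁ := (R + R₂) / 2 with hR₁
  have hR1 : R₁ < R := by linarith
  have hR12 : R₂ < R₁ := by linarith
  obtain ⟨ζ, hζ, hζ1⟩ := exists_isCutoff x₀ hR12
  have eL : 1 / (R₁ - R₂) = 2 / (R - R₂) := by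
    rw [hR₁, div_eq_div_iff (by linarith) (by linarith)]; ring
  have eR : R / (R - R₁) = 2 * R / (R - R₂) := by
    rw [hR₁, div_eq_div_iff (by linarith) (by linarith)]; ring
  rw [eL] at hζ
  have hL : 0 < 2 / (R - R₂) := div_pos (by norm_num) (by linarith)
  have hT : ∀ᵐ τ ∂(volume.restrict (Ioo a₀ b)), TailBound p s x₀ R₁ R
      ((2 * R / (R - R₂)) ^ ((N : ℝ) + p * s) * D) (fun x => max (u' (x, τ)) 0) := by
    filter_upwards [hD] with τ hτ
    rw [← eR]
    exact tailBound_of_centered hp hs₀ (by linarith) hR1 hρ hτ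
  have hav := h.averaged_caccioppoli hC0.le ha h01 hb hR1 hU hk hL hζ hT
  set X := cylinderExcess p u' x₀ R a₀ b k (1 / (a₁ - a₀)) ((2 / (R - R₂)) ^ (p * s))
            ((2 * R / (R - R₂)) ^ ((N : ℝ) + p * s) * D) with hX
  rcases eq_or_ne X ⊤ with hXt | hXt
  · rw [hXt, ENNReal.top_rpow_of_pos (by positivity), ENNReal.mul_top]
    · exact le_top
    · rw [Ne, ENNReal.ofReal_eq_zero, not_le]; positivity
  set U := Metric.ball x₀ R with hUdef
  set v := truncation u' k ζ with hv
  have hvm : Measurable v := measurable_truncation h.meas k hζ.continuous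
  have hsub : Ioo a₁ b ⊆ timeDom T := fun τ hτ =>
    mem_timeDom_of_lt ha hb (h01.le.trans hτ.1.le) hτ.2.le
  have hUfin : volume U ≠ ⊤ := measure_ball_lt_top.ne
  obtain ⟨hi, -⟩ := continuousOn_lintegral_toReal_sq (h.sol.cont U hU) hUfin k
    (hζ.rpow hp h.p_lt_two)
  have hS : ∀ᵐ t ∂(volume.restrict (Ioo a₁ b)),
      ∫⁻ x, ENNReal.ofReal (v (x, t) ^ 2) ≤ ENNReal.ofReal (2 * c) * X := by
    filter_upwards [hav, h.ae_eq_of_subset hsub, ae_restrict_mem measurableSet_Ioo] with t h1 h2 h3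
    have h4 := le_trans le_self_add h1
    have e2 : ∀ t : ℝ, ENNReal.ofReal t = 2 * ENNReal.ofReal (1 / 2 * t) := by
      intro t
      have : ∀ r, 2 * ENNReal.ofReal r = ENNReal.ofReal (2 * r) := fun r => by
        rw [ENNReal.ofReal_mul (by norm_num)]; simp
      rw [this]; congr 1; ring
    have h5 : ∫⁻ x, ENNReal.ofReal (v (x, t) ^ 2) ≤
        ∫⁻ x in U, ENNReal.ofReal (max (u (x, t) - k) 0 ^ 2 * ζ x ^ p) := by
      rw [← lintegral_indicator measurableSet_ball]
      refine lintegral_mono_ae ?_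
      filter_upwards [h2] with x hx
      by_cases hxU : x ∈ U
      · rw [indicator_of_mem hxU, hx]
        refine ENNReal.ofReal_le_ofReal ?_
        rw [hv, truncation, mul_pow]
        refine mul_le_mul_of_nonneg_left ?_ (sq_nonneg _)
        rw [← Real.rpow_two]
        simp only
        rcases (hζ.nonneg x).eq_or_lt with h0 | h0
        · rw [← h0, Real.zero_rpow (by norm_num), Real.zero_rpow (by linarith)]
        · exact Real.rpow_le_rpow_of_exponent_ge h0 (hζ.le_one x) h.p_lt_two.le
      · have : ζ x = 0 := hζ.zero x fun h => hxU (Metric.ball_subset_ball hR1.le h)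
        rw [hv, truncation]
        simp [this]
    refine h5.trans ?_
    rw [← ofReal_integral_eq_lintegral_ofReal (hi t (hsub h3)) (Eventually.of_forall fun x =>
      mul_nonneg (sq_nonneg _) (Real.rpow_nonneg (hζ.nonneg x) _)), e2,
      ENNReal.ofReal_mul (p := 2) (by norm_num), mul_assoc]
    refine le_trans (mul_le_mul_right h4 _) (by rw [ENNReal.ofReal_ofNat])
  have hGag : ∫⁻ τ in Ioo a₁ b, gagliardoPow s p univ (fun x => v (x, τ)) ≤
      ENNReal.ofReal (4 / C₁ * c) * X := by
    refine lintegral_Ioo_le_of_ae h1b ?_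
    filter_upwards [hav] with t h1
    have h4 := le_trans le_add_self h1
    have h5 := mul_le_mul_right h4 (ENNReal.ofReal (4 / C₁))
    rw [← mul_assoc, ← mul_assoc, ← ENNReal.ofReal_mul (by positivity),
      ← ENNReal.ofReal_mul (by positivity), show 4 / C₁ * (C₁ / 4) = 1 by field_simp,
      ENNReal.ofReal_one, one_mul] at h5
    exact h5
  calc levelIntegral u' x₀ R₂ a₁ b k (p + 2 * α)
      ≤ ∫⁻ τ in Ioo a₁ b, ∫⁻ x, ENNReal.ofReal (|v (x, τ)| ^ (p + 2 * α)) := by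
        refine lintegral_mono fun τ => ?_
        refine le_trans ?_ (setLIntegral_le_lintegral (Metric.ball x₀ R₂) _)
        refine setLIntegral_mono' measurableSet_ball fun x hx => ?_
        rw [hv, truncation, hζ1 x hx, mul_one, abs_of_nonneg (le_max_right _ _)]
    _ ≤ ∫⁻ τ in Ioo a₁ b, ENNReal.ofReal G * (ENNReal.ofReal (2 * c) * X) ^ α
          * gagliardoPow s p univ (fun x => v (x, τ)) := by
        refine lintegral_mono_ae ?_
        filter_upwards [hS] with τ hτ
        have hne : ∫⁻ x, ENNReal.ofReal (v (x, τ) ^ 2) ≠ ⊤ :=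
          ne_top_of_le_ne_top (ENNReal.mul_ne_top ENNReal.ofReal_ne_top hXt) hτ
        refine (hG _ (measurable_slice hvm τ) hne).trans ?_
        gcongr
    _ ≤ ENNReal.ofReal G * (ENNReal.ofReal (2 * c) * X) ^ α *
          (ENNReal.ofReal (4 / C₁ * c) * X) := by
        rw [lintegral_const_mul _ (measurable_gagliardoPow p s hvm univ)]
        gcongr
    _ = _ := by
        rw [ENNReal.mul_rpow_of_nonneg _ _ hα0.le, ENNReal.ofReal_rpow_of_pos (by positivity),
          ENNReal.rpow_add_of_nonneg _ _ zero_le_one hα0.le, ENNReal.rpow_one,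
          ENNReal.ofReal_mul (p := G * (2 * c) ^ α) (by positivity),
          ENNReal.ofReal_mul (p := G) hG0.le]
        ring

lemma rpow_max_sub_add_le {e e' η k : ℝ} (he : 0 < e) (hee : e ≤ e') (hη : 0 < η) (w : ℝ) :
    max (w - (k + η)) 0 ^ e ≤ η ^ (e - e') * max (w - k) 0 ^ e' := by
  rcases le_total (w - (k + η)) 0 with h | h
  · rw [max_eq_right h, Real.zero_rpow he.ne']
    exact mul_nonneg (by positivity) (Real.rpow_nonneg (le_max_right _ _) _)
  · have hk : η ≤ w - k := by linarith
    have hk0 : 0 < w - k := by linarith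
    rw [max_eq_left h, max_eq_left hk0.le]
    have h1 : (w - k) ^ (e - e') ≤ η ^ (e - e') :=
      Real.rpow_le_rpow_of_nonpos hη hk (by linarith)
    calc (w - (k + η)) ^ e ≤ (w - k) ^ e := Real.rpow_le_rpow h (by linarith) he.le
      _ = (w - k) ^ (e - e') * (w - k) ^ e' := by
        rw [← Real.rpow_add hk0]; congr 1; ring
      _ ≤ _ := mul_le_mul_of_nonneg_right h1 (by positivity)

lemma rpow_max_sub_le_of_le {e e' k k' M w : ℝ} (he' : 0 < e') (hee : e' ≤ e) (hk' : 0 ≤ k')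
    (hk : k' ≤ k) (hw : w ≤ M) (hM : 0 ≤ M) :
    max (w - k) 0 ^ e ≤ M ^ (e - e') * max (w - k') 0 ^ e' := by
  rcases le_total (w - k) 0 with h | h
  · rw [max_eq_right h, Real.zero_rpow (by linarith)]
    exact mul_nonneg (by positivity) (Real.rpow_nonneg (le_max_right _ _) _)
  · have hk0 : 0 ≤ w - k' := by linarith
    rw [max_eq_left h, max_eq_left hk0]
    calc (w - k) ^ e = (w - k) ^ (e - e') * (w - k) ^ e' := by
          rw [← Real.rpow_add_of_nonneg h (by linarith) he'.le]; congr 1; ring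
      _ ≤ _ := mul_le_mul (Real.rpow_le_rpow h (by linarith) (by linarith))
        (Real.rpow_le_rpow h (by linarith) he'.le) (by positivity) (by positivity)

lemma levelIntegral_le_mul {x₀ : RN N} {R R' a a' b k k' e e' c : ℝ} (hR : R ≤ R') (ha : a' ≤ a)
    (hc : 0 ≤ c) (h : ∀ᵐ τ ∂(volume.restrict (Ioo a b)), ∀ᵐ x ∂(volume.restrict (Metric.ball x₀ R)),
      max (u (x, τ) - k) 0 ^ e ≤ c * max (u (x, τ) - k') 0 ^ e') :
    levelIntegral u x₀ R a b k e ≤ ENNReal.ofReal c * levelIntegral u x₀ R' a' b k' e' := by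
  unfold levelIntegral
  rw [← lintegral_const_mul' _ _ ENNReal.ofReal_ne_top]
  refine le_trans ?_ (lintegral_mono_set (Ioo_subset_Ioo_left ha))
  refine lintegral_mono_ae ?_
  filter_upwards [h] with τ hτ
  rw [← lintegral_const_mul' _ _ ENNReal.ofReal_ne_top]
  refine le_trans ?_ (lintegral_mono_set (Metric.ball_subset_ball hR))
  refine lintegral_mono_ae ?_
  filter_upwards [hτ] with x hx
  rw [← ENNReal.ofReal_mul hc]
  exact ENNReal.ofReal_le_ofReal hx

lemma levelIntegral_le_of_forall {x₀ : RN N} {R R' a a' b k k' e e' c : ℝ} (hR : R ≤ R')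
    (ha : a' ≤ a) (hc : 0 ≤ c) (h : ∀ w : ℝ, max (w - k) 0 ^ e ≤ c * max (w - k') 0 ^ e') :
    levelIntegral u x₀ R a b k e ≤ ENNReal.ofReal c * levelIntegral u x₀ R' a' b k' e' :=
  levelIntegral_le_mul hR ha hc (Eventually.of_forall fun _ => Eventually.of_forall fun _ => h _)

lemma levelIntegral_mono {x₀ : RN N} {R R' a a' b k k' e : ℝ} (hR : R ≤ R')
    (ha : a' ≤ a) (hk : k' ≤ k) (he : 0 ≤ e) :
    levelIntegral u x₀ R a b k e ≤ levelIntegral u x₀ R' a' b k' e := by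
  have := levelIntegral_le_of_forall (u := u) (x₀ := x₀) (b := b) (k := k) (k' := k') (e := e)
    (e' := e) hR ha zero_le_one fun w => by
      rw [one_mul]
      exact Real.rpow_le_rpow (le_max_right _ _) (max_le_max (by linarith) le_rfl) he
  simpa using this

/-- The coefficient arising in one step of the iteration, under the smallness conditions on `t`. -/
lemma step_coefficient_le (hp : 1 < p) (hp2 : p < 2) (hs₀ : 0 < s)
    {ρ t k D G η A H E : ℝ} (hρ : 0 < ρ) (ht : 0 < t) (hk : 0 < k) (hD : 0 ≤ D) (hG : 1 ≤ G)
    (hη : k / (8 * G) ≤ η) (h1 : t / ρ ^ (p * s) * k ^ (p - 2) ≤ 1) (h2 : t * D ≤ k)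
    (hA : A ≤ 2 * G / t) (hH0 : 0 ≤ H) (hH : H ≤ 4 * G / ρ) (hE0 : 0 ≤ E) (hE : E ≤ 4 * G) :
    A + H ^ (p * s) * η ^ (p - 2) + E ^ ((N : ℝ) + p * s) * D * η ^ (1 - 2 : ℝ) ≤
      (2 + 8 * 4 ^ (p * s) + 8 * 4 ^ ((N : ℝ) + p * s)) * G ^ ((N : ℝ) + p * s + 1) / t := by
  have hps : 0 < p * s := by positivity
  have hν : 0 < (N : ℝ) + p * s := by positivity
  have hG0 : 0 < G := by linarith
  have h8 : 0 < k / (8 * G) := by positivity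
  have hη0 : 0 < η := by linarith
  have hGν : ∀ e : ℝ, e ≤ (N : ℝ) + p * s + 1 → G ^ e ≤ G ^ ((N : ℝ) + p * s + 1) :=
    fun e he => Real.rpow_le_rpow_of_exponent_le hG he
  have t1 : A ≤ 2 * G ^ ((N : ℝ) + p * s + 1) / t := by
    refine hA.trans ?_
    have := hGν 1 (by linarith)
    rw [Real.rpow_one] at this
    gcongr
  have e1 : η ^ (p - 2) ≤ k ^ (p - 2) * (8 * G) := by
    calc η ^ (p - 2) ≤ (k / (8 * G)) ^ (p - 2) :=
          Real.rpow_le_rpow_of_nonpos h8 hη (by linarith)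
      _ = k ^ (p - 2) * (8 * G) ^ (2 - p) := by
        rw [Real.div_rpow hk.le (by positivity), div_eq_mul_inv, ← Real.rpow_neg (by positivity)]
        congr 2; ring
      _ ≤ k ^ (p - 2) * (8 * G) ^ (1 : ℝ) := by
        refine mul_le_mul_of_nonneg_left ?_ (by positivity)
        exact Real.rpow_le_rpow_of_exponent_le (by linarith) (by linarith)
      _ = _ := by rw [Real.rpow_one]
  have t2 : H ^ (p * s) * η ^ (p - 2) ≤ 8 * 4 ^ (p * s) * G ^ ((N : ℝ) + p * s + 1) / t := by
    calc H ^ (p * s) * η ^ (p - 2) ≤ (4 * G / ρ) ^ (p * s) * (k ^ (p - 2) * (8 * G)) := by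
          gcongr
      _ = 8 * 4 ^ (p * s) * (G ^ (p * s) * G) / t * (t / ρ ^ (p * s) * k ^ (p - 2)) := by
        rw [Real.div_rpow (by positivity) hρ.le, Real.mul_rpow (by norm_num) hG0.le]
        field_simp
      _ ≤ 8 * 4 ^ (p * s) * (G ^ (p * s) * G) / t * 1 := by gcongr
      _ ≤ _ := by
        rw [mul_one, ← Real.rpow_add_one hG0.ne']
        have := hGν (p * s + 1) (by have : (0:ℝ) ≤ N := by positivity
                                    linarith)
        gcongr
  have e2 : η ^ (1 - 2 : ℝ) ≤ 8 * G / k := by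
    rw [show (1 - 2 : ℝ) = -1 by norm_num, Real.rpow_neg_one]
    calc η⁻¹ ≤ (k / (8 * G))⁻¹ := inv_anti₀ h8 hη
      _ = _ := by rw [inv_div]
  have t3 : E ^ ((N : ℝ) + p * s) * D * η ^ (1 - 2 : ℝ) ≤
      8 * 4 ^ ((N : ℝ) + p * s) * G ^ ((N : ℝ) + p * s + 1) / t := by
    calc E ^ ((N : ℝ) + p * s) * D * η ^ (1 - 2 : ℝ)
        ≤ (4 * G) ^ ((N : ℝ) + p * s) * D * (8 * G / k) := by gcongr
      _ = 8 * 4 ^ ((N : ℝ) + p * s) * (G ^ ((N : ℝ) + p * s) * G) / t * (t * D / k) := by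
        rw [Real.mul_rpow (by norm_num) hG0.le]
        field_simp
      _ ≤ 8 * 4 ^ ((N : ℝ) + p * s) * (G ^ ((N : ℝ) + p * s) * G) / t * 1 := by
        gcongr
        exact (div_le_one hk).2 h2
      _ = _ := by rw [mul_one, ← Real.rpow_add_one hG0.ne']
  calc _ ≤ _ := add_le_add (add_le_add t1 t2) t3
    _ = _ := by ring

/-- The exponent governing the loss in the De Giorgi iteration. -/
noncomputable def lossExponent (N : ℕ) (p s : ℝ) : ℝ :=
  p + 2 * (p * s / N) + ((N : ℝ) + p * s + 1) * (1 + p * s / N)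

/-- The recursive inequality of the De Giorgi iteration. -/
lemma exists_levelIntegral_recursion (hN : 1 ≤ N) (hp : 1 < p) (hp2 : p < 2) (hs₀ : 0 < s)
    (hC₁ : 0 < C₁) (hC₂ : C₁ ≤ C₂) {Λ : ℝ} (hΛ : 1 ≤ Λ) : ∃ C : ℝ, 0 < C ∧
    ∀ {Ω : Set (RN N)} {T : EReal} {K K' : RN N × RN N × ℝ → ℝ} {u u' : RN N × ℝ → ℝ},
      MeasurableVersion p s C₁ C₂ Ω T K u K' u' →
      ∀ {a₀ a₁ b ρ t R₂ R D k k' η G : ℝ} {x₀ : RN N}, 0 < a₀ → a₀ < a₁ → a₁ < b →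
        (b : EReal) < T → 0 < ρ → 0 < t → 0 < k → 0 ≤ D → 1 ≤ G →
        0 < R₂ → R₂ < R → ρ / 2 ≤ R → CompactlyIn (Metric.ball x₀ R) Ω →
        0 ≤ k' → k' + 2 * η ≤ k → k / (8 * G) ≤ η →
        t / ρ ^ (p * s) * k ^ (p - 2) ≤ 1 → t * D ≤ k →
        1 / (a₁ - a₀) ≤ 2 * G / t → 2 / (R - R₂) ≤ 4 * G / ρ → 2 * R / (R - R₂) ≤ 4 * G →
        CenteredTailBound p s x₀ (ρ / 2) a₀ b D u' →
        (2 ≤ p + 2 * (p * s / N) ∨ ∀ᵐ τ ∂(volume.restrict (Ioo a₀ b)),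
          ∀ᵐ x ∂(volume.restrict (Metric.ball x₀ R)), u' (x, τ) ≤ Λ * k) →
        levelIntegral u' x₀ R₂ a₁ b (k' + 2 * η) 2 ≤
          ENNReal.ofReal (C * (k ^ (2 - (p + 2 * (p * s / N))) * t ^ (-(1 + p * s / N))
            * G ^ lossExponent N p s)) * levelIntegral u' x₀ R a₀ b k' 2 ^ (1 + p * s / N) := by
  obtain ⟨C, hC0, hC⟩ := exists_levelIntegral_le (N := N) hN hp hs₀ hC₁ hC₂
  have hN0 : (0 : ℝ) < N := by exact_mod_cast hN
  set α := p * s / N with hα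
  have hα0 : 0 < α := by positivity
  set q := p + 2 * α with hq
  have hq0 : 0 < q := by positivity
  set c' : ℝ := 2 + 8 * 4 ^ (p * s) + 8 * 4 ^ ((N : ℝ) + p * s) with hc'
  have hc'0 : 0 < c' := by positivity
  refine ⟨8 ^ q * Λ ^ (2 : ℝ) * C * c' ^ (1 + α), by positivity, ?_⟩
  intro Ω T K K' u u' h a₀ a₁ b ρ t R₂ R D k k' η G x₀ ha h01 h1b hb hρ ht hk hD hG hR₂ hR hρR hU
    hk' hkη hη h1 h2 hA hH hE hT hq2
  have hG0 : 0 < G := by linarith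
  have hη0 : 0 < η := lt_of_lt_of_le (by positivity) hη
  have hRR : 0 < R - R₂ := by linarith
  have hl0 : 0 ≤ k' + η := by linarith
  have hcoef := step_coefficient_le (N := N) hp hp2 hs₀ hρ ht hk hD hG hη h1 h2 hA
    (by positivity) hH (div_nonneg (by linarith) hRR.le) hE
  rw [← hc'] at hcoef
  have hstep := hC h ha h01 h1b hb hR₂ hR hρR hU hl0 hT
  set Y := levelIntegral u' x₀ R a₀ b k' 2 with hY
  have hlev : ∀ e : ℝ, 0 < e → e ≤ 2 →
      levelIntegral u' x₀ R a₀ b (k' + η) e ≤ ENNReal.ofReal (η ^ (e - 2)) * Y :=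
    fun e he he2 => levelIntegral_le_of_forall le_rfl le_rfl (by positivity)
      fun w => rpow_max_sub_add_le he he2 hη0 w
  have h01' : 0 < a₁ - a₀ := by linarith
  have hX : cylinderExcess p u' x₀ R a₀ b (k' + η) (1 / (a₁ - a₀)) ((2 / (R - R₂)) ^ (p * s))
            ((2 * R / (R - R₂)) ^ ((N : ℝ) + p * s) * D) ≤
      ENNReal.ofReal (c' * G ^ ((N : ℝ) + p * s + 1) / t) * Y := by
    have hR0 : 0 < R := by linarith
    have n1 : 0 ≤ (2 / (R - R₂)) ^ (p * s) := by positivity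
    have n2 : 0 ≤ (2 * R / (R - R₂)) ^ ((N : ℝ) + p * s) * D := by positivity
    refine le_trans ?_ (mul_le_mul_left (ENNReal.ofReal_le_ofReal hcoef) _)
    rw [ENNReal.ofReal_add (by positivity) (by positivity),
      ENNReal.ofReal_add (by positivity) (by positivity), add_mul, add_mul,
      ENNReal.ofReal_mul n1, ENNReal.ofReal_mul n2, mul_assoc, mul_assoc]
    refine add_le_add (add_le_add ?_ ?_) ?_
    · have := hlev 2 (by norm_num) le_rfl
      rw [sub_self, Real.rpow_zero, ENNReal.ofReal_one, one_mul] at this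
      exact mul_le_mul_right this _
    · exact mul_le_mul_right (hlev p (by linarith) hp2.le) _
    · exact mul_le_mul_right (hlev 1 one_pos (by norm_num)) _
  have hup : levelIntegral u' x₀ R₂ a₁ b (k' + 2 * η) 2 ≤
      ENNReal.ofReal (8 ^ q * Λ ^ (2 : ℝ) * (k ^ (2 - q) * G ^ q)) *
        levelIntegral u' x₀ R₂ a₁ b (k' + η) q := by
    have hGq : 1 ≤ G ^ q := Real.one_le_rpow hG hq0.le
    have h8q : (1 : ℝ) ≤ 8 ^ q := Real.one_le_rpow (by norm_num) hq0.le
    have hΛ2 : (1 : ℝ) ≤ Λ ^ (2 : ℝ) := Real.one_le_rpow hΛ (by norm_num)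
    have hkq : 0 < k ^ (2 - q) := by positivity
    refine levelIntegral_le_mul le_rfl le_rfl (by positivity) ?_
    rcases le_or_gt 2 q with hq2' | hq2'
    · refine Eventually.of_forall fun τ => Eventually.of_forall fun x => ?_
      rw [show k' + 2 * η = (k' + η) + η by ring]
      refine (rpow_max_sub_add_le (by norm_num) hq2' hη0 _).trans ?_
      refine mul_le_mul_of_nonneg_right ?_ (Real.rpow_nonneg (le_max_right _ _) _)
      calc η ^ (2 - q) ≤ (k / (8 * G)) ^ (2 - q) :=
            Real.rpow_le_rpow_of_nonpos (by positivity) hη (by linarith)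
        _ = k ^ (2 - q) * (8 * G) ^ (q - 2) := by
          rw [Real.div_rpow hk.le (by positivity), div_eq_mul_inv,
            ← Real.rpow_neg (by positivity)]
          congr 2; ring
        _ ≤ k ^ (2 - q) * (8 * G) ^ q := by
          refine mul_le_mul_of_nonneg_left ?_ hkq.le
          exact Real.rpow_le_rpow_of_exponent_le (by linarith) (by linarith)
        _ = 8 ^ q * 1 * (k ^ (2 - q) * G ^ q) := by
          rw [Real.mul_rpow (by norm_num) hG0.le]; ring
        _ ≤ _ := by gcongr
    · replace hq2 := hq2.resolve_left (not_le.2 hq2')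
      filter_upwards [ae_restrict_of_ae_restrict_of_subset (Ioo_subset_Ioo_left h01.le) hq2]
        with τ hτ
      filter_upwards [ae_restrict_of_ae_restrict_of_subset (Metric.ball_subset_ball hR.le) hτ]
        with x hx
      refine (rpow_max_sub_le_of_le (k' := k' + η) hq0 hq2'.le hl0 (by linarith) hx
        (by positivity)).trans ?_
      refine mul_le_mul_of_nonneg_right ?_ (Real.rpow_nonneg (le_max_right _ _) _)
      calc (Λ * k) ^ (2 - q) = Λ ^ (2 - q) * k ^ (2 - q) :=
            Real.mul_rpow (by linarith) hk.le
        _ ≤ Λ ^ (2 : ℝ) * k ^ (2 - q) := by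
          refine mul_le_mul_of_nonneg_right ?_ hkq.le
          exact Real.rpow_le_rpow_of_exponent_le hΛ (by linarith)
        _ = 1 * Λ ^ (2 : ℝ) * (k ^ (2 - q) * 1) := by ring
        _ ≤ _ := by gcongr
  have h1α : 0 ≤ 1 + α := by positivity
  calc _ ≤ _ := hup
    _ ≤ ENNReal.ofReal (8 ^ q * Λ ^ (2 : ℝ) * (k ^ (2 - q) * G ^ q)) * (ENNReal.ofReal C *
        (ENNReal.ofReal (c' * G ^ ((N : ℝ) + p * s + 1) / t) * Y) ^ (1 + α)) := by
      refine mul_le_mul_right (hstep.trans (mul_le_mul_right ?_ _)) _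
      exact ENNReal.rpow_le_rpow hX h1α
    _ = _ := by
      rw [ENNReal.mul_rpow_of_nonneg _ _ h1α, ENNReal.ofReal_rpow_of_pos (by positivity),
        ← mul_assoc, ← mul_assoc, ← ENNReal.ofReal_mul (by positivity),
        ← ENNReal.ofReal_mul (by positivity)]
      congr 2
      rw [Real.div_rpow (by positivity) ht.le, Real.mul_rpow hc'0.le (by positivity),
        ← Real.rpow_mul hG0.le, lossExponent, ← hα, ← hq, Real.rpow_add hG0 q, Real.rpow_neg ht.le]
      ring

lemma CompactlyIn.ball_mono {x₀ : RN N} {R R' : ℝ} (h : CompactlyIn (Metric.ball x₀ R') Ω)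
    (hR : R ≤ R') : CompactlyIn (Metric.ball x₀ R) Ω := by
  have hsub := closure_mono (Metric.ball_subset_ball hR : Metric.ball x₀ R ⊆ Metric.ball x₀ R')
  exact ⟨Metric.isOpen_ball, h.2.1.of_isClosed_subset isClosed_closure hsub, hsub.trans h.2.2⟩

lemma div_half_mul_eq {c δ ε m : ℝ} (hc : 0 < c) (hδ : 0 < δ) (hε : 0 < ε) (hεm : ε * m = 1) :
    c / (δ * c * ε / 2) = 2 * (m / δ) := by
  have hm : m = 1 / ε := by field_simp; linarith
  rw [hm]
  field_simp

set_option maxHeartbeats 1000000 in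
/-- **De Giorgi iteration**: smallness of the excess over the level `k/2` on a cylinder gives the
upper bound `k` on a smaller cylinder. -/
theorem exists_levelIntegral_eq_zero (hN : 1 ≤ N) (hp : 1 < p) (hp2 : p < 2) (hs₀ : 0 < s)
    (hC₁ : 0 < C₁) (hC₂ : C₁ ≤ C₂) {Λ : ℝ} (hΛ : 1 ≤ Λ) : ∃ C : ℝ, 0 < C ∧
    ∀ {Ω : Set (RN N)} {T : EReal} {K K' : RN N × RN N × ℝ → ℝ} {u u' : RN N × ℝ → ℝ},
      MeasurableVersion p s C₁ C₂ Ω T K u K' u' →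
      ∀ {a₀ a₁ b ρ t R₁ R₀ D k δ : ℝ} {x₀ : RN N}, 0 < a₀ → a₁ < b → (b : EReal) < T →
        0 < ρ → 0 < t → 0 < k → 0 ≤ D → 0 < δ → δ ≤ 1 → δ * t ≤ a₁ - a₀ →
        ρ / 2 ≤ R₁ → R₀ ≤ ρ → δ * ρ ≤ R₀ - R₁ → CompactlyIn (Metric.ball x₀ R₀) Ω →
        t / ρ ^ (p * s) * k ^ (p - 2) ≤ 1 → t * D ≤ k →
        CenteredTailBound p s x₀ (ρ / 2) a₀ b D u' →
        (2 ≤ p + 2 * (p * s / N) ∨ ∀ᵐ τ ∂(volume.restrict (Ioo a₀ b)),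
          ∀ᵐ x ∂(volume.restrict (Metric.ball x₀ R₀)), u' (x, τ) ≤ Λ * k) →
        ENNReal.ofReal (C * (k ^ (2 - (p + 2 * (p * s / N))) * t ^ (-(1 + p * s / N))
            * δ ^ (-lossExponent N p s)))
          * levelIntegral u' x₀ R₀ a₀ b (k / 2) 2 ^ (p * s / N) ≤ 1 →
        levelIntegral u' x₀ R₁ a₁ b k 2 = 0 := by
  obtain ⟨C, hC0, hC⟩ := exists_levelIntegral_recursion (N := N) hN hp hp2 hs₀ hC₁ hC₂ hΛ
  have hN0 : (0 : ℝ) < N := by exact_mod_cast hN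
  set α := p * s / N with hα
  have hα0 : 0 < α := by positivity
  set β := lossExponent N p s with hβ
  have hβ0 : 0 < β := by rw [hβ, lossExponent]; positivity
  have hB1 : (1 : ℝ) < 2 ^ β := Real.one_lt_rpow (by norm_num) hβ0
  refine ⟨C * ((2 : ℝ) ^ β) ^ (1 / α), by positivity, ?_⟩
  intro Ω T K K' u u' h a₀ a₁ b ρ t R₁ R₀ D k δ x₀ ha h1b hb hρ ht hk hD hδ hδ1 hat hR₁ hR₀ hRR hU
    h1 h2 hT hq hY
  set q := p + 2 * α with hq'
  have hδt : 0 < δ * t := by positivity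
  have hδρ : 0 < δ * ρ := by positivity
  set ε : ℕ → ℝ := fun n => (1 / 2) ^ n with hε
  have hε0 : ∀ n, 0 < ε n := fun n => by positivity
  have hε1 : ∀ n, ε n ≤ 1 := fun n => pow_le_one₀ (by norm_num) (by norm_num)
  have hεs : ∀ n, ε (n + 1) = ε n / 2 := fun n => by simp only [hε]; rw [pow_succ]; ring
  have hε2 : ∀ n, ε n * 2 ^ n = 1 := fun n => by simp only [hε]; rw [← mul_pow]; norm_num
  have hεz : ε 0 = 1 := pow_zero _
  clear_value ε
  set R : ℕ → ℝ := fun n => R₁ + (R₀ - R₁) * ε n with hR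
  set a : ℕ → ℝ := fun n => a₁ - (a₁ - a₀) * ε n with haa
  set l : ℕ → ℝ := fun n => k * (1 - ε n / 2) with hl
  have hRle : ∀ n, R n ≤ R₀ := fun n => by
    have := hε1 n; simp only [hR]; nlinarith
  have hRge : ∀ n, R₁ ≤ R n := fun n => by
    have := hε0 n; simp only [hR]; nlinarith
  have hage : ∀ n, a₀ ≤ a n := fun n => by
    have := hε1 n; simp only [haa]; nlinarith
  have hale : ∀ n, a n ≤ a₁ := fun n => by
    have := hε0 n; simp only [haa]; nlinarith
  set Y : ℕ → ℝ≥0∞ := fun n => levelIntegral u' x₀ (R n) (a n) b (l n) 2 with hYdef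
  set Cr := C * (k ^ (2 - q) * t ^ (-(1 + α)) * δ ^ (-β)) with hCr
  have hCr0 : 0 < Cr := by positivity
  have hrec : ∀ n, Y (n + 1) ≤ ENNReal.ofReal (Cr * (2 ^ β) ^ n) * Y n ^ (1 + α) := by
    intro n
    have hd : 0 < 2 ^ n / δ := by positivity
    have e2 := hε2 n
    have e0 := hε0 n
    have e1 := hε1 n
    have hη : l (n + 1) = l n + 2 * (k * ε n / 8) := by
      simp only [hl, hεs]; ring
    have hRd : R n - R (n + 1) = (R₀ - R₁) * ε n / 2 := by simp only [hR, hεs]; ring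
    have had : a (n + 1) - a n = (a₁ - a₀) * ε n / 2 := by simp only [haa, hεs]; ring
    have hRd' : δ * ρ * ε n / 2 ≤ R n - R (n + 1) := by rw [hRd]; gcongr
    have had' : δ * t * ε n / 2 ≤ a (n + 1) - a n := by rw [had]; gcongr
    have hRd0 : 0 < δ * ρ * ε n / 2 := by positivity
    have had0 : 0 < δ * t * ε n / 2 := by positivity
    have key1 : ∀ c : ℝ, 0 < c → c / (δ * c * ε n / 2) = 2 * (2 ^ n / δ) := fun c hc =>
      div_half_mul_eq hc hδ e0 e2
    have hGpow : (2 ^ n / δ) ^ β = (2 ^ β) ^ n * δ ^ (-β) := by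
      rw [Real.div_rpow (by positivity) hδ.le, Real.rpow_neg hδ.le, ← Real.rpow_natCast,
        ← Real.rpow_natCast, ← Real.rpow_mul (by norm_num), ← Real.rpow_mul (by norm_num),
        mul_comm β, div_eq_mul_inv]
    have := hC h (a₀ := a n) (a₁ := a (n + 1)) (b := b) (ρ := ρ) (t := t) (R₂ := R (n + 1))
      (R := R n) (D := D) (k := k) (k' := l n) (η := k * ε n / 8) (G := 2 ^ n / δ) (x₀ := x₀)
      (ha.trans_le (hage n)) (by linarith) ((hale _).trans_lt h1b) hb hρ ht hk hD
      ?_ (by linarith [hRge (n + 1)]) (by linarith) (by linarith [hRge n])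
      (hU.ball_mono (hRle n)) ?_ ?_ ?_ h1 h2 ?_ ?_ ?_
      (ae_restrict_of_ae_restrict_of_subset (Ioo_subset_Ioo_left (hage n)) hT) ?_
    · rw [hYdef]
      simp only
      rw [hη]
      refine this.trans (le_of_eq ?_)
      rw [hGpow, hCr]
      congr 2
      ring
    · rw [le_div_iff₀ hδ, one_mul]
      exact hδ1.trans (one_le_pow₀ (by norm_num))
    · simp only [hl]
      exact mul_nonneg hk.le (by linarith)
    · rw [← hη]
      have := hε0 (n + 1)
      exact mul_le_of_le_one_right hk.le (by linarith)
    · rw [div_le_div_iff₀ (by positivity) (by norm_num)]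
      have e3 : k * ε n * (8 * (2 ^ n / δ)) = 8 * k * (ε n * 2 ^ n) / δ := by ring
      rw [e3, e2, mul_one, le_div_iff₀ hδ, mul_comm 8 k]
      exact mul_le_of_le_one_right (by positivity) hδ1
    · have e4 : 2 * (2 ^ n / δ) / t = 1 / (δ * t * ε n / 2) := by
        rw [← key1 t ht]; field_simp
      rw [e4]
      exact one_div_le_one_div_of_le had0 had'
    · have e4 : 4 * (2 ^ n / δ) / ρ = 2 / (δ * ρ * ε n / 2) := by
        have := key1 ρ hρ
        rw [show 4 * (2 ^ n / δ) = 2 * (2 * (2 ^ n / δ)) by ring, ← this]; field_simp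
      rw [e4]
      exact div_le_div_of_nonneg_left (by norm_num) hRd0 hRd'
    · have e4 : 4 * (2 ^ n / δ) = 2 * ρ / (δ * ρ * ε n / 2) := by
        have := key1 ρ hρ
        rw [show 4 * (2 ^ n / δ) = 2 * (2 * (2 ^ n / δ)) by ring, ← this]; ring
      rw [e4]
      have := hRle n
      exact div_le_div₀ (by positivity) (by linarith) hRd0 hRd'
    · refine hq.imp id fun hq => ?_
      filter_upwards [ae_restrict_of_ae_restrict_of_subset (Ioo_subset_Ioo_left (hage n)) hq]
        with τ hτ
      exact ae_restrict_of_ae_restrict_of_subset (Metric.ball_subset_ball (hRle n)) hτ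
  have hY0 : Y 0 = levelIntegral u' x₀ R₀ a₀ b (k / 2) 2 := by
    simp only [hYdef, hR, haa, hl, hεz]
    congr 1 <;> ring
  have hfin : Y 0 ≠ ⊤ := by
    rw [hY0]
    refine ne_top_of_le_ne_top (h.lintegral_sq_ne_top ha hb hU 0) ?_
    refine lintegral_mono fun τ => lintegral_mono fun x => ENNReal.ofReal_le_ofReal ?_
    rw [Real.rpow_two, zero_add, sq_abs]
    rcases le_total (u' (x, τ) - k / 2) 0 with h0 | h0
    · rw [max_eq_right h0]; nlinarith [sq_nonneg (u' (x, τ))]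
    · rw [max_eq_left h0]; nlinarith
  have hlim := tendsto_zero_of_fast_decay hα0 hB1 hCr0.le hrec ?_ hfin
  · refine le_antisymm (ge_of_tendsto' hlim fun n => ?_) zero_le
    refine levelIntegral_mono (hRge n) (hale n) ?_ (by norm_num)
    have := hε0 n
    exact mul_le_of_le_one_right hk.le (by linarith)
  · rw [hY0]
    have hb0 : 0 < ((2 : ℝ) ^ β) ^ (1 / α) := by positivity
    have e1 : C * ((2 : ℝ) ^ β) ^ (1 / α) * (k ^ (2 - q) * t ^ (-(1 + α)) * δ ^ (-β)) =
        ((2 : ℝ) ^ β) ^ (1 / α) * Cr := by rw [hCr]; ring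
    rw [e1, ENNReal.ofReal_mul hb0.le, mul_assoc] at hY
    have e2 : ENNReal.ofReal (((2 : ℝ) ^ β) ^ (-1 / α)) =
        (ENNReal.ofReal (((2 : ℝ) ^ β) ^ (1 / α)))⁻¹ := by
      rw [← ENNReal.ofReal_inv_of_pos hb0, ← Real.rpow_neg (by positivity), neg_div]
    rw [e2, ENNReal.le_inv_iff_mul_le, mul_comm]
    exact hY

lemma levelIntegral_eq_lintegral_prod (hu : Measurable u) (x₀ : RN N) (R a b k e : ℝ) :
    levelIntegral u x₀ R a b k e =
      ∫⁻ z in Metric.ball x₀ R ×ˢ Ioo a b, ENNReal.ofReal (max (u z - k) 0 ^ e) := by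
  rw [Measure.volume_eq_prod, ← Measure.prod_restrict, lintegral_prod_symm]
  · rfl
  · have : Measurable fun z => ENNReal.ofReal (max (u z - k) 0 ^ e) := by fun_prop
    exact this.aemeasurable

lemma levelIntegral_eq_zero_iff (hu : Measurable u) (x₀ : RN N) (R a b k : ℝ) :
    levelIntegral u x₀ R a b k 2 = 0 ↔
      ∀ᵐ z ∂(volume.restrict (Metric.ball x₀ R ×ˢ Ioo a b)), u z ≤ k := by
  have hm : Measurable fun z => ENNReal.ofReal (max (u z - k) 0 ^ (2 : ℝ)) := by fun_prop
  rw [levelIntegral_eq_lintegral_prod hu, lintegral_eq_zero_iff hm]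
  refine eventually_congr (Eventually.of_forall fun z => ?_)
  simp only [Pi.zero_apply, ENNReal.ofReal_eq_zero, Real.rpow_two]
  constructor
  · intro h
    have h1 : max (u z - k) 0 = 0 := by nlinarith [sq_nonneg (max (u z - k) 0)]
    linarith [max_eq_right_iff.1 h1]
  · intro h
    rw [max_eq_right (by linarith)]; norm_num

lemma MeasurableVersion.exists_centeredTailBound (h : MeasurableVersion p s C₁ C₂ Ω T K u K' u')
    {a b : ℝ} (ha : 0 < a) (hab : a < b) (hb : (b : EReal) < T) (x₀ : RN N) {ρ : ℝ} (hρ : 0 < ρ) :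
    ∃ D : ℝ, 0 ≤ D ∧ CenteredTailBound p s x₀ ρ a b D u' := by
  obtain ⟨D, hD, hT⟩ := h.exists_tailBound ha hab hb x₀ (half_lt_self hρ)
  refine ⟨D, hD, ?_⟩
  filter_upwards [hT] with τ hτ
  refine le_trans ?_ (hτ x₀ (Metric.mem_ball_self (by positivity)))
  refine lintegral_mono fun y => ENNReal.ofReal_le_ofReal ?_
  rw [norm_sub_rev x₀ y]
  have hp := h.one_lt_p
  have h1 : max (u' (y, τ)) 0 ≤ |u' (y, τ)| := max_le (le_abs_self _) (abs_nonneg _)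
  have h2 := Real.rpow_le_rpow (le_max_right _ _) h1 (by linarith : 0 ≤ p - 1)
  gcongr

lemma two_lt_of_pCrit_lt (hN : 1 ≤ N) (hs₀ : 0 < s) (h : pCrit N s < p) :
    2 < p + 2 * (p * s / N) := by
  have hN0 : (0 : ℝ) < N := by exact_mod_cast hN
  rw [pCrit, div_lt_iff₀ (by positivity)] at h
  have e : p + 2 * (p * s / N) = p * (N + 2 * s) / N := by field_simp
  rw [e, lt_div_iff₀ hN0]
  linarith

/-- In the supercritical range a local weak solution is bounded above on small cylinders. -/
lemma MeasurableVersion.exists_upper_bound (hC₂ : C₁ ≤ C₂)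
    (h : MeasurableVersion p s C₁ C₂ Ω T K u K' u') (hpc : pCrit N s < p)
    {t₁ t₂ : ℝ} (ht₁ : 0 < t₁) (h12 : t₁ < t₂) (ht₂ : (t₂ : EReal) < T) {x₀ : RN N} {ρ : ℝ}
    (hρ : 0 < ρ) (hU : CompactlyIn (Metric.ball x₀ ρ) Ω) :
    ∃ M : ℝ, ∀ᵐ z ∂(volume.restrict (Metric.ball x₀ (ρ / 2) ×ˢ Ioo t₁ t₂)), u' z ≤ M := by
  have hp := h.one_lt_p
  have hp2 := h.p_lt_two
  have hs₀ := h.s_pos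
  have hN0 : (0 : ℝ) < N := by exact_mod_cast h.one_le_dim
  obtain ⟨C, hC0, hC⟩ := exists_levelIntegral_eq_zero h.one_le_dim hp hp2 hs₀ h.C₁_pos hC₂
    (le_refl (1 : ℝ))
  have hq := two_lt_of_pCrit_lt h.one_le_dim hs₀ hpc
  have ha : 0 < t₁ / 2 := by linarith
  have hα0 : 0 < p * s / N := by positivity
  set α := p * s / N
  set q := p + 2 * α with hqdef
  have ht : 0 < t₂ := by linarith
  obtain ⟨D, hD, hT⟩ := h.exists_centeredTailBound ha (by linarith : t₁ / 2 < t₂) ht₂ x₀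
    (half_pos hρ)
  set δ := t₁ / (2 * t₂) with hδ
  have hδ0 : 0 < δ := by positivity
  have hδ1 : δ ≤ 1 / 2 := by rw [hδ, div_le_div_iff₀ (by positivity) (by norm_num)]; linarith
  set A := levelIntegral u' x₀ ρ (t₁ / 2) t₂ 0 2 with hA
  have hAfin : A ≠ ⊤ := by
    refine ne_top_of_le_ne_top (h.lintegral_sq_ne_top ha ht₂ hU 0) ?_
    refine lintegral_mono fun τ => lintegral_mono fun x => ENNReal.ofReal_le_ofReal ?_
    rw [Real.rpow_two, zero_add, sq_abs, sub_zero]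
    exact pow_le_pow_left₀ (le_max_right _ _) (max_le (le_abs_self _) (abs_nonneg _)) 2 |>.trans
      (sq_abs _).le
  have e1 : ∀ᶠ k : ℝ in atTop, t₂ / ρ ^ (p * s) * k ^ (p - 2) ≤ 1 := by
    have := (tendsto_rpow_neg_atTop (by linarith : 0 < 2 - p)).const_mul (t₂ / ρ ^ (p * s))
    rw [mul_zero] at this
    filter_upwards [this.eventually (gt_mem_nhds one_pos)] with k hk
    rw [show p - 2 = -(2 - p) by ring]
    exact hk.le
  have e2 : ∀ᶠ k : ℝ in atTop, C * (k ^ (2 - q) * t₂ ^ (-(1 + α)) * δ ^ (-lossExponent N p s))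
      * A.toReal ^ α ≤ 1 := by
    have := (tendsto_rpow_neg_atTop (by linarith : 0 < q - 2)).const_mul
      (C * (t₂ ^ (-(1 + α)) * δ ^ (-lossExponent N p s)) * A.toReal ^ α)
    rw [mul_zero] at this
    filter_upwards [this.eventually (gt_mem_nhds one_pos)] with k hk
    rw [show 2 - q = -(q - 2) by ring]
    refine le_trans (le_of_eq ?_) hk.le
    ring
  obtain ⟨k, hk1, hk2, hk3, hk0⟩ :=
    (e1.and (e2.and ((eventually_ge_atTop (t₂ * D)).and (eventually_gt_atTop 0)))).exists
  refine ⟨k, ?_⟩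
  rw [← levelIntegral_eq_zero_iff h.meas]
  refine hC h (δ := δ) (D := D) (ρ := ρ) (R₀ := ρ) (t := t₂) ha h12 ht₂ hρ ht hk0 hD hδ0
    (by linarith) ?_ le_rfl le_rfl ?_ hU hk1 hk3 hT (Or.inl hq.le) ?_
  · rw [hδ]; field_simp; linarith
  · nlinarith
  · refine le_trans ?_ (ENNReal.ofReal_le_one.2 hk2)
    rw [ENNReal.ofReal_mul (p := C * (k ^ (2 - q) * t₂ ^ (-(1 + α)) * δ ^ (-lossExponent N p s)))
      (by positivity), ← ENNReal.ofReal_rpow_of_nonneg ENNReal.toReal_nonneg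
      hα0.le, ENNReal.ofReal_toReal hAfin]
    refine mul_le_mul_right (ENNReal.rpow_le_rpow ?_ hα0.le) _
    exact levelIntegral_mono le_rfl le_rfl (by linarith) (by norm_num)

lemma LpLocSobolev.neg {U : Set (RN N)} (h : LpLocSobolev s p U T u) :
    LpLocSobolev s p U T (fun z => -u z) := by
  intro t₁ t₂ h1 h2 h3
  refine lt_of_eq_of_lt (lintegral_congr fun τ => ?_) (h t₁ t₂ h1 h2 h3)
  simp only [sobolevPow, gagliardoPow, abs_neg, neg_sub_neg]
  congr 2
  funext z
  rw [abs_sub_comm]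

lemma ContL2.neg {U : Set (RN N)} (h : ContL2 U T u) : ContL2 U T (fun z => -u z) := by
  refine ⟨fun τ hτ => (h.1 τ hτ).neg, fun τ₀ hτ₀ => ?_⟩
  refine (h.2 τ₀ hτ₀).congr fun τ => ?_
  rw [← eLpNorm_neg]
  congr 1
  funext x
  simp only [Pi.neg_apply]
  ring

lemma IsLocalWeakSolution.neg (h : IsLocalWeakSolution p s Ω T K u) :
    IsLocalWeakSolution p s Ω T K (fun z => -u z) where
  aemeasurable := h.aemeasurable.neg
  cont U hU := (h.cont U hU).neg
  sobolev U hU := (h.sobolev U hU).neg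
  weak U hU t₁ t₂ h1 h2 h3 φ ψ hφ := by
    have := h.weak U hU t₁ t₂ h1 h2 h3 φ ψ hφ
    have e : ∀ τ, (∫ z : RN N × RN N,
            |(-u (z.1, τ)) - (-u (z.2, τ))| ^ (p - 2) * ((-u (z.1, τ)) - (-u (z.2, τ)))
              * (φ (z.1, τ) - φ (z.2, τ)) * K (z.1, z.2, τ)) = -∫ z : RN N × RN N,
            |u (z.1, τ) - u (z.2, τ)| ^ (p - 2) * (u (z.1, τ) - u (z.2, τ))
              * (φ (z.1, τ) - φ (z.2, τ)) * K (z.1, z.2, τ) := by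
      intro τ
      rw [← integral_neg]
      refine integral_congr_ae (Eventually.of_forall fun z => ?_)
      simp only [neg_sub_neg]
      rw [abs_sub_comm]
      ring
    simp only [e, neg_mul, integral_neg]
    linarith
  tail t₁ t₂ h1 h2 h3 := by
    simp only [abs_neg]
    exact h.tail t₁ t₂ h1 h2 h3

lemma exists_ae_le_of_isCompact {U : Set (RN N)} (hU : IsCompact U) {I : Set ℝ}
    (h : ∀ x ∈ U, ∃ r : ℝ, 0 < r ∧ ∃ M : ℝ,
      ∀ᵐ z ∂(volume.restrict (Metric.ball x r ×ˢ I)), u z ≤ M) :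
    ∃ M : ℝ, ∀ᵐ z ∂(volume.restrict (U ×ˢ I)), u z ≤ M := by
  refine hU.induction_on (p := fun S => ∃ M : ℝ, ∀ᵐ z ∂(volume.restrict (S ×ˢ I)), u z ≤ M)
    ⟨0, by simp⟩ ?_ ?_ ?_
  · rintro S S' hS ⟨M, hM⟩
    exact ⟨M, ae_restrict_of_ae_restrict_of_subset (prod_mono_left hS) hM⟩
  · rintro S S' ⟨M, hM⟩ ⟨M', hM'⟩
    refine ⟨max M M', ?_⟩
    rw [union_prod, ae_restrict_union_iff]
    exact ⟨hM.mono fun z hz => hz.trans (le_max_left _ _),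
      hM'.mono fun z hz => hz.trans (le_max_right _ _)⟩
  · intro x hx
    obtain ⟨r, hr, M, hM⟩ := h x hx
    exact ⟨_, mem_nhdsWithin_of_mem_nhds (Metric.ball_mem_nhds x hr), M, hM⟩

lemma exists_compactlyIn_ball (hΩ : IsOpen Ω) {x : RN N} (hx : x ∈ Ω) :
    ∃ ρ : ℝ, 0 < ρ ∧ CompactlyIn (Metric.ball x ρ) Ω := by
  obtain ⟨ρ, hρ, hsub⟩ := Metric.nhds_basis_closedBall.mem_iff.1 (hΩ.mem_nhds hx)
  exact ⟨ρ, hρ, Metric.isOpen_ball, (isCompact_closedBall x ρ).of_isClosed_subset isClosed_closure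
    Metric.closure_ball_subset_closedBall, Metric.closure_ball_subset_closedBall.trans hsub⟩

/-- In the supercritical range local weak solutions are locally bounded above. -/
lemma IsLocalWeakSolution.exists_ae_le (hN : 1 ≤ N) (hp : 1 < p) (hp2 : p < 2)
    (hs₀ : 0 < s) (hs₁ : s < 1) (hC₁ : 0 < C₁) (hC₂ : C₁ ≤ C₂) (hpc : pCrit N s < p)
    (hΩ : IsOpen Ω) (hK : IsKernel N p s C₁ C₂ T K) (hu : IsLocalWeakSolution p s Ω T K u)
    {U : Set (RN N)} (hU : CompactlyIn U Ω) {t₁ t₂ : ℝ} (ht₁ : 0 < t₁) (h12 : t₁ < t₂)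
    (ht₂ : (t₂ : EReal) < T) :
    ∃ M : ℝ, ∀ᵐ z ∂(volume.restrict (U ×ˢ Ioo t₁ t₂)), u z ≤ M := by
  obtain ⟨K', u', h, hae⟩ := exists_measurableVersion hN hp hp2 hs₀ hs₁ hC₁ hC₂ hK hu
  obtain ⟨M, hM⟩ := exists_ae_le_of_isCompact (u := u) (I := Ioo t₁ t₂) hU.2.1 fun x hx => by
    obtain ⟨ρ, hρ, hball⟩ := exists_compactlyIn_ball hΩ (hU.2.2 hx)
    obtain ⟨M, hM⟩ := h.exists_upper_bound hC₂ hpc ht₁ h12 ht₂ hρ hball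
    refine ⟨ρ / 2, half_pos hρ, M, ?_⟩
    filter_upwards [hM, ae_restrict_of_ae_restrict_of_subset
      (prod_mono (subset_univ _) (Ioo_subset_timeDom ht₁ ht₂)) hae] with z hz hz2
    rwa [hz2]
  exact ⟨M, ae_restrict_of_ae_restrict_of_subset (prod_mono_left subset_closure) hM⟩

/-- **Local boundedness** in the supercritical range. -/
theorem IsLocalWeakSolution.isLocallyBounded (hN : 1 ≤ N) (hp : 1 < p) (hp2 : p < 2)
    (hs₀ : 0 < s) (hs₁ : s < 1) (hC₁ : 0 < C₁) (hC₂ : C₁ ≤ C₂) (hpc : pCrit N s < p)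
    (hΩ : IsOpen Ω) (hK : IsKernel N p s C₁ C₂ T K) (hu : IsLocalWeakSolution p s Ω T K u) :
    IsLocallyBounded Ω T u := by
  intro U hU t₁ t₂ ht₁ h12 ht₂
  obtain ⟨M, hM⟩ := hu.exists_ae_le hN hp hp2 hs₀ hs₁ hC₁ hC₂ hpc hΩ hK hU ht₁ h12 ht₂
  obtain ⟨M', hM'⟩ := hu.neg.exists_ae_le hN hp hp2 hs₀ hs₁ hC₁ hC₂ hpc hΩ hK hU ht₁ h12 ht₂
  refine ⟨max M M', ?_⟩
  filter_upwards [hM, hM'] with z h1 h2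
  exact abs_le'.2 ⟨h1.trans (le_max_left _ _), h2.trans (le_max_right _ _)⟩

/-- The integral over a level set in terms of the `L^r` norm, for a function bounded by `Λ k`. -/
lemma levelIntegral_half_le {r Λ k a b R : ℝ} {x₀ : RN N} (hu : Measurable u) (hr : 0 < r)
    (hΛ : 1 ≤ Λ) (hk : 0 < k)
    (hle : ∀ᵐ z ∂(volume.restrict (Metric.ball x₀ R ×ˢ Ioo a b)), u z ≤ Λ * k) :
    levelIntegral u x₀ R a b (k / 2) 2 ≤
      ENNReal.ofReal (Λ ^ (2 : ℝ) * 2 ^ r * k ^ (2 - r)) * levelIntegral u x₀ R a b 0 r := by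
  have hΛ2 : (1 : ℝ) ≤ Λ ^ (2 : ℝ) := Real.one_le_rpow hΛ (by norm_num)
  have h2r : (1 : ℝ) ≤ 2 ^ r := Real.one_le_rpow (by norm_num) hr.le
  have hkr : 0 < k ^ (2 - r) := by positivity
  rw [levelIntegral_eq_lintegral_prod hu, levelIntegral_eq_lintegral_prod hu,
    ← lintegral_const_mul' _ _ ENNReal.ofReal_ne_top]
  refine lintegral_mono_ae ?_
  filter_upwards [hle] with z hz
  rw [← ENNReal.ofReal_mul (by positivity)]
  refine ENNReal.ofReal_le_ofReal ?_
  have h0 : 0 ≤ max (u z - 0) 0 ^ r := Real.rpow_nonneg (le_max_right _ _) _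
  rcases le_or_gt r 2 with hr2 | hr2
  · refine (rpow_max_sub_le_of_le (k' := 0) hr hr2 le_rfl (by linarith) hz
      (by positivity)).trans ?_
    refine mul_le_mul_of_nonneg_right ?_ h0
    rw [Real.mul_rpow (by linarith) hk.le]
    calc Λ ^ (2 - r) * k ^ (2 - r) ≤ Λ ^ (2 : ℝ) * k ^ (2 - r) := by
          refine mul_le_mul_of_nonneg_right ?_ hkr.le
          exact Real.rpow_le_rpow_of_exponent_le hΛ (by linarith)
      _ = Λ ^ (2 : ℝ) * 1 * k ^ (2 - r) := by ring
      _ ≤ _ := by gcongr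
  · have := rpow_max_sub_add_le (e := 2) (e' := r) (k := 0) (by norm_num) hr2.le (half_pos hk) (u z)
    rw [zero_add] at this
    refine this.trans (mul_le_mul_of_nonneg_right ?_ h0)
    calc (k / 2) ^ (2 - r) = 2 ^ (r - 2) * k ^ (2 - r) := by
          rw [Real.div_rpow hk.le (by norm_num), div_eq_mul_inv, ← Real.rpow_neg (by norm_num),
            neg_sub, mul_comm]
      _ ≤ 2 ^ r * k ^ (2 - r) := by
        refine mul_le_mul_of_nonneg_right ?_ hkr.le
        exact Real.rpow_le_rpow_of_exponent_le (by norm_num) (by linarith)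
      _ = 1 * 2 ^ r * k ^ (2 - r) := by ring
      _ ≤ _ := by gcongr

lemma ae_ae_of_ae_prod_restrict {P : RN N × ℝ → Prop} {B : Set (RN N)} {I : Set ℝ}
    (h : ∀ᵐ z ∂(volume.restrict (B ×ˢ I)), P z) :
    ∀ᵐ τ ∂(volume.restrict I), ∀ᵐ x ∂(volume.restrict B), P (x, τ) := by
  rw [Measure.volume_eq_prod, ← Measure.prod_restrict] at h
  have h2 : ∀ᵐ w ∂((volume.restrict I : Measure ℝ).prod (volume.restrict B : Measure (RN N))),
      P w.swap := Measure.measurePreserving_swap.quasiMeasurePreserving.ae h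
  exact Measure.ae_ae_of_ae_prod h2

/-- Improvement of an upper bound `Λ k` to `k` on a smaller cylinder, in terms of the `L^r` norm. -/
lemma exists_upper_bound_improvement (hN : 1 ≤ N) (hp : 1 < p) (hp2 : p < 2) (hs₀ : 0 < s)
    (hC₁ : 0 < C₁) (hC₂ : C₁ ≤ C₂) {r : ℝ} (hr : 0 < r) {Λ : ℝ} (hΛ : 1 ≤ Λ) : ∃ C : ℝ, 0 < C ∧
    ∀ {Ω : Set (RN N)} {T : EReal} {K K' : RN N × RN N × ℝ → ℝ} {u u' : RN N × ℝ → ℝ},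
      MeasurableVersion p s C₁ C₂ Ω T K u K' u' →
      ∀ {a₀ a₁ b ρ t R₁ R₀ D k δ I : ℝ} {x₀ : RN N}, 0 < a₀ → a₁ < b → (b : EReal) < T →
        0 < ρ → 0 < t → 0 < k → 0 ≤ D → 0 < δ → δ ≤ 1 → δ * t ≤ a₁ - a₀ →
        ρ / 2 ≤ R₁ → R₀ ≤ ρ → δ * ρ ≤ R₀ - R₁ → CompactlyIn (Metric.ball x₀ R₀) Ω →
        t / ρ ^ (p * s) * k ^ (p - 2) ≤ 1 → t * D ≤ k →
        CenteredTailBound p s x₀ (ρ / 2) a₀ b D u' →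
        0 ≤ I → levelIntegral u' x₀ R₀ a₀ b 0 r ≤ ENNReal.ofReal I →
        C * (I ^ (p * s / N) * t ^ (-(1 + p * s / N))) * δ ^ (-lossExponent N p s)
          ≤ k ^ (r * (p * s / N) - (2 - p)) →
        (∀ᵐ z ∂(volume.restrict (Metric.ball x₀ R₀ ×ˢ Ioo a₀ b)), u' z ≤ Λ * k) →
        ∀ᵐ z ∂(volume.restrict (Metric.ball x₀ R₁ ×ˢ Ioo a₁ b)), u' z ≤ k := by
  obtain ⟨C, hC0, hC⟩ := exists_levelIntegral_eq_zero (N := N) hN hp hp2 hs₀ hC₁ hC₂ hΛ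
  have hN0 : (0 : ℝ) < N := by exact_mod_cast hN
  set α := p * s / N with hα
  have hα0 : 0 < α := by positivity
  set c := Λ ^ (2 : ℝ) * 2 ^ r with hc
  have hc0 : 0 < c := by positivity
  refine ⟨C * c ^ α, by positivity, ?_⟩
  intro Ω T K K' u u' h a₀ a₁ b ρ t R₁ R₀ D k δ I x₀ ha h1b hb hρ ht hk hD hδ hδ1 hat hR₁ hR₀ hRR
    hU h1 h2 hT hI hIle hkC hle
  rw [← levelIntegral_eq_zero_iff h.meas]
  refine hC h ha h1b hb hρ ht hk hD hδ hδ1 hat hR₁ hR₀ hRR hU h1 h2 hT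
    (Or.inr (ae_ae_of_ae_prod_restrict hle)) ?_
  have hY : levelIntegral u' x₀ R₀ a₀ b (k / 2) 2 ≤ ENNReal.ofReal (c * k ^ (2 - r) * I) := by
    refine (levelIntegral_half_le h.meas hr hΛ hk hle).trans ?_
    rw [ENNReal.ofReal_mul (p := c * k ^ (2 - r)) (by positivity)]
    exact mul_le_mul_right hIle _
  set q := p + 2 * α with hq
  set β := lossExponent N p s
  calc _ ≤ ENNReal.ofReal (C * (k ^ (2 - q) * t ^ (-(1 + α)) * δ ^ (-β))) *
        ENNReal.ofReal (c * k ^ (2 - r) * I) ^ α :=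
        mul_le_mul_right (ENNReal.rpow_le_rpow hY hα0.le) _
    _ = ENNReal.ofReal (C * (k ^ (2 - q) * t ^ (-(1 + α)) * δ ^ (-β)) *
        (c * k ^ (2 - r) * I) ^ α) := by
      rw [ENNReal.ofReal_rpow_of_nonneg (by positivity) hα0.le,
        ← ENNReal.ofReal_mul (by positivity)]
    _ ≤ 1 := by
      rw [ENNReal.ofReal_le_one]
      have e : C * (k ^ (2 - q) * t ^ (-(1 + α)) * δ ^ (-β)) * (c * k ^ (2 - r) * I) ^ α =
          C * c ^ α * (I ^ α * t ^ (-(1 + α))) * δ ^ (-β) * k ^ (-(r * α - (2 - p))) := by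
        rw [Real.mul_rpow (by positivity) hI, Real.mul_rpow (by positivity) (by positivity),
          ← Real.rpow_mul hk.le,
          show -(r * α - (2 - p)) = (2 - q) + (2 - r) * α by rw [hq]; ring, Real.rpow_add hk]
        ring
      rw [e]
      calc _ ≤ k ^ (r * α - (2 - p)) * k ^ (-(r * α - (2 - p))) := by gcongr
        _ = 1 := by rw [← Real.rpow_add hk]; simp

lemma rpow_two_sub_le_one {A k : ℝ} (hA : 0 < A) (hp2 : p < 2) (h : A ^ (1 / (2 - p)) ≤ k) :
    A * k ^ (p - 2) ≤ 1 := by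
  have h2 : 0 < 2 - p := by linarith
  have hk : 0 < k := lt_of_lt_of_le (by positivity) h
  have h1 : A ≤ k ^ (2 - p) := by
    have := Real.rpow_le_rpow (by positivity) h h2.le
    rwa [← Real.rpow_mul hA.le, one_div_mul_cancel h2.ne', Real.rpow_one] at this
  rw [show p - 2 = -(2 - p) by ring, Real.rpow_neg hk.le, ← div_eq_mul_inv,
    div_le_one (by positivity)]
  exact h1

/-- The a priori bound, on time intervals with positive distance to `0` and `t`. -/
theorem exists_upper_bound_of_bounded (hN : 1 ≤ N) (hp : 1 < p) (hp2 : p < 2) (hs₀ : 0 < s)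
    (hC₁ : 0 < C₁) (hC₂ : C₁ ≤ C₂) {r : ℝ} (hr : 0 < r) (hκ : 0 < r * (p * s / N) - (2 - p)) :
    ∃ C : ℝ, 0 < C ∧
    ∀ {Ω : Set (RN N)} {T : EReal} {K K' : RN N × RN N × ℝ → ℝ} {u u' : RN N × ℝ → ℝ},
      MeasurableVersion p s C₁ C₂ Ω T K u K' u' →
      ∀ {ε b ρ t D I M : ℝ} {x₀ : RN N}, 0 < ε → ε ≤ t / 4 → t / 2 < b → (b : EReal) < T →
        0 < ρ → 0 ≤ D → CompactlyIn (Metric.ball x₀ ρ) Ω →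
        CenteredTailBound p s x₀ (ρ / 2) ε b D u' →
        0 ≤ I → levelIntegral u' x₀ ρ ε b 0 r ≤ ENNReal.ofReal I →
        (∀ᵐ z ∂(volume.restrict (Metric.ball x₀ ρ ×ˢ Ioo ε b)), u' z ≤ M) →
        ∀ᵐ z ∂(volume.restrict (Metric.ball x₀ (ρ / 2) ×ˢ Ioo (t / 2) b)), u' z ≤
          max (max ((t / ρ ^ (p * s)) ^ (1 / (2 - p))) (t * D))
            (C * (I ^ (p * s / N) * t ^ (-(1 + p * s / N))) ^
              (1 / (r * (p * s / N) - (2 - p)))) := by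
  have hN0 : (0 : ℝ) < N := by exact_mod_cast hN
  set α := p * s / N with hα
  have hα0 : 0 < α := by positivity
  set κ := r * α - (2 - p) with hκdef
  set β := lossExponent N p s with hβ
  have hβ0 : 0 < β := by rw [hβ, lossExponent]; positivity
  set B : ℝ := 2 ^ (β / κ) with hB
  have hB1 : 1 ≤ B := Real.one_le_rpow (by norm_num) (by positivity)
  have hB0 : 0 < B := by linarith
  obtain ⟨C, hC0, hC⟩ := exists_upper_bound_improvement (N := N) hN hp hp2 hs₀ hC₁ hC₂ hr
    (by linarith : 1 ≤ 2 * B)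
  refine ⟨(C * 8 ^ β) ^ (1 / κ), by positivity, ?_⟩
  intro Ω T K K' u u' h ε b ρ t D I M x₀ hε hεt htb hb hρ hD hU hT hI hIle hM
  have ht : 0 < t := by linarith
  set J := I ^ α * t ^ (-(1 + α)) with hJ
  have hJ0 : 0 ≤ J := by positivity
  set A := t / ρ ^ (p * s) with hA
  have hA0 : 0 < A := by positivity
  set S₁ := max (A ^ (1 / (2 - p))) (t * D) with hS₁
  have hS₁0 : 0 < S₁ := lt_of_lt_of_le (by positivity) (le_max_left _ _)
  set S₂ := (C * 8 ^ β) ^ (1 / κ) * J ^ (1 / κ) with hS₂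
  have hS₂0 : 0 ≤ S₂ := by positivity
  set e : ℕ → ℝ := fun n => (1 / 2) ^ n with he
  have he0 : ∀ n, 0 < e n := fun n => by positivity
  have he1 : ∀ n, e n ≤ 1 := fun n => pow_le_one₀ (by norm_num) (by norm_num)
  have hes : ∀ n, e (n + 1) = e n / 2 := fun n => by simp only [he]; rw [pow_succ]; ring
  have hez : e 0 = 1 := pow_zero _
  have heβ : ∀ n, (e n / 8) ^ (-β) = 8 ^ β * (2 ^ β) ^ n := fun n => by
    simp only [he]
    rw [Real.rpow_neg (by positivity), ← Real.inv_rpow (by positivity), inv_div, div_eq_mul_inv,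
      Real.mul_rpow (by norm_num) (by positivity), one_div, inv_pow, inv_inv,
      ← Real.rpow_natCast, ← Real.rpow_natCast, ← Real.rpow_mul (by norm_num),
      ← Real.rpow_mul (by norm_num), mul_comm β]
  clear_value e
  set R : ℕ → ℝ := fun n => ρ * (1 - e n / 2) with hR
  set a : ℕ → ℝ := fun n => ε + (t / 2 - ε) * e n with ha
  set Upper : ℕ → ℝ → Prop := fun n m =>
    ∀ᵐ z ∂(volume.restrict (Metric.ball x₀ (R n) ×ˢ Ioo (a n) b)), u' z ≤ m with hUpper
  have hRρ : ∀ n, R n ≤ ρ := fun n =>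
    mul_le_of_le_one_right hρ.le (by linarith [he0 n])
  have haε : ∀ n, ε ≤ a n := fun n => by
    have : 0 ≤ (t / 2 - ε) * e n := mul_nonneg (by linarith) (he0 n).le
    simp only [ha]; linarith
  have hat : ∀ n, a n ≤ t / 2 := fun n => by
    have : (t / 2 - ε) * e n ≤ t / 2 - ε := mul_le_of_le_one_right (by linarith) (he1 n)
    simp only [ha]; linarith
  have mono : ∀ n m m', m ≤ m' → Upper n m → Upper n m' := fun n m m' hm hu =>
    hu.mono fun z hz => hz.trans hm
  have step : ∀ n m, Upper (n + 1) m →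
      Upper n (max (max S₁ (S₂ * B ^ n)) ((1 / (2 * B)) * m)) := by
    intro n m hm
    set k := max (max S₁ (S₂ * B ^ n)) ((1 / (2 * B)) * m) with hk
    have hk1 : S₁ ≤ k := (le_max_left _ _).trans (le_max_left _ _)
    have hk2 : S₂ * B ^ n ≤ k := (le_max_right _ _).trans (le_max_left _ _)
    have hk3 : 1 / (2 * B) * m ≤ k := le_max_right _ _
    have hk0 : 0 < k := by linarith
    have hmk : m ≤ 2 * B * k := by
      rw [one_div, inv_mul_le_iff₀ (by positivity)] at hk3
      exact hk3
    have e0 := he0 n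
    refine hC h (δ := e n / 8) (a₀ := a (n + 1)) (R₀ := R (n + 1)) (I := I) (ρ := ρ) (t := t)
      (hε.trans_le (haε _)) ((hat n).trans_lt htb) hb hρ ht
      hk0 hD (by positivity) (by linarith [he1 n]) ?_ ?_ (hRρ _) ?_ (hU.ball_mono (hRρ _)) ?_ ?_
      (ae_restrict_of_ae_restrict_of_subset (Ioo_subset_Ioo_left (haε _)) hT) hI
      ((levelIntegral_mono (hRρ _) (haε _) le_rfl hr.le).trans hIle) ?_ (mono _ _ _ hmk hm)
    · have : a n - a (n + 1) = (t / 2 - ε) * e n / 2 := by simp only [ha, hes]; ring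
      rw [this]
      nlinarith
    · simp only [hR]
      nlinarith [he1 n]
    · have : R (n + 1) - R n = ρ * e n / 4 := by simp only [hR, hes]; ring
      rw [this]
      nlinarith
    · exact rpow_two_sub_le_one hA0 hp2 ((le_max_left _ _).trans hk1)
    · exact (le_max_right _ _).trans hk1
    · rw [heβ]
      have h1 : (S₂ * B ^ n) ^ κ ≤ k ^ κ := Real.rpow_le_rpow (by positivity) hk2 hκ.le
      refine le_trans (le_of_eq ?_) h1
      rw [Real.mul_rpow hS₂0 (by positivity), hS₂, Real.mul_rpow (by positivity) (by positivity),
        ← Real.rpow_mul (by positivity), ← Real.rpow_mul hJ0, one_div_mul_cancel hκ.ne',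
        Real.rpow_one, Real.rpow_one, hB, ← Real.rpow_natCast, ← Real.rpow_natCast,
        ← Real.rpow_mul (by norm_num), ← Real.rpow_mul (by positivity),
        ← Real.rpow_mul (by norm_num), show β / κ * ((n : ℝ) * κ) = β * n by field_simp]
      change C * J * _ = _
      ring
  have iter : ∀ i n m, Upper (n + i) m →
      Upper n (max (max S₁ (S₂ * B ^ n)) ((1 / (2 * B)) ^ i * m)) := by
    intro i
    induction i with
    | zero =>
      intro n m hm
      refine mono _ _ _ ?_ hm
      rw [pow_zero, one_mul]
      exact le_max_right _ _
    | succ i ih =>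
      intro n m hm
      have h1 := step n _ (ih (n + 1) m (by rwa [show n + 1 + i = n + (i + 1) by ring]))
      refine mono _ _ _ ?_ h1
      have hb1 : 1 / (2 * B) ≤ 1 := by
        rw [div_le_one (by positivity)]; linarith
      have hb0 : 0 ≤ 1 / (2 * B) := by positivity
      rw [mul_max_of_nonneg _ _ hb0, mul_max_of_nonneg _ _ hb0]
      refine max_le (le_max_left _ _) (max_le (max_le ?_ ?_) ?_)
      · refine le_trans ?_ ((le_max_left _ _).trans (le_max_left _ _))
        exact mul_le_of_le_one_left hS₁0.le hb1
      · refine le_trans ?_ ((le_max_right _ _).trans (le_max_left _ _))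
        have : 1 / (2 * B) * (S₂ * B ^ (n + 1)) = 1 / 2 * (S₂ * B ^ n) := by
          rw [pow_succ]; field_simp
        rw [this]
        have : 0 ≤ S₂ * B ^ n := by positivity
        linarith
      · rw [← mul_assoc, ← pow_succ']
        exact le_max_right _ _
  have hlim : Tendsto (fun i : ℕ => (1 / (2 * B)) ^ i * M) atTop (𝓝 0) := by
    have := (tendsto_pow_atTop_nhds_zero_of_lt_one (r := 1 / (2 * B)) (by positivity)
      (by rw [div_lt_one (by positivity)]; linarith)).mul_const M
    rwa [zero_mul] at this
  obtain ⟨i, hi⟩ := (hlim.eventually (gt_mem_nhds hS₁0)).exists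
  have hstart : Upper (0 + i) M :=
    ae_restrict_of_ae_restrict_of_subset (prod_mono (Metric.ball_subset_ball (hRρ _))
      (Ioo_subset_Ioo_left (haε _))) hM
  have hfin := mono _ _ (max S₁ S₂) (by
    rw [pow_zero, mul_one]
    exact max_le le_rfl (hi.le.trans (le_max_left _ _))) (iter i 0 M hstart)
  have hR0 : R 0 = ρ / 2 := by simp only [hR, hez]; ring
  have ha0 : a 0 = t / 2 := by simp only [ha, hez]; ring
  simp only [hUpper, hR0, ha0] at hfin
  exact hfin

lemma scaling_identity (hN : 1 ≤ N) {e l I t ρ w : ℝ} (hI : 0 ≤ I)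
    (ht : 0 < t) (hρ : 0 < ρ) (hw : 0 < w) :
    (I ^ (e / N) * t ^ (-(1 + e / N))) ^ (N / l) =
      w ^ (e / l) * (I / (ρ ^ N * w * t)) ^ (e / l) * (t / ρ ^ e) ^ (-(N : ℝ) / l) := by
  have hN0 : (0 : ℝ) < N := by exact_mod_cast hN
  have e1 : e / N * (N / l) = e / l := by field_simp
  have e2 : -(1 + e / N) * (N / l) = -(N : ℝ) / l + -(e / l) := by field_simp; ring
  have e3 : e * (-(N : ℝ) / l) = -(N * (e / l)) := by ring
  rw [Real.mul_rpow (by positivity) (by positivity), ← Real.rpow_mul hI, ← Real.rpow_mul ht.le, e1,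
    e2, Real.rpow_add ht, Real.div_rpow hI (by positivity),
    Real.mul_rpow (by positivity) ht.le, Real.mul_rpow (by positivity) hw.le,
    ← Real.rpow_natCast ρ N, ← Real.rpow_mul hρ.le, Real.div_rpow ht.le (by positivity),
    ← Real.rpow_mul hρ.le, e3, Real.rpow_neg hρ.le, Real.rpow_neg ht.le]
  have h1 : w ^ (e / l) ≠ 0 := by positivity
  have h2 : ρ ^ ((N : ℝ) * (e / l)) ≠ 0 := by positivity
  have h3 : t ^ (e / l) ≠ 0 := by positivity
  generalize w ^ (e / l) = x1 at *
  generalize ρ ^ ((N : ℝ) * (e / l)) = x2 at *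
  generalize t ^ (e / l) = x3 at *
  generalize t ^ (-(N : ℝ) / l) = x4 at *
  generalize I ^ (e / l) = x5 at *
  field_simp

lemma centeredTailBound_of_tail (hp : 1 < p) {x₀ : RN N} {ρ a b : ℝ} (hρ : 0 < ρ)
    (hu : ∀ᵐ τ ∂(volume.restrict (Ioo a b)), ∀ᵐ x : RN N, u (x, τ) = u' (x, τ))
    (hT : Tail p s (fun z => max (u z) 0) x₀ ρ a b ≠ ⊤) :
    CenteredTailBound p s x₀ ρ a b
      ((Tail p s (fun z => max (u z) 0) x₀ ρ a b ^ (p - 1)).toReal / ρ ^ (p * s)) u' := by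
  have hp1 : 0 < p - 1 := by linarith
  set L := Tail p s (fun z => max (u z) 0) x₀ ρ a b with hL
  have hLp : L ^ (p - 1) ≠ ⊤ := ENNReal.rpow_ne_top_of_nonneg hp1.le hT
  have hρs : 0 < ρ ^ (p * s) := by positivity
  filter_upwards [hu, ENNReal.ae_le_essSup (μ := volume.restrict (Ioo a b)) fun τ =>
      (ENNReal.ofReal (ρ ^ (p * s)) * ∫⁻ x in (Metric.ball x₀ ρ)ᶜ,
        ENNReal.ofReal (|max (u (x, τ)) 0| ^ (p - 1) / ‖x - x₀‖ ^ ((N : ℝ) + p * s)))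
        ^ (1 / (p - 1))] with τ hτ hle
  change _ ≤ L at hle
  replace hle := ENNReal.rpow_le_rpow hle hp1.le
  rw [← ENNReal.rpow_mul, one_div_mul_cancel hp1.ne', ENNReal.rpow_one] at hle
  have e : ∫⁻ y in (Metric.ball x₀ ρ)ᶜ,
      ENNReal.ofReal (max (u' (y, τ)) 0 ^ (p - 1) / ‖y - x₀‖ ^ ((N : ℝ) + p * s)) =
      ∫⁻ x in (Metric.ball x₀ ρ)ᶜ,
        ENNReal.ofReal (|max (u (x, τ)) 0| ^ (p - 1) / ‖x - x₀‖ ^ ((N : ℝ) + p * s)) := by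
    refine lintegral_congr_ae ?_
    filter_upwards [ae_restrict_of_ae hτ] with x hx
    rw [hx, abs_of_nonneg (le_max_right _ _)]
  rw [e, ENNReal.ofReal_div_of_pos hρs, ENNReal.ofReal_toReal hLp, ENNReal.le_div_iff_mul_le
    (Or.inl (by simpa using hρs)) (Or.inl ENNReal.ofReal_ne_top), mul_comm]
  exact hle

lemma ae_restrict_Ioo_of_forall {P : RN N × ℝ → Prop} {B : Set (RN N)} {t : ℝ} (ht : 0 < t)
    (h : ∀ ε, 0 < ε → ε ≤ t / 4 → ∀ᵐ z ∂(volume.restrict (B ×ˢ Ioo (t / 2) (t - ε))), P z) :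
    ∀ᵐ z ∂(volume.restrict (B ×ˢ Ioo (t / 2) t)), P z := by
  have hun : B ×ˢ Ioo (t / 2) t ⊆ ⋃ n : ℕ, B ×ˢ Ioo (t / 2) (t - t / 4 * (1 / ((n : ℝ) + 1))) := by
    rintro ⟨x, τ⟩ ⟨hx, h1, h2⟩
    have hlim : Tendsto (fun n : ℕ => t - t / 4 * (1 / ((n : ℝ) + 1))) atTop (𝓝 (t - t / 4 * 0)) :=
      (tendsto_one_div_add_atTop_nhds_zero_nat.const_mul _).const_sub _
    rw [mul_zero, sub_zero] at hlim
    obtain ⟨n, hn⟩ := (hlim.eventually (lt_mem_nhds h2)).exists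
    exact mem_iUnion.2 ⟨n, hx, h1, hn⟩
  refine ae_restrict_of_ae_restrict_of_subset hun ?_
  rw [ae_restrict_iUnion_iff]
  intro n
  refine h _ (by positivity) ?_
  refine mul_le_of_le_one_right (by positivity) ?_
  rw [div_le_one (by positivity)]
  have : (0 : ℝ) ≤ n := by positivity
  linarith

lemma setLAverage_rpow_eq (hu : Measurable u') (x₀ : RN N) {ρ t : ℝ} (hρ : 0 < ρ)
    {r : ℝ} (hr : 0 < r)
    (hae : ∀ᵐ z ∂(volume.restrict (Metric.ball x₀ ρ ×ˢ Ioo 0 t)), u z = u' z) :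
    ⨍⁻ z in Metric.ball x₀ ρ ×ˢ Ioo 0 t, ENNReal.ofReal (u z) ^ r ∂volume =
      levelIntegral u' x₀ ρ 0 t 0 r /
        ENNReal.ofReal (ρ ^ N * (volume (Metric.ball (0 : RN N) 1)).toReal * t) := by
  have hw := volume_unitBall_pos N
  rw [setLAverage_eq, levelIntegral_eq_lintegral_prod hu]
  congr 1
  · refine lintegral_congr_ae ?_
    filter_upwards [hae] with z hz
    rw [hz, sub_zero, ← ENNReal.ofReal_rpow_of_nonneg (le_max_right _ _) hr.le, ENNReal.ofReal_max,
      ENNReal.ofReal_zero, max_eq_left zero_le]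
  · rw [Measure.volume_eq_prod, Measure.prod_prod, volume_ball_RN x₀ hρ, Real.volume_Ioo, sub_zero,
      ← ENNReal.ofReal_mul (by positivity)]

/-- The **`L^r`-`L^∞` estimate** for locally bounded local weak solutions. -/
theorem exists_essSup_le (hN : 1 ≤ N) (hp : 1 < p) (hp2 : p < 2) (hs₀ : 0 < s) (hs₁ : s < 1)
    (hC₁ : 0 < C₁) (hC₂ : C₁ ≤ C₂) {r : ℝ} (hr : 0 < r) (hlam : 0 < lam N p s r) :
    ∃ γ : ℝ, 0 < γ ∧
      ∀ (Ω : Set (RN N)) (T : EReal) (K : RN N × RN N × ℝ → ℝ) (u : RN N × ℝ → ℝ),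
        IsKernel N p s C₁ C₂ T K →
        IsLocalWeakSolution p s Ω T K u → IsLocallyBounded Ω T u →
        ∀ (x₀ : RN N) (ρ t : ℝ), 0 < ρ → 0 < t →
          CompactlyIn (Metric.ball x₀ ρ) Ω → (t : EReal) ≤ T →
          essSup (fun z => ENNReal.ofReal (u z))
              (volume.restrict (Metric.ball x₀ (ρ / 2) ×ˢ Ioo (t / 2) t)) ≤
            ENNReal.ofReal γ
                * (⨍⁻ z in Metric.ball x₀ ρ ×ˢ Ioo 0 t, ENNReal.ofReal (u z) ^ r ∂volume)
                    ^ (p * s / lam N p s r)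
                * ENNReal.ofReal ((t / ρ ^ (p * s)) ^ (-(N : ℝ) / lam N p s r))
              + ENNReal.ofReal γ
                * ENNReal.ofReal ((t / ρ ^ (p * s)) ^ (1 / (2 - p)))
                * max 1 (ENNReal.ofReal ((t / ρ ^ (p * s)) ^ ((1 - p) / (2 - p)))
                    * Tail p s (fun z => max (u z) 0) x₀ (ρ / 2) 0 t ^ (p - 1)) := by
  have hN0 : (0 : ℝ) < N := by exact_mod_cast hN
  set l := lam N p s r with hl
  have hκ : r * (p * s / N) - (2 - p) = l / N := by
    rw [hl, lam]; field_simp; ring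
  have hκ0 : 0 < r * (p * s / N) - (2 - p) := by rw [hκ]; positivity
  obtain ⟨C, hC0, hC⟩ := exists_upper_bound_of_bounded hN hp hp2 hs₀ hC₁ hC₂ hr hκ0
  have hinv : 1 / (r * (p * s / N) - (2 - p)) = N / l := by rw [hκ, one_div_div]
  rw [hinv] at hC
  set w := (volume (Metric.ball (0 : RN N) 1)).toReal with hw
  have hw0 : 0 < w := volume_unitBall_pos N
  have hps : 0 < p * s := by positivity
  have h2ps : (1 : ℝ) ≤ 2 ^ (p * s) := Real.one_le_rpow (by norm_num) hps.le
  set γ := 2 ^ (p * s) + C * w ^ (p * s / l) with hγ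
  have hCw : 0 < C * w ^ (p * s / l) := by positivity
  have hγ0 : 0 < γ := by positivity
  have hγ1 : 1 ≤ γ := by linarith
  refine ⟨γ, hγ0, ?_⟩
  intro Ω T K u hK hu hbdd x₀ ρ t hρ ht hU htT
  obtain ⟨K', u', h, hae⟩ := exists_measurableVersion hN hp hp2 hs₀ hs₁ hC₁ hC₂ hK hu
  have htime : Ioo 0 t ⊆ timeDom T := fun τ hτ =>
    ⟨hτ.1, lt_of_lt_of_le (by exact_mod_cast hτ.2) htT⟩
  have hae' : ∀ B : Set (RN N), ∀ I ⊆ Ioo 0 t, ∀ᵐ z ∂(volume.restrict (B ×ˢ I)), u z = u' z :=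
    fun B I hI => ae_restrict_of_ae_restrict_of_subset
      (prod_mono (subset_univ _) (hI.trans htime)) hae
  rw [setLAverage_rpow_eq h.meas x₀ hρ hr (hae' _ _ subset_rfl)]
  set A := t / ρ ^ (p * s) with hA
  have hA0 : 0 < A := by positivity
  set L := Tail p s (fun z => max (u z) 0) x₀ (ρ / 2) 0 t with hL
  have hp1 : 0 < p - 1 := by linarith
  have pos : ∀ {x : ℝ}, 0 < x → ENNReal.ofReal x ≠ 0 := fun hx => by simpa using hx
  rcases eq_or_ne L ⊤ with hLt | hLt
  · rw [hLt, ENNReal.top_rpow_of_pos hp1, ENNReal.mul_top (pos (by positivity)),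
      max_eq_right le_top, ENNReal.mul_top (mul_ne_zero (pos hγ0) (pos (by positivity))), add_top]
    exact le_top
  set J := levelIntegral u' x₀ ρ 0 t 0 r with hJ
  rcases eq_or_ne J ⊤ with hJt | hJt
  · rw [hJt, ENNReal.top_div_of_ne_top ENNReal.ofReal_ne_top,
      ENNReal.top_rpow_of_pos (by positivity), ENNReal.mul_top (pos hγ0),
      ENNReal.top_mul (pos (by positivity)), top_add]
    exact le_top
  have hLp : L ^ (p - 1) ≠ ⊤ := ENNReal.rpow_ne_top_of_nonneg hp1.le hLt
  have hρ2 : 0 < ρ / 2 := half_pos hρ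
  set D := (L ^ (p - 1)).toReal / (ρ / 2) ^ (p * s) with hD
  have hD0 : 0 ≤ D := by positivity
  have hT := centeredTailBound_of_tail hp hρ2 (h.ae_eq_of_subset htime) hLt
  have hmain : ∀ᵐ z ∂(volume.restrict (Metric.ball x₀ (ρ / 2) ×ˢ Ioo (t / 2) t)), u' z ≤
      max (max (A ^ (1 / (2 - p))) (t * D))
        (C * (J.toReal ^ (p * s / N) * t ^ (-(1 + p * s / N))) ^ (N / l)) := by
    refine ae_restrict_Ioo_of_forall ht fun ε hε hεt => ?_
    have hb : ((t - ε : ℝ) : EReal) < T :=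
      lt_of_lt_of_le (by exact_mod_cast (by linarith : t - ε < t)) htT
    have hsub : Ioo ε (t - ε) ⊆ Ioo 0 t := Ioo_subset_Ioo hε.le (by linarith)
    obtain ⟨M, hM⟩ := hbdd _ hU ε (t - ε) hε (by linarith) hb
    refine hC h hε hεt (by linarith) hb hρ hD0 hU
      (ae_restrict_of_ae_restrict_of_subset hsub hT) ENNReal.toReal_nonneg ?_ (M := M) ?_
    · rw [ENNReal.ofReal_toReal hJt, hJ, levelIntegral_eq_lintegral_prod h.meas,
        levelIntegral_eq_lintegral_prod h.meas]
      exact lintegral_mono_set (prod_mono_right hsub)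
    · filter_upwards [hM, hae' (Metric.ball x₀ ρ) _ hsub] with z h1 h2
      rw [← h2]
      exact (le_abs_self _).trans h1
  refine essSup_le_of_ae_le _ ?_
  filter_upwards [hmain, hae' (Metric.ball x₀ (ρ / 2)) (Ioo (t / 2) t)
    (Ioo_subset_Ioo_left (by linarith))] with z hz hzu
  rw [hzu]
  refine (ENNReal.ofReal_le_ofReal hz).trans ?_
  rw [ENNReal.ofReal_max, ENNReal.ofReal_max]
  refine max_le (le_add_left (max_le ?_ ?_)) (le_add_right ?_)
  · calc ENNReal.ofReal (A ^ (1 / (2 - p))) = 1 * ENNReal.ofReal (A ^ (1 / (2 - p))) * 1 := by simp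
      _ ≤ _ := mul_le_mul' (mul_le_mul_left (ENNReal.one_le_ofReal.2 hγ1) _) (le_max_left _ _)
  · have e1 : A = A ^ (1 / (2 - p)) * A ^ ((1 - p) / (2 - p)) := by
      rw [← Real.rpow_add hA0, ← add_div, show 1 + (1 - p) = 2 - p by ring,
        div_self (by linarith), Real.rpow_one]
    have e2 : t * D = 2 ^ (p * s) * A ^ (1 / (2 - p)) *
        (A ^ ((1 - p) / (2 - p)) * (L ^ (p - 1)).toReal) := by
      have : t * D = 2 ^ (p * s) * A * (L ^ (p - 1)).toReal := by
        rw [hD, hA, Real.div_rpow hρ.le (by norm_num)]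
        field_simp
      rw [this]
      nth_rewrite 1 [e1]
      ring
    rw [e2, ENNReal.ofReal_mul (by positivity), ENNReal.ofReal_mul (by positivity),
      ENNReal.ofReal_mul (by positivity), ENNReal.ofReal_toReal hLp]
    refine mul_le_mul' (mul_le_mul_left (ENNReal.ofReal_le_ofReal ?_) _) (le_max_right _ _)
    linarith
  · rw [scaling_identity hN (l := l) ENNReal.toReal_nonneg ht hρ hw0, ← ENNReal.ofReal_toReal hJt,
      ENNReal.toReal_ofReal ENNReal.toReal_nonneg, ← ENNReal.ofReal_div_of_pos (by positivity),
      ENNReal.ofReal_rpow_of_nonneg (by positivity) (by positivity),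
      ← ENNReal.ofReal_mul hγ0.le, ← ENNReal.ofReal_mul (by positivity)]
    refine ENNReal.ofReal_le_ofReal ?_
    rw [← mul_assoc, ← mul_assoc]
    gcongr
    linarith

end FracPLap

/-- The `L^r`-`L^∞` estimate for locally bounded local weak solutions, and local boundedness of
every local weak solution in the supercritical range. All quantities in the estimate are taken in
`[0,∞]`, so that the averages and the tail are meaningful also when they are infinite. -/
theorem theorem1p1 (N : ℕ) (hN : 1 ≤ N) (p s C₁ C₂ : ℝ) (hp₁ : 1 < p) (hp₂ : p < 2)
    (hs₀ : 0 < s) (hs₁ : s < 1) (hC₁ : 0 < C₁) (hC₂ : C₁ ≤ C₂) :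
    (∀ r : ℝ, 1 ≤ r → 0 < lam N p s r → (pCrit N s < p → r < 2) →
      ∃ γ : ℝ, 0 < γ ∧
        ∀ (Ω : Set (RN N)) (T : EReal) (K : RN N × RN N × ℝ → ℝ) (u : RN N × ℝ → ℝ),
          IsOpen Ω → 0 < T → IsKernel N p s C₁ C₂ T K →
          IsLocalWeakSolution p s Ω T K u → IsLocallyBounded Ω T u →
          ∀ (x₀ : RN N) (ρ t : ℝ), 0 < ρ → 0 < t →
            Metric.ball x₀ (4 * ρ) ⊆ Ω → (t : EReal) ≤ T →
            (∀ᵐ z ∂(volume.restrict (Metric.ball x₀ (4 * ρ) ×ˢ Ioo 0 t)), 0 ≤ u z) →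
            essSup (fun z => ENNReal.ofReal (u z))
                (volume.restrict (Metric.ball x₀ (ρ / 2) ×ˢ Ioo (t / 2) t)) ≤
              ENNReal.ofReal γ
                  * (⨍⁻ z in Metric.ball x₀ ρ ×ˢ Ioo 0 t, ENNReal.ofReal (u z) ^ r ∂volume)
                      ^ (p * s / lam N p s r)
                  * ENNReal.ofReal ((t / ρ ^ (p * s)) ^ (-(N : ℝ) / lam N p s r))
                + ENNReal.ofReal γ
                  * ENNReal.ofReal ((t / ρ ^ (p * s)) ^ (1 / (2 - p)))
                  * max 1 (ENNReal.ofReal ((t / ρ ^ (p * s)) ^ ((1 - p) / (2 - p)))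
                      * Tail p s (fun z => max (u z) 0) x₀ (ρ / 2) 0 t ^ (p - 1))) ∧
    (pCrit N s < p →
      ∀ (Ω : Set (RN N)) (T : EReal) (K : RN N × RN N × ℝ → ℝ) (u : RN N × ℝ → ℝ),
        IsOpen Ω → 0 < T → IsKernel N p s C₁ C₂ T K →
        IsLocalWeakSolution p s Ω T K u → IsLocallyBounded Ω T u) := by
  refine ⟨fun r hr hlam _ => ?_, fun hpc Ω T K u hΩ _ hK hu =>
    hu.isLocallyBounded hN hp₁ hp₂ hs₀ hs₁ hC₁ hC₂ hpc hΩ hK⟩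
  obtain ⟨γ, hγ, hmain⟩ := exists_essSup_le (N := N) hN hp₁ hp₂ hs₀ hs₁ hC₁ hC₂
    (by linarith : 0 < r) hlam
  refine ⟨γ, hγ, fun Ω T K u _ _ hK hu hbdd x₀ ρ t hρ ht hball htT _ => ?_⟩
  refine hmain Ω T K u hK hu hbdd x₀ ρ t hρ ht ?_ htT
  refine ⟨Metric.isOpen_ball, (isCompact_closedBall x₀ ρ).of_isClosed_subset isClosed_closure
    Metric.closure_ball_subset_closedBall, Metric.closure_ball_subset_closedBall.trans ?_⟩
  exact (Metric.closedBall_subset_ball (by linarith)).trans hball
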